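/- Let $G$ be a countable discrete group that is amenable, i.e. there is a sequence $(\Phi_n)_{n\in\mathbb N}$ of finite subsets of $G$ (a right Følner sequence) such that $\lim_{n\to\infty} |\Phi_n\cap \Phi_n g|/|\Phi_n| = 1$ for every $g\in G$. For a sequence $(x_n)_{n\in\mathbb N}$ in $G$, its left finite product set is $$\mathbf{FP}_L(x_n)=\{x_{n_k}x_{n_{k-1}}\cdots x_{n_1} : k\ge 1,\ n_1<n_2<\dots<n_k\},$$ i.e. the set of all products over finite nonempty index sets, with the indices taken in decreasing order. A subset of $G$ is a left IP set if it contains $\mathbf{FP}_L(x_n)$ for some sequence $(x_n)_{n\in\mathbb N}$ in $G$, and a subset of $G$ is left IP$^{\ast}$ if it has nonempty intersection with every left IP set. Then for every finite partition $G\times G=C_1\cup\dots\cup C_r$ into pairwise disjoint sets there is $j\in\{1,\dots,r\}$ such that the set $$\{g\in G : \text{there exists } (x,y)\in G\times G \text{ such that } \{(x,y),(xg,y),(xg,yg)\}\subseteq C_j\}$$ is left IP$^{\ast}$. -/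

import Mathlib

open Filter Topology

open Classical in
/-- A right Følner sequence in a group: a sequence of finite sets `Φ n` such that
`|Φ n ∩ (Φ n) g| / |Φ n| → 1` for every `g`. (The limit forces `Φ n` to be nonempty for all
large `n`.) -/
def IsRightFolnerSeq {G : Type*} [Group G] (Φ : ℕ → Finset G) : Prop :=
  ∀ g : G, Tendsto
    (fun n => ((Φ n ∩ (Φ n).image (fun a => a * g)).card : ℝ) / ((Φ n).card : ℝ)) atTop (𝓝 1)

/-- Amenability of a countable discrete group: a right Følner sequence exists. -/
def IsAmenableGroup (G : Type*) [Group G] : Prop :=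
  ∃ Φ : ℕ → Finset G, IsRightFolnerSeq Φ

/-- The product of the `x n`, `n ∈ F`, with the indices in decreasing order. -/
def decreasingProd {G : Type*} [Group G] (x : ℕ → G) (F : Finset ℕ) : G :=
  ((F.sort (fun a b => a ≥ b)).map x).prod

/-- The left finite product set of a sequence. -/
def leftFP {G : Type*} [Group G] (x : ℕ → G) : Set G :=
  {g | ∃ F : Finset ℕ, F.Nonempty ∧ g = decreasingProd x F}

/-- A left IP set: a set that contains a left finite product set. -/
def IsLeftIP {G : Type*} [Group G] (Y : Set G) : Prop :=
  ∃ x : ℕ → G, leftFP x ⊆ Y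

/-- A left IP* set: a set that meets every left IP set. -/
def IsLeftIPStar {G : Type*} [Group G] (X : Set G) : Prop :=
  ∀ Y : Set G, IsLeftIP Y → (X ∩ Y).Nonempty

/-! Furstenberg's correspondence (`exists_invariant_measure`) turns the colouring into a point of
the compact space of all colourings. Averaging over the Følner sets gives a probability measure
invariant under two commuting translation actions `T` and `S`. Some set `ω (1, 1) = j` has positive
measure, and this fixes the colour. Every left finite product set belongs to an idempotent
ultrafilter `p`, so it suffices that for `A` of positive measure the event `x, T h x, S h (T h x) ∈
A` has positive measure for `p`-most `h` (`frequently_measureReal_corner_ne_zero`).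

Idempotence enters in two ways. Weak limits of orbits along `p` are rigid (`exists_rigid_limit`), so
the weak limit of `φ ∘ S g` is the conditional expectation of `φ` on the σ-algebra `B` of `S`-rigid
sets. And a positive semidefinite kernel with bounded diagonal cannot satisfy `k g (g * h) < -ε` for
`p`-most `h` and `p`-most `g` (`kernel_nonneg`). This plays the role of van der Corput's lemma.

Next comes a splitting into structure and randomness. A function orthogonal to the sets that are
almost periodic for `T` relative to `B` is mixing relative to `B`
(`tendsto_integral_mul_condExp_zero`), so at the middle vertex it contributes nothing to corners
(`tendsto_integral_corner_zero`). The middle vertex may therefore be tested against an almost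
periodic set `D`, with `A ∩ D` at the other two.

The structured case (`not_tendsto_integral_corner_zero`) is a comparison of moments, for `A ⊆ D`.
Let `q h` be the conditional expectation on `B` of `1_D · 1_D ∘ T h`, let `Y` be a rigid set where
the conditional probability of `A` is at least `c` and that of `D` lies in `[t, t + η)`, and let `M
n` be the integral of `(q h) ^ n` over `Y ∩ (T h)⁻¹ Y`. Positivity bounds the correlation of `A ∩ Y`
with its `S h T h`-translate, weighted by `(q h) ^ n`, below by `c ^ 2 / 4 * M n`, up to a small
error. If corners vanish in the limit, then `T h x` lies essentially outside `D` whenever both outer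
vertices lie in `A`, and the same correlation is at most about `(t + η) * M n - M (n + 1)`. With `c
^ 2 / 4 = 2 * η` this forces `M n ≤ (t - η) ^ n` up to a small error. Almost periodicity of `D`,
however, keeps `q h` above `t - η / 2` on a set of measure `κ > 0` independent of `n`, which is
impossible for large `n`. -/

/-- `p` is idempotent for the product in which the later factor stands on the left. -/
def IsIdempotentFilter {G : Type*} [Group G] (p : Ultrafilter G) : Prop :=
  ∀ Q : G → Prop, (∀ᶠ g in (p : Filter G), Q g) →
    ∀ᶠ h in (p : Filter G), ∀ᶠ g in (p : Filter G), Q (g * h)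

/-! ### Positive semidefinite kernels along an idempotent ultrafilter. -/

namespace IsIdempotentFilter

variable {G : Type*} [Group G] {p : Ultrafilter G}

/-- The list grows by choosing a generic `g`, multiplying every entry by `g` on the left and
prepending `g`. Old quotients `v⁻¹ * w` are unchanged, and the new ones `g⁻¹ * (g * w)` are old
entries. The statements about `p`-most further translations are carried along so that the induction
can continue. -/
theorem exists_list (hp : IsIdempotentFilter p) {Q : G → Prop} {R : G → G → Prop}
    (hQ : ∀ᶠ g in (p : Filter G), Q g)
    (hR : ∀ h, Q h → ∀ᶠ g in (p : Filter G), R g h) (N : ℕ) :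
    ∃ L : List G, L.length = N ∧ (∀ v ∈ L, Q v ∧ ∀ᶠ g in (p : Filter G), Q (g * v)) ∧
      L.Pairwise (fun v w => Q (v⁻¹ * w) ∧ ∀ᶠ g in (p : Filter G), R (g * v) (v⁻¹ * w)) := by
  classical
  induction N with
  | zero => exact ⟨[], rfl, by simp, by simp⟩
  | succ N ih =>
    obtain ⟨L, hL, h1, h2⟩ := ih
    have e1 : ∀ᶠ g in (p : Filter G), ∀ v ∈ L.toFinset,
        Q (g * v) ∧ ∀ᶠ g' in (p : Filter G), Q (g' * (g * v)) := by
      rw [Filter.eventually_all_finset]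
      intro v hv
      have hv' := (h1 v (by simpa using hv)).2
      filter_upwards [hv', hp _ hv'] with g hg hg'
      exact ⟨hg, by simpa [mul_assoc] using hg'⟩
    have e2 : ∀ᶠ g in (p : Filter G), ∀ v ∈ L.toFinset,
        ∀ᶠ g' in (p : Filter G), R (g' * g) v := by
      rw [Filter.eventually_all_finset]
      intro v hv
      exact hp _ (hR v (h1 v (by simpa using hv)).1)
    have e3 : ∀ᶠ g in (p : Filter G), ∀ v ∈ L.toFinset, ∀ w ∈ L.toFinset,
        (∀ᶠ g' in (p : Filter G), R (g' * v) (v⁻¹ * w)) →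
          ∀ᶠ g' in (p : Filter G), R (g' * (g * v)) (v⁻¹ * w) := by
      rw [Filter.eventually_all_finset]
      intro v _
      rw [Filter.eventually_all_finset]
      intro w _
      by_cases h : ∀ᶠ g' in (p : Filter G), R (g' * v) (v⁻¹ * w)
      · filter_upwards [hp _ h] with g hg _
        simpa [mul_assoc] using hg
      · exact Eventually.of_forall fun g h' => absurd h' h
    obtain ⟨g, hg0, hg1, hg2, hg3, hg4⟩ :=
      (hQ.and ((hp _ hQ).and (e1.and (e2.and e3)))).exists
    refine ⟨g :: L.map (g * ·), by simp [hL], ?_, ?_⟩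
    · intro v hv
      rcases List.mem_cons.1 hv with rfl | hv
      · exact ⟨hg0, hg1⟩
      · obtain ⟨w, hw, rfl⟩ := List.mem_map.1 hv
        exact hg2 w (by simpa using hw)
    · rw [List.pairwise_cons]
      constructor
      · intro v hv
        obtain ⟨w, hw, rfl⟩ := List.mem_map.1 hv
        rw [inv_mul_cancel_left]
        exact ⟨(h1 w hw).1, hg3 w (by simpa using hw)⟩
      · rw [List.pairwise_map]
        refine h2.imp_of_mem ?_
        intro v w hv hw hvw
        have : (g * v)⁻¹ * (g * w) = v⁻¹ * w := by group
        rw [this]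
        exact ⟨hvw.1, hg4 v (by simpa using hv) w (by simpa using hw) hvw.2⟩

theorem exists_fin (hp : IsIdempotentFilter p) {Q : G → Prop} {R : G → G → Prop}
    (hQ : ∀ᶠ g in (p : Filter G), Q g)
    (hR : ∀ h, Q h → ∀ᶠ g in (p : Filter G), R g h) (N : ℕ) :
    ∃ v : Fin N → G, (∀ i, Q (v i)) ∧
      ∀ i j, i < j → Q ((v i)⁻¹ * v j) ∧ R (v i) ((v i)⁻¹ * v j) := by
  obtain ⟨L, rfl, h1, h2⟩ := hp.exists_list hQ hR N
  have e1 : ∀ᶠ g in (p : Filter G), ∀ i j : Fin L.length, i < j →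
      R (g * L.get i) ((L.get i)⁻¹ * L.get j) := by
    rw [eventually_all]
    intro i
    rw [eventually_all]
    intro j
    by_cases hij : i < j
    · filter_upwards [((List.pairwise_iff_get.1 h2) i j hij).2] with g hg _
      exact hg
    · exact Eventually.of_forall fun g h => absurd h hij
  have e2 : ∀ᶠ g in (p : Filter G), ∀ i : Fin L.length, Q (g * L.get i) := by
    rw [eventually_all]
    exact fun i => (h1 _ (L.get_mem i)).2
  obtain ⟨g, hg1, hg2⟩ := (e1.and e2).exists
  -- One last generic translation turns the statements about `p`-most translations into actual ones.
  refine ⟨fun i => g * L.get i, hg2, fun i j hij => ?_⟩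
  have : (g * L.get i)⁻¹ * (g * L.get j) = (L.get i)⁻¹ * L.get j := by group
  rw [this]
  exact ⟨((List.pairwise_iff_get.1 h2) i j hij).1, hg1 i j hij⟩

/-- Otherwise there are arbitrarily many points whose off-diagonal kernel values are all below `-ε`.
With `N` of them the full sum is at most `N * (C + ε - N * ε)`, which is negative for large `N`. -/
theorem kernel_nonneg (hp : IsIdempotentFilter p) {k : G → G → ℝ} (hsymm : ∀ g h, k g h = k h g)
    (hpos : ∀ (N : ℕ) (v : Fin N → G), 0 ≤ ∑ i, ∑ j, k (v i) (v j))
    {C : ℝ} (hC : ∀ g, k g g ≤ C) {ε : ℝ} (hε : 0 < ε) :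
    ¬ ∀ᶠ h in (p : Filter G), ∀ᶠ g in (p : Filter G), k g (g * h) < -ε := by
  intro H
  obtain ⟨N, hN⟩ := exists_nat_gt ((C + ε) / ε)
  obtain ⟨v, -, hv⟩ := hp.exists_fin (Q := fun h => ∀ᶠ g in (p : Filter G), k g (g * h) < -ε)
    (R := fun g h => k g (g * h) < -ε) H (fun h hh => hh) N
  have hlt : ∀ i j, i ≠ j → k (v i) (v j) ≤ -ε := by
    intro i j hij
    rcases lt_or_gt_of_ne hij with h | h
    · have := (hv i j h).2
      rw [mul_inv_cancel_left] at this
      exact this.le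
    · have := (hv j i h).2
      rw [mul_inv_cancel_left] at this
      rw [hsymm]
      exact this.le
  have hle : ∀ i, ∑ j, k (v i) (v j) ≤ (C + ε) - N * ε := by
    intro i
    calc ∑ j, k (v i) (v j) ≤ ∑ j, ((if i = j then (C + ε) else 0) - ε) := by
          refine Finset.sum_le_sum fun j _ => ?_
          split_ifs with h
          · subst h
            linarith [hC (v i)]
          · linarith [hlt i j h]
      _ = _ := by simp [Finset.sum_sub_distrib]
  have hneg : (C + ε) - N * ε < 0 := by
    rw [div_lt_iff₀ hε] at hN
    linarith
  have hNpos : 0 < N := by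
    rcases Nat.eq_zero_or_pos N with rfl | h
    · exfalso
      have h0 := hpos 1 (fun _ => 1)
      simp at h0
      have := hC 1
      simp at hneg
      linarith
    · exact h
  have := hpos N v
  have h2 : ∑ i, ∑ j, k (v i) (v j) ≤ N * ((C + ε) - N * ε) := by
    calc _ ≤ ∑ i : Fin N, ((C + ε) - N * ε) := Finset.sum_le_sum fun i _ => hle i
      _ = _ := by rw [Finset.sum_const, Finset.card_univ, Fintype.card_fin, nsmul_eq_mul]
  have : (N : ℝ) * ((C + ε) - N * ε) < 0 := mul_neg_of_pos_of_neg (by exact_mod_cast hNpos) hneg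
  linarith

end IsIdempotentFilter

/-- A bounded real function converges along an ultrafilter. -/
theorem Ultrafilter.exists_tendsto_of_bounded {α : Type*} (p : Ultrafilter α) {f : α → ℝ} {C : ℝ}
    (h : ∀ a, |f a| ≤ C) : ∃ l, Tendsto f p (𝓝 l) := by
  obtain ⟨l, -, hl⟩ := (isCompact_Icc (a := -C) (b := C)).ultrafilter_le_nhds (p.map f)
    (by
      rw [Ultrafilter.coe_map, le_principal_iff, Filter.mem_map]
      exact univ_mem' fun a => abs_le.1 (h a))
  exact ⟨l, hl⟩

/-! ### Weak limits of isometries along an ultrafilter. -/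

section Hilbert

variable {G : Type*} [Group G] {p : Ultrafilter G}
  {H : Type*} [NormedAddCommGroup H] [InnerProductSpace ℝ H] [CompleteSpace H]

open scoped InnerProductSpace

theorem exists_weak_limit_operator {ι : Type*} (p : Ultrafilter ι) (U : ι → H →ₗᵢ[ℝ] H) :
    ∃ W : H →L[ℝ] H, ∀ x y, Tendsto (fun g => ⟪U g x, y⟫_ℝ) p (𝓝 ⟪W x, y⟫_ℝ) := by
  have hb : ∀ x y g, |⟪U g x, y⟫_ℝ| ≤ ‖x‖ * ‖y‖ := fun x y g => by
    simpa using abs_real_inner_le_norm (U g x) y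
  choose B hB using fun x y => p.exists_tendsto_of_bounded (hb x y)
  have hB' : ∀ x y l, Tendsto (fun g => ⟪U g x, y⟫_ℝ) p (𝓝 l) → B x y = l := fun x y l h =>
    tendsto_nhds_unique (hB x y) h
  let L : H →ₗ[ℝ] H →ₗ[ℝ] ℝ := LinearMap.mk₂ ℝ B
    (fun x x' y => hB' _ _ _ (by simpa [inner_add_left] using (hB x y).add (hB x' y)))
    (fun c x y => hB' _ _ _ (by simpa [inner_smul_left] using (hB x y).const_mul c))
    (fun x y y' => hB' _ _ _ (by simpa [inner_add_right] using (hB x y).add (hB x y')))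
    (fun c x y => hB' _ _ _ (by simpa [inner_smul_right] using (hB x y).const_mul c))
  have hL : ∀ x y, ‖L x y‖ ≤ 1 * ‖x‖ * ‖y‖ := fun x y => by
    rw [one_mul]
    exact le_of_tendsto (hB x y).abs (Eventually.of_forall fun g => hb x y g)
  refine ⟨InnerProductSpace.continuousLinearMapOfBilin (𝕜 := ℝ) (L.mkContinuous₂ 1 hL), ?_⟩
  intro x y
  rw [InnerProductSpace.continuousLinearMapOfBilin_apply]
  exact hB x y

/-- Weak limits of an orbit along an idempotent ultrafilter are rigid. -/
theorem IsIdempotentFilter.exists_rigid_limit (hp : IsIdempotentFilter p) (U : G → H →ₗᵢ[ℝ] H)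
    (hU : ∀ g h x, U (g * h) x = U g (U h x)) (x : H) :
    ∃ z : H, (∀ y, Tendsto (fun g => ⟪U g x, y⟫_ℝ) p (𝓝 ⟪z, y⟫_ℝ)) ∧
      Tendsto (fun g => U g z) p (𝓝 z) ∧ ⟪x, z⟫_ℝ = ‖z‖ ^ 2 ∧
      z ∈ closure (Submodule.span ℝ (Set.range fun g => U g x) : Set H) := by
  obtain ⟨W, hW⟩ := exists_weak_limit_operator p U
  -- The iterated limit, first over `g` and then over `h`, of `U g (U h x)` is `W (W x)`.
  -- Idempotence identifies it with the single limit `W x`.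
  have hWW : W (W x) = W x := by
    refine ext_inner_right ℝ fun y => ?_
    have h1 : Tendsto (fun h => ⟪W (U h x), y⟫_ℝ) p (𝓝 ⟪W (W x), y⟫_ℝ) := by
      have := hW x (W.adjoint y)
      simpa [ContinuousLinearMap.adjoint_inner_right] using this
    refine eq_of_abs_sub_le_all fun ε hε => ?_
    have e1 := h1.eventually (Metric.closedBall_mem_nhds _ (half_pos hε))
    have e2 := hp _ ((hW x y).eventually (Metric.closedBall_mem_nhds _ (half_pos hε)))
    obtain ⟨h, hh1, hh2⟩ := (e1.and e2).exists
    have h3 : |⟪W (U h x), y⟫_ℝ - ⟪W x, y⟫_ℝ| ≤ ε / 2 := by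
      refine le_of_tendsto ((hW (U h x) y).sub_const _).abs ?_
      filter_upwards [hh2] with g hg
      simpa [hU, Real.dist_eq] using hg
    rw [Real.dist_eq] at hh1
    calc |⟪W (W x), y⟫_ℝ - ⟪W x, y⟫_ℝ|
        ≤ |⟪W (W x), y⟫_ℝ - ⟪W (U h x), y⟫_ℝ| + |⟪W (U h x), y⟫_ℝ - ⟪W x, y⟫_ℝ| :=
          abs_sub_le _ _ _
      _ ≤ ε / 2 + ε / 2 := add_le_add (by rw [abs_sub_comm]; exact hh1) h3
      _ = ε := by ring
  have hrigid : Tendsto (fun g => U g (W x)) p (𝓝 (W x)) := by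
    -- The squared norm is `2 * ‖W x‖ ^ 2 - 2 * ⟪U g (W x), W x⟫`, and the inner product tends to
    -- `⟪W (W x), W x⟫ = ‖W x‖ ^ 2`.
    have h1 : Tendsto (fun g => ‖U g (W x) - W x‖ ^ 2) p (𝓝 0) := by
      have := ((hW (W x) (W x)).const_mul 2).const_sub (‖W x‖ ^ 2 + ‖W x‖ ^ 2)
      rw [hWW, real_inner_self_eq_norm_sq] at this
      convert this using 2 with g
      · rw [norm_sub_sq_real, (U g).norm_map]
        ring
      · ring
    rw [tendsto_iff_norm_sub_tendsto_zero]
    have := h1.sqrt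
    simpa using this
  refine ⟨W x, hW x, hrigid, ?_, ?_⟩
  · rw [← real_inner_self_eq_norm_sq]
    refine tendsto_nhds_unique ?_ (hW x (W x))
    have h1 : Tendsto (fun g => ⟪U g x, W x - U g (W x)⟫_ℝ + ⟪x, W x⟫_ℝ) p
        (𝓝 (0 + ⟪x, W x⟫_ℝ)) := by
      refine Tendsto.add_const _ ?_
      refine squeeze_zero_norm (a := fun g => ‖x‖ * ‖W x - U g (W x)‖) (fun g => ?_) ?_
      · simpa using norm_inner_le_norm (𝕜 := ℝ) (U g x) (W x - U g (W x))
      · have := (tendsto_const_nhds (x := W x)).sub hrigid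
        simpa using this.norm.const_mul ‖x‖
    rw [zero_add] at h1
    refine h1.congr fun g => ?_
    rw [inner_sub_right, (U g).inner_map_map]
    ring
  · rw [← Submodule.topologicalClosure_coe, SetLike.mem_coe,
      ← Submodule.orthogonal_orthogonal_eq_closure, Submodule.mem_orthogonal']
    intro y hy
    refine tendsto_nhds_unique (hW x y) ?_
    refine tendsto_const_nhds.congr fun g => ?_
    rw [Submodule.mem_orthogonal] at hy
    exact (hy _ (Submodule.subset_span ⟨g, rfl⟩)).symm

end Hilbert

open MeasureTheory

/-! ### σ-algebras attached to classes of functions. -/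

section LipschitzClass

variable {X : Type*} {m0 : MeasurableSpace X} {μ : Measure X}

/-- A class of integrable functions that is closed under binary Lipschitz operations and under
limits in `L¹`. -/
structure IsLipschitzClass (μ : Measure X) (c : (X → ℝ) → Prop) : Prop where
  zero : c fun _ => 0
  lip : ∀ f g : X → ℝ, Measurable f → Measurable g → Integrable f μ → Integrable g μ → c f → c g →
    ∀ (F : ℝ → ℝ → ℝ) (K : ℝ), (∀ a a' b b', |F a b - F a' b'| ≤ K * (|a - a'| + |b - b'|)) →
      c fun x => F (f x) (g x)
  closed : ∀ f : X → ℝ, Measurable f → Integrable f μ →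
    (∀ ε > 0, ∃ g : X → ℝ, Measurable g ∧ Integrable g μ ∧ c g ∧ ∫ x, |f x - g x| ∂μ ≤ ε) → c f

theorem exists_integral_abs_sub_le [IsFiniteMeasure μ] {f : X → ℝ} {g : ℕ → X → ℝ} {C : ℝ}
    (hf : Measurable f) (hg : ∀ n, Measurable (g n)) (hC : ∀ n x, |g n x| ≤ C)
    (h : ∀ x, Tendsto (fun n => g n x) atTop (𝓝 (f x))) {ε : ℝ} (hε : 0 < ε) :
    ∃ n, ∫ x, |f x - g n x| ∂μ ≤ ε := by
  have hfC : ∀ x, |f x| ≤ C := fun x => le_of_tendsto (h x).abs (Eventually.of_forall fun n => hC n x)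
  have : Tendsto (fun n => ∫ x, |f x - g n x| ∂μ) atTop (𝓝 (∫ x, |f x - f x| ∂μ)) := by
    refine tendsto_integral_of_dominated_convergence (fun _ => C + C)
      (fun n => ((hf.sub (hg n)).abs).aestronglyMeasurable) (integrable_const _) ?_ ?_
    · intro n
      refine Eventually.of_forall fun x => ?_
      rw [Real.norm_eq_abs, abs_abs]
      exact (abs_sub _ _).trans (add_le_add (hfC x) (hC n x))
    · exact Eventually.of_forall fun x => ((h x).const_sub _).abs
  simp only [sub_self, abs_zero, integral_zero] at this
  obtain ⟨n, hn⟩ := (this.eventually (gt_mem_nhds hε)).exists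
  exact ⟨n, hn.le⟩

theorem integrable_of_abs_le [IsFiniteMeasure μ] {f : X → ℝ} (hf : Measurable f) {C : ℝ}
    (hC : ∀ x, |f x| ≤ C) : Integrable f μ :=
  Integrable.of_bound hf.aestronglyMeasurable C (Eventually.of_forall hC)

theorem integrable_indicator_one [IsFiniteMeasure μ] {A : Set X} (hA : MeasurableSet A) :
    Integrable (A.indicator fun _ => (1 : ℝ)) μ := (integrable_const _).indicator hA

namespace IsLipschitzClass

variable [IsFiniteMeasure μ] {c : (X → ℝ) → Prop}

theorem closed_of_tendsto (h : IsLipschitzClass μ c) {f : X → ℝ} {g : ℕ → X → ℝ} {C : ℝ}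
    (hf : Measurable f) (hg : ∀ n, Measurable (g n)) (hC : ∀ n x, |g n x| ≤ C)
    (hlim : ∀ x, Tendsto (fun n => g n x) atTop (𝓝 (f x))) (hgc : ∀ n, c (g n)) : c f := by
  have hfC : ∀ x, |f x| ≤ C := fun x =>
    le_of_tendsto (hlim x).abs (Eventually.of_forall fun n => hC n x)
  refine h.closed f hf (integrable_of_abs_le hf hfC) fun ε hε => ?_
  obtain ⟨n, hn⟩ := exists_integral_abs_sub_le (μ := μ) hf hg hC hlim hε
  exact ⟨g n, hg n, integrable_of_abs_le (hg n) (hC n), hgc n, hn⟩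

theorem indicator_union (h : IsLipschitzClass μ c) {A B : Set X} (hA : MeasurableSet A)
    (hB : MeasurableSet B) (hcA : c (A.indicator fun _ => 1)) (hcB : c (B.indicator fun _ => 1)) :
    c ((A ∪ B).indicator fun _ => 1) := by
  have := h.lip _ _ (measurable_const.indicator hA) (measurable_const.indicator hB)
    (integrable_indicator_one hA) (integrable_indicator_one hB) hcA hcB max 1 (fun a a' b b' => by
      rw [one_mul]
      exact (abs_max_sub_max_le_max _ _ _ _).trans
        (max_le (le_add_of_nonneg_right (abs_nonneg _)) (le_add_of_nonneg_left (abs_nonneg _))))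
  convert this using 1
  ext x
  by_cases h1 : x ∈ A <;> by_cases h2 : x ∈ B <;> simp [h1, h2]

theorem indicator_compl (h : IsLipschitzClass μ c) {A : Set X} (hA : MeasurableSet A)
    (hcA : c (A.indicator fun _ => 1)) : c (Aᶜ.indicator fun _ => 1) := by
  have := h.lip _ _ (measurable_const.indicator hA) (measurable_const.indicator hA)
    (integrable_indicator_one hA) (integrable_indicator_one hA) hcA hcA (fun a _ => 1 - a) 1
    (fun a a' b b' => by
      rw [one_mul, sub_sub_sub_cancel_left, abs_sub_comm]
      exact le_add_of_nonneg_right (abs_nonneg _))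
  convert this using 1
  ext x
  by_cases h1 : x ∈ A <;> simp [h1]

/-- The σ-algebra of the sets whose indicator function belongs to the class. -/
@[reducible]
def sigma (h : IsLipschitzClass μ c) : MeasurableSpace X where
  MeasurableSet' A := MeasurableSet[m0] A ∧ c (A.indicator fun _ => 1)
  measurableSet_empty := ⟨MeasurableSet.empty, by simpa using h.zero⟩
  measurableSet_compl A hA := ⟨hA.1.compl, h.indicator_compl hA.1 hA.2⟩
  measurableSet_iUnion A hA := by
    have hm : MeasurableSet[m0] (⋃ i, A i) := MeasurableSet.iUnion fun i => (hA i).1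
    refine ⟨hm, ?_⟩
    have hacc : ∀ n, MeasurableSet[m0] (Set.accumulate A n) ∧
        c ((Set.accumulate A n).indicator fun _ => 1) := by
      intro n
      induction n with
      | zero => simpa [Set.accumulate_zero_nat] using hA 0
      | succ n ih =>
        rw [Set.accumulate_succ]
        exact ⟨ih.1.union (hA _).1, h.indicator_union ih.1 (hA _).1 ih.2 (hA _).2⟩
    refine h.closed_of_tendsto (C := 1) (g := fun n => (Set.accumulate A n).indicator fun _ => 1)
      (measurable_const.indicator hm) (fun n => measurable_const.indicator (hacc n).1) ?_ ?_
      fun n => (hacc n).2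
    · intro n x
      by_cases hx : x ∈ Set.accumulate A n <;> simp [hx]
    · intro x
      by_cases hx : x ∈ ⋃ i, A i
      · obtain ⟨i, hi⟩ := Set.mem_iUnion.1 hx
        rw [Set.indicator_of_mem hx]
        refine tendsto_const_nhds.congr' ?_
        filter_upwards [eventually_ge_atTop i] with n hn
        rw [Set.indicator_of_mem (Set.mem_accumulate.2 ⟨i, hn, hi⟩)]
      · rw [Set.indicator_of_notMem hx]
        refine tendsto_const_nhds.congr fun n => ?_
        rw [Set.indicator_of_notMem]
        intro h'
        obtain ⟨i, -, hi⟩ := Set.mem_accumulate.1 h'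
        exact hx (Set.mem_iUnion.2 ⟨i, hi⟩)

theorem measurableSet_sigma (h : IsLipschitzClass μ c) {A : Set X} :
    MeasurableSet[h.sigma] A ↔ MeasurableSet[m0] A ∧ c (A.indicator fun _ => 1) := Iff.rfl

theorem sigma_le (h : IsLipschitzClass μ c) : h.sigma ≤ m0 := fun _ hA => (h.measurableSet_sigma.1 hA).1

/-- The indicator of `f > r` is the pointwise limit of the Lipschitz truncations `min 1 (n * max (f
- r) 0)`, so superlevel sets inherit membership from `f`. -/
theorem measurable_sigma (h : IsLipschitzClass μ c) {f : X → ℝ} (hf : Measurable f)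
    (hi : Integrable f μ) (hc : c f) : Measurable[h.sigma] f := by
  refine @measurable_of_Ioi ℝ X _ _ _ h.sigma _ _ _ f fun r => ?_
  have hm : MeasurableSet[m0] (f ⁻¹' Set.Ioi r) := hf measurableSet_Ioi
  refine h.measurableSet_sigma.2 ⟨hm, ?_⟩
  refine h.closed_of_tendsto (C := 1) (g := fun n x => min 1 (n * max (f x - r) 0))
    (measurable_const.indicator hm) (fun n => by fun_prop) ?_ ?_ ?_
  · intro n x
    rw [abs_of_nonneg (by positivity)]
    exact min_le_left _ _
  · intro x
    by_cases hx : r < f x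
    · have : x ∈ f ⁻¹' Set.Ioi r := hx
      rw [Set.indicator_of_mem this]
      refine tendsto_const_nhds.congr' ?_
      have hpos : 0 < max (f x - r) 0 := lt_max_of_lt_left (sub_pos.2 hx)
      filter_upwards [(tendsto_natCast_atTop_atTop.atTop_mul_const hpos).eventually_ge_atTop
        (1 : ℝ)] with n hn
      exact (min_eq_left hn).symm
    · have : x ∉ f ⁻¹' Set.Ioi r := hx
      rw [Set.indicator_of_notMem this]
      simp [max_eq_right (sub_nonpos.2 (not_lt.1 hx))]
  · intro n
    refine h.lip f f hf hf hi hi hc hc (fun a _ => min 1 (n * max (a - r) 0)) n ?_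
    intro a a' b b'
    calc |min 1 (n * max (a - r) 0) - min 1 (n * max (a' - r) 0)|
        ≤ max |(1 : ℝ) - 1| |n * max (a - r) 0 - n * max (a' - r) 0| :=
          abs_min_sub_min_le_max _ _ _ _
      _ = n * |max (a - r) 0 - max (a' - r) 0| := by
          rw [sub_self, abs_zero, ← mul_sub, abs_mul, Nat.abs_cast]
          exact max_eq_right (by positivity)
      _ ≤ n * max |(a - r) - (a' - r)| |(0 : ℝ) - 0| := by
          gcongr
          exact abs_max_sub_max_le_max _ _ _ _
      _ = n * |a - a'| := by simp
      _ ≤ n * (|a - a'| + |b - b'|) := by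
          gcongr
          exact le_add_of_nonneg_right (abs_nonneg _)

/-- Simple functions are built from indicators by scaling and addition, both Lipschitz; bounded
approximation by simple functions and closedness do the rest. -/
theorem of_measurable_sigma (h : IsLipschitzClass μ c) {f : X → ℝ} (hf : Measurable[h.sigma] f)
    {C : ℝ} (hC : ∀ x, |f x| ≤ C) : c f := by
  have hs : StronglyMeasurable[h.sigma] f := hf.stronglyMeasurable
  have hsimple : ∀ g : @SimpleFunc X h.sigma ℝ, c g := by
    intro g
    refine @SimpleFunc.induction X ℝ h.sigma _ (fun g => c g) ?_ ?_ g
    · intro a s hs''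
      have hs' := h.measurableSet_sigma.1 hs''
      have := h.lip _ _ (measurable_const.indicator hs'.1) (measurable_const.indicator hs'.1)
        (integrable_indicator_one hs'.1) (integrable_indicator_one hs'.1) hs'.2 hs'.2
        (fun b _ => a * b) |a| (fun b b' d d' => by
          rw [← mul_sub, abs_mul]
          gcongr
          exact le_add_of_nonneg_right (abs_nonneg _))
      convert this using 1
      ext x
      by_cases hx : x ∈ s <;> simp [hx]
    · intro g g' _ hg hg'
      have m1 : Measurable[m0] g := (@SimpleFunc.measurable _ _ h.sigma _ g).mono h.sigma_le le_rfl
      have m2 : Measurable[m0] g' :=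
        (@SimpleFunc.measurable _ _ h.sigma _ g').mono h.sigma_le le_rfl
      obtain ⟨c1, hc1⟩ := @SimpleFunc.exists_forall_norm_le _ _ h.sigma _ g
      obtain ⟨c2, hc2⟩ := @SimpleFunc.exists_forall_norm_le _ _ h.sigma _ g'
      exact h.lip g g' m1 m2 (integrable_of_abs_le m1 hc1) (integrable_of_abs_le m2 hc2) hg hg'
        (fun a b => a + b) 1 (fun a a' b b' => by
          rw [one_mul, add_sub_add_comm]
          exact abs_add_le _ _)
  by_cases hX : Nonempty X
  · obtain ⟨x0⟩ := hX
    have hC0 : 0 ≤ C := (abs_nonneg _).trans (hC x0)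
    refine h.closed_of_tendsto (C := C) (hf.mono h.sigma_le le_rfl)
      (fun n => (@SimpleFunc.measurable _ _ h.sigma _ (hs.approxBounded C n)).mono h.sigma_le le_rfl)
      (fun n x => hs.norm_approxBounded_le hC0 n x)
      (fun x => hs.tendsto_approxBounded_of_norm_le (hC x)) fun n => hsimple _
  · have : f = fun _ => 0 := by
      ext x
      exact absurd ⟨x⟩ hX
    rw [this]
    exact h.zero

end IsLipschitzClass

end LipschitzClass

/-! ### Measure preserving actions and the rigid σ-algebra. -/

/-- A measure preserving action `φ ↦ φ ∘ R g` on functions, so that `R` reverses products. -/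
structure MPAction (G : Type*) [Group G] {X : Type*} [MeasurableSpace X] (μ : Measure X) where
  act : G → X → X
  mp : ∀ g, MeasurePreserving (act g) μ μ
  act_mul : ∀ g h x, act (g * h) x = act h (act g x)
  act_one : ∀ x, act 1 x = x

section

variable {G : Type*} [Group G] {p : Ultrafilter G} {X : Type*} [MeasurableSpace X] {μ : Measure X}

instance : CoeFun (MPAction G μ) fun _ => G → X → X := ⟨MPAction.act⟩

theorem integral_abs_le_norm_Lp_two [IsProbabilityMeasure μ] (w : Lp ℝ 2 μ) :
    ∫ x, |w x| ∂μ ≤ ‖w‖ := by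
  have h1 : ∫ x, |w x| ∂μ = (eLpNorm w 1 μ).toReal := by
    rw [eLpNorm_one_eq_lintegral_enorm]
    simp_rw [← Real.norm_eq_abs]
    rw [integral_norm_eq_lintegral_enorm (Lp.aestronglyMeasurable w)]
  rw [h1, Lp.norm_def]
  exact ENNReal.toReal_mono (Lp.eLpNorm_ne_top w)
    (eLpNorm_le_eLpNorm_of_exponent_le (by norm_num) (Lp.aestronglyMeasurable w))

theorem memLp_of_abs_le [IsFiniteMeasure μ] {f : X → ℝ} (hf : Measurable f) {C : ℝ}
    (hC : ∀ x, |f x| ≤ C) {q : ENNReal} : MemLp f q μ :=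
  MemLp.of_bound hf.aestronglyMeasurable C (Eventually.of_forall hC)

namespace MPAction

theorem measurable (R : MPAction G μ) (g : G) : Measurable (R g) := (R.mp g).measurable

theorem integral_comp (R : MPAction G μ) (g : G) {f : X → ℝ} (hf : Measurable f) :
    ∫ x, f (R g x) ∂μ = ∫ x, f x ∂μ := by
  rw [← integral_map (R.measurable g).aemeasurable hf.aestronglyMeasurable, (R.mp g).map_eq]

theorem inv_act (R : MPAction G μ) (g : G) (x : X) : R g⁻¹ (R g x) = x := by
  rw [← R.act_mul, mul_inv_cancel, R.act_one]

/-- This is `exists_rigid_limit` for the Koopman isometries of `L²`, rewritten with honest functions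
and `L¹` errors. The last clause, approximation of the limit by combinations of translates of `φ`,
later makes a kernel operator almost of finite rank. -/
theorem exists_weak_limit [IsProbabilityMeasure μ] (hp : IsIdempotentFilter p) (R : MPAction G μ)
    {φ : X → ℝ} (hφ : Measurable φ) {C : ℝ} (hC : ∀ x, |φ x| ≤ C) :
    ∃ z : X → ℝ, Measurable z ∧ MemLp z 2 μ ∧
      (∀ ψ : X → ℝ, MemLp ψ 2 μ →
        Tendsto (fun g => ∫ x, φ (R g x) * ψ x ∂μ) p (𝓝 (∫ x, z x * ψ x ∂μ))) ∧
      Tendsto (fun g => ∫ x, |z (R g x) - z x| ∂μ) p (𝓝 0) ∧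
      ∫ x, φ x * z x ∂μ = ∫ x, z x ^ 2 ∂μ ∧
      ∀ ε > 0, ∃ c : G →₀ ℝ, ∫ x, |z x - c.sum fun k r => r * φ (R k x)| ∂μ ≤ ε := by
  have hφ2 : MemLp φ 2 μ := memLp_of_abs_le hφ hC
  let U : G → Lp ℝ 2 μ →ₗᵢ[ℝ] Lp ℝ 2 μ := fun g => Lp.compMeasurePreservingₗᵢ ℝ (R g) (R.mp g)
  have hU : ∀ g (w : Lp ℝ 2 μ), U g w = Lp.compMeasurePreserving (R g) (R.mp g) w :=
    fun g w => rfl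
  have hUc : ∀ g (w : Lp ℝ 2 μ), U g w =ᵐ[μ] fun x => w (R g x) := fun g w => by
    rw [hU]
    exact Lp.coeFn_compMeasurePreserving w (R.mp g)
  have hUφ : ∀ g, U g (hφ2.toLp φ) =ᵐ[μ] fun x => φ (R g x) := fun g => by
    refine (hUc g _).trans ?_
    exact (R.mp g).quasiMeasurePreserving.ae_eq_comp hφ2.coeFn_toLp
  have hUmul : ∀ g h w, U (g * h) w = U g (U h w) := by
    intro g h w
    refine Lp.ext ?_
    refine (hUc _ _).trans (EventuallyEq.trans ?_ (hUc _ _).symm)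
    have := (R.mp g).quasiMeasurePreserving.ae_eq_comp (hUc h w)
    refine EventuallyEq.trans (Eventually.of_forall fun x => ?_) this.symm
    simp [R.act_mul]
  obtain ⟨z, h1, h2, h3, h4⟩ := hp.exists_rigid_limit U hUmul (hφ2.toLp φ)
  have hinner : ∀ u v : Lp ℝ 2 μ, inner ℝ u v = ∫ x, u x * v x ∂μ := fun u v => by
    rw [L2.inner_def]
    exact integral_congr_ae (Eventually.of_forall fun x => by simp [mul_comm])
  refine ⟨z, (Lp.stronglyMeasurable z).measurable, Lp.memLp z, ?_, ?_, ?_, ?_⟩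
  · intro ψ hψ
    have := h1 (hψ.toLp ψ)
    simp_rw [hinner] at this
    have e : ∫ x, z x * (hψ.toLp ψ) x ∂μ = ∫ x, z x * ψ x ∂μ := by
      refine integral_congr_ae ?_
      filter_upwards [hψ.coeFn_toLp] with x hx
      rw [hx]
    rw [e] at this
    refine this.congr fun g => integral_congr_ae ?_
    filter_upwards [hψ.coeFn_toLp, hUφ g] with x hx hx'
    rw [hx, hx']
  · have h2' := tendsto_iff_norm_sub_tendsto_zero.1 h2
    refine squeeze_zero (fun g => integral_nonneg fun x => abs_nonneg _) (fun g => ?_) h2'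
    refine le_trans (le_of_eq (integral_congr_ae ?_)) (integral_abs_le_norm_Lp_two _)
    filter_upwards [hUc g z, Lp.coeFn_sub (U g z) z] with x hx hx'
    rw [hx', Pi.sub_apply, hx]
  · have e1 : ∫ x, φ x * z x ∂μ = inner ℝ (hφ2.toLp φ) z := by
      rw [hinner]
      refine integral_congr_ae ?_
      filter_upwards [hφ2.coeFn_toLp] with x hx
      rw [hx]
    rw [e1, h3, ← real_inner_self_eq_norm_sq, hinner]
    simp_rw [sq]
  · intro ε hε
    obtain ⟨w, hw, hwz⟩ := Metric.mem_closure_iff.1 h4 ε hε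
    rw [SetLike.mem_coe, Finsupp.mem_span_range_iff_exists_finsupp] at hw
    obtain ⟨c, rfl⟩ := hw
    refine ⟨c, ?_⟩
    rw [dist_eq_norm] at hwz
    refine le_trans (le_of_eq (integral_congr_ae ?_)) ((integral_abs_le_norm_Lp_two _).trans hwz.le)
    have hs : ((c.sum fun k r => r • U k (hφ2.toLp φ) : Lp ℝ 2 μ) : X → ℝ) =ᵐ[μ]
        fun x => c.sum fun k r => r * φ (R k x) := by
      unfold Finsupp.sum
      refine (Lp.coeFn_finsetSum _ _).trans ?_
      have : ∀ k ∈ c.support, (c k • U k (hφ2.toLp φ) : Lp ℝ 2 μ) =ᵐ[μ]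
          fun x => c k * φ (R k x) := by
        intro k _
        refine (Lp.coeFn_smul _ _).trans ?_
        filter_upwards [hUφ k] with x hx
        rw [Pi.smul_apply, hx, smul_eq_mul]
      have := (eventually_all_finset c.support).2 this
      filter_upwards [this] with x hx
      rw [Finset.sum_apply]
      exact Finset.sum_congr rfl hx
    filter_upwards [hs, Lp.coeFn_sub z (c.sum fun k r => r • U k (hφ2.toLp φ))] with x hx hx'
    rw [hx', Pi.sub_apply, hx]

end MPAction

end

theorem integrable_mul_of_abs_le {X : Type*} [MeasurableSpace X] {μ : Measure X} {f g : X → ℝ}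
    (hf : Integrable f μ) (hg : Measurable g) {C : ℝ}
    (hC : ∀ x, |g x| ≤ C) : Integrable (fun x => f x * g x) μ := by
  have := hf.bdd_mul (c := C) hg.aestronglyMeasurable (Eventually.of_forall hC)
  simpa [mul_comm] using this

theorem integral_mul_eq_of_ae_eq_condExp {X : Type*} {m m0 : MeasurableSpace X} {μ : Measure X}
    [IsFiniteMeasure μ] (hm : m ≤ m0) {φ e β : X → ℝ}
    (hφi : Integrable φ μ) (he : e =ᵐ[μ] μ[φ | m]) (hβ : Measurable[m] β) {C : ℝ}
    (hC : ∀ x, |β x| ≤ C) : ∫ x, φ x * β x ∂μ = ∫ x, e x * β x ∂μ := by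
  have hi : Integrable (φ * β) μ := integrable_mul_of_abs_le hφi (hβ.mono hm le_rfl) hC
  have h := condExp_mul_of_stronglyMeasurable_right hβ.stronglyMeasurable hi hφi
  calc ∫ x, φ x * β x ∂μ = ∫ x, (μ[φ * β | m]) x ∂μ := (integral_condExp hm).symm
    _ = ∫ x, e x * β x ∂μ := by
        refine integral_congr_ae ?_
        filter_upwards [h, he] with x h1 h2
        rw [h1, Pi.mul_apply, h2]

section

variable {G : Type*} [Group G] {p : Ultrafilter G} {X : Type*} [mX : MeasurableSpace X]
  {μ : Measure X}

namespace MPAction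

theorem integrable_comp (R : MPAction G μ) (g : G) {f : X → ℝ} (hf : Integrable f μ) :
    Integrable (fun x => f (R g x)) μ :=
  (R.mp g).integrable_comp_of_integrable hf

/-- Rigidity of a function along `p`. -/
def IsRigid (S : MPAction G μ) (p : Ultrafilter G) (f : X → ℝ) : Prop :=
  Tendsto (fun g => ∫ x, |f (S g x) - f x| ∂μ) p (𝓝 0)

theorem isLipschitzClass_isRigid (S : MPAction G μ) (p : Ultrafilter G) :
    IsLipschitzClass μ (S.IsRigid p) where
  zero := by simp [IsRigid]
  lip f g hf hg hfi hgi hfc hgc F K hF := by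
    have h := (hfc.add hgc).const_mul |K|
    rw [add_zero, mul_zero] at h
    refine squeeze_zero (fun g => integral_nonneg fun x => abs_nonneg _) (fun a => ?_) h
    have i1 : Integrable (fun x => |f (S a x) - f x|) μ :=
      ((S.integrable_comp a hfi).sub hfi).abs
    have i2 : Integrable (fun x => |g (S a x) - g x|) μ :=
      ((S.integrable_comp a hgi).sub hgi).abs
    rw [← integral_add i1 i2, ← integral_const_mul]
    refine integral_mono_of_nonneg (Eventually.of_forall fun x => abs_nonneg _)
      ((i1.add i2).const_mul _) (Eventually.of_forall fun x => ?_)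
    refine (hF _ _ _ _).trans ?_
    exact mul_le_mul_of_nonneg_right (le_abs_self K) (by positivity)
  closed f hf hfi h := by
    rw [IsRigid, Metric.tendsto_nhds]
    intro ε hε
    obtain ⟨g, hg, hgi, hgc, hfg⟩ := h (ε / 4) (by positivity)
    filter_upwards [hgc.eventually (gt_mem_nhds (show (0 : ℝ) < ε / 4 by positivity))] with a ha
    have i0 : Integrable (fun x => |f x - g x|) μ := (hfi.sub hgi).abs
    have i1 : Integrable (fun x => |f (S a x) - g (S a x)|) μ := S.integrable_comp a i0
    have i2 : Integrable (fun x => |g (S a x) - g x|) μ := ((S.integrable_comp a hgi).sub hgi).abs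
    have e1 : ∫ x, |f (S a x) - g (S a x)| ∂μ = ∫ x, |f x - g x| ∂μ :=
      S.integral_comp a (f := fun x => |f x - g x|) (by fun_prop)
    have i12 : Integrable (fun x => |f (S a x) - g (S a x)| + |g (S a x) - g x|) μ := i1.add i2
    have : ∫ x, |f (S a x) - f x| ∂μ ≤
        ∫ x, (|f (S a x) - g (S a x)| + |g (S a x) - g x| + |f x - g x|) ∂μ := by
      refine integral_mono_of_nonneg (Eventually.of_forall fun x => abs_nonneg _)
        ((i1.add i2).add i0) (Eventually.of_forall fun x => ?_)
      have h1 := abs_sub_le (f (S a x)) (g (S a x)) (f x)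
      have h2 := abs_sub_le (g (S a x)) (g x) (f x)
      rw [abs_sub_comm (g x) (f x)] at h2
      dsimp only
      linarith
    rw [integral_add i12 i0, integral_add i1 i2, e1] at this
    rw [dist_zero_right, Real.norm_eq_abs, abs_of_nonneg (integral_nonneg fun x => abs_nonneg _)]
    linarith

/-- Replacing a rigid factor by its translate does not change limits of integrals. -/
theorem tendsto_integral_sub_of_isRigid (S : MPAction G μ) {p : Ultrafilter G} {β : X → ℝ}
    (hβi : Integrable β μ)
    (hr : S.IsRigid p β) {f : G → X → ℝ} (hf : ∀ g, Measurable (f g)) {C : ℝ}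
    (hC : ∀ g x, |f g x| ≤ C) :
    Tendsto (fun g => ∫ x, f g x * β (S g x) ∂μ - ∫ x, f g x * β x ∂μ) p (𝓝 0) := by
  have h := hr.const_mul C
  rw [mul_zero] at h
  refine squeeze_zero_norm (fun g => ?_) h
  have i1 : Integrable (fun x => f g x * β (S g x)) μ := by
    simpa [mul_comm] using integrable_mul_of_abs_le (S.integrable_comp g hβi) (hf g) (hC g)
  have i2 : Integrable (fun x => f g x * β x) μ := by
    simpa [mul_comm] using integrable_mul_of_abs_le hβi (hf g) (hC g)
  rw [← integral_sub i1 i2, ← integral_const_mul]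
  refine (norm_integral_le_integral_norm _).trans ?_
  refine integral_mono_of_nonneg (Eventually.of_forall fun x => norm_nonneg _)
    ((((S.integrable_comp g hβi).sub hβi).abs).const_mul C) (Eventually.of_forall fun x => ?_)
  dsimp only
  rw [← mul_sub, Real.norm_eq_abs, abs_mul]
  exact mul_le_mul_of_nonneg_right (hC g x) (abs_nonneg _)

/-- The σ-algebra of rigid sets. -/
@[reducible]
def rigidSigma [IsFiniteMeasure μ] (S : MPAction G μ) (p : Ultrafilter G) : MeasurableSpace X :=
  (S.isLipschitzClass_isRigid p).sigma

variable [IsProbabilityMeasure μ]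

theorem rigidSigma_le (S : MPAction G μ) (p : Ultrafilter G) : S.rigidSigma p ≤ mX :=
  (S.isLipschitzClass_isRigid p).sigma_le

theorem isRigid_of_measurable (S : MPAction G μ) {p : Ultrafilter G} {f : X → ℝ}
    (hf : Measurable[S.rigidSigma p] f) {C : ℝ} (hC : ∀ x, |f x| ≤ C) : S.IsRigid p f :=
  (S.isLipschitzClass_isRigid p).of_measurable_sigma hf hC

/-- The conditional expectation of a bounded function with respect to the rigid σ-algebra is its
weak limit along `p`. -/
theorem exists_rigid_condExp (hp : IsIdempotentFilter p) (S : MPAction G μ) {φ : X → ℝ}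
    (hφ : Measurable φ) {a b : ℝ} (ha : ∀ x, a ≤ φ x) (hb : ∀ x, φ x ≤ b) :
    ∃ e : X → ℝ, Measurable[S.rigidSigma p] e ∧ (∀ x, a ≤ e x) ∧ (∀ x, e x ≤ b) ∧
      e =ᵐ[μ] μ[φ | S.rigidSigma p] ∧
      ∀ ψ : X → ℝ, MemLp ψ 2 μ →
        Tendsto (fun g => ∫ x, φ (S g x) * ψ x ∂μ) p (𝓝 (∫ x, e x * ψ x ∂μ)) := by
  have hC : ∀ x, |φ x| ≤ max |a| |b| := fun x => abs_le_max_abs_abs (ha x) (hb x)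
  have hφi : Integrable φ μ := integrable_of_abs_le hφ hC
  have hle := S.rigidSigma_le p
  obtain ⟨z, hzm, hz2, hz, hzr, -, -⟩ := S.exists_weak_limit hp hφ hC
  have hzi : Integrable z μ := hz2.integrable (by norm_num)
  have hzB : Measurable[S.rigidSigma p] z :=
    (S.isLipschitzClass_isRigid p).measurable_sigma hzm hzi hzr
  have hzc : z =ᵐ[μ] μ[φ | S.rigidSigma p] := by
    refine ae_eq_condExp_of_forall_setIntegral_eq hle hφi (fun s _ _ => hzi.integrableOn) ?_
      hzB.stronglyMeasurable.aestronglyMeasurable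
    intro s hs _
    have hsm := hle s hs
    have hs1 : Measurable (s.indicator fun _ => (1 : ℝ)) := measurable_const.indicator hsm
    have hs1b : ∀ x, |s.indicator (fun _ => (1 : ℝ)) x| ≤ 1 := fun x => by
      by_cases hx : x ∈ s <;> simp [hx]
    have hmul : ∀ f : X → ℝ, ∫ x, f x * s.indicator (fun _ => (1 : ℝ)) x ∂μ = ∫ x in s, f x ∂μ := by
      intro f
      rw [← integral_indicator hsm]
      refine integral_congr_ae (Eventually.of_forall fun x => ?_)
      by_cases hx : x ∈ s <;> simp [hx]
    have h1 := hz _ (memLp_of_abs_le hs1 hs1b)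
    -- As `s` is rigid, its indicator may be composed with `S g` in the limit, after which
    -- invariance of the measure removes `S g` altogether.
    have h2 := S.tendsto_integral_sub_of_isRigid (integrable_of_abs_le hs1 hs1b)
      ((S.isLipschitzClass_isRigid p).measurableSet_sigma.1 hs).2 (f := fun g x => φ (S g x))
      (fun g => hφ.comp (S.measurable g)) (fun g x => hC _)
    have h3 := h1.add h2
    rw [add_zero, hmul] at h3
    refine tendsto_nhds_unique h3 (tendsto_const_nhds.congr fun g => ?_)
    rw [add_sub_cancel, S.integral_comp g (f := fun x => φ x * s.indicator (fun _ => (1 : ℝ)) x)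
      (hφ.mul hs1), hmul]
  have hbound : ∀ᵐ x ∂μ, a ≤ z x ∧ z x ≤ b := by
    have h1 := condExp_mono (m := S.rigidSigma p) (integrable_const a) hφi (Eventually.of_forall ha)
    have h2 := condExp_mono (m := S.rigidSigma p) hφi (integrable_const b) (Eventually.of_forall hb)
    rw [condExp_const hle] at h1 h2
    filter_upwards [h1, h2, hzc] with x h1 h2 h3
    rw [h3]
    exact ⟨h1, h2⟩
  have hab : ∀ x : X, a ≤ b := fun x => (ha x).trans (hb x)
  -- Clipping changes the weak limit only on a null set and makes the bounds hold everywhere.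
  have hez : (fun x => max a (min b (z x))) =ᵐ[μ] z := by
    filter_upwards [hbound] with x hx
    rw [min_eq_right hx.2, max_eq_right hx.1]
  refine ⟨fun x => max a (min b (z x)), ?_, fun x => le_max_left _ _,
    fun x => max_le (hab x) (min_le_left _ _), hez.trans hzc, ?_⟩
  · exact measurable_const.max (measurable_const.min hzB)
  · intro ψ hψ
    have : ∫ x, max a (min b (z x)) * ψ x ∂μ = ∫ x, z x * ψ x ∂μ := by
      refine integral_congr_ae ?_
      filter_upwards [hez] with x hx
      rw [hx]
    rw [this]
    exact hz ψ hψ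

end MPAction

/-- Two actions commute. -/
def MPAction.Commute (T S : MPAction G μ) : Prop := ∀ g h x, T g (S h x) = S h (T g x)

namespace MPAction

variable [IsProbabilityMeasure μ] {T S : MPAction G μ}

/-- By commutation and invariance, the set and its preimage under `T h` are moved by `S g` by the
same amount in `L¹`. -/
theorem Commute.measurable_rigidSigma (hTS : T.Commute S) (p : Ultrafilter G) (h : G) :
    @Measurable _ _ (S.rigidSigma p) (S.rigidSigma p) (T h) := by
  intro s hs
  obtain ⟨hs1, hs2⟩ := (S.isLipschitzClass_isRigid p).measurableSet_sigma.1 hs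
  refine (S.isLipschitzClass_isRigid p).measurableSet_sigma.2 ⟨T.measurable h hs1, ?_⟩
  refine hs2.congr fun g => ?_
  have hm : Measurable (s.indicator fun _ => (1 : ℝ)) := measurable_const.indicator hs1
  rw [← T.integral_comp h
    (f := fun x => |s.indicator (fun _ => (1 : ℝ)) (S g x) - s.indicator (fun _ => (1 : ℝ)) x|)
    (((hm.comp (S.measurable g)).sub hm).abs)]
  refine integral_congr_ae (Eventually.of_forall fun x => ?_)
  simp only [← hTS h g]
  rfl

theorem Commute.condExp_comp (hTS : T.Commute S) (p : Ultrafilter G) (h : G) {φ : X → ℝ}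
    (hφ : Measurable φ) (hφi : Integrable φ μ) :
    μ[fun x => φ (T h x) | S.rigidSigma p] =ᵐ[μ] fun x => (μ[φ | S.rigidSigma p]) (T h x) := by
  have hle := S.rigidSigma_le p
  have hcm : Measurable[S.rigidSigma p] (μ[φ | S.rigidSigma p]) :=
    stronglyMeasurable_condExp.measurable
  refine (ae_eq_condExp_of_forall_setIntegral_eq hle (T.integrable_comp h hφi)
    (fun s _ _ => (T.integrable_comp h integrable_condExp).integrableOn) ?_ ?_).symm
  · intro s hs _
    have hs' : MeasurableSet[S.rigidSigma p] (T h⁻¹ ⁻¹' s) := hTS.measurable_rigidSigma p h⁻¹ hs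
    have key : ∀ f : X → ℝ, Measurable f →
        ∫ x in s, f (T h x) ∂μ = ∫ x in T h⁻¹ ⁻¹' s, f x ∂μ := by
      intro f hf
      rw [← integral_indicator (hle s hs), ← integral_indicator (hle _ hs'),
        ← T.integral_comp h (hf.indicator (hle _ hs'))]
      refine integral_congr_ae (Eventually.of_forall fun x => ?_)
      by_cases hx : x ∈ s <;> simp [Set.indicator, T.inv_act, hx]
    rw [key _ (hcm.mono hle le_rfl), key _ hφ, setIntegral_condExp hle hφi hs']
  · exact (hcm.comp (hTS.measurable_rigidSigma p h)).stronglyMeasurable.aestronglyMeasurable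

end MPAction

end

/-! ### Relatively almost periodic functions. -/

section

variable {G : Type*} [Group G] {p : Ultrafilter G} {X : Type*} [mX : MeasurableSpace X]
  {μ : Measure X}

theorem measureReal_le_add_of_ae [IsFiniteMeasure μ] {A B C : Set X}
    (h : ∀ᵐ x ∂μ, x ∈ A → x ∈ B ∨ x ∈ C) : μ.real A ≤ μ.real B + μ.real C := by
  have h1 : μ A ≤ μ (B ∪ C) := measure_mono_ae h
  exact (ENNReal.toReal_mono (measure_ne_top _ _) h1).trans (measureReal_union_le B C)

theorem measureReal_lt_condExp_abs_le [IsFiniteMeasure μ] {m : MeasurableSpace X} (hm : m ≤ mX)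
    (f : X → ℝ) {ε : ℝ} (hε : 0 < ε) :
    μ.real {x | ε < (μ[fun y => |f y| | m]) x} ≤ (∫ x, |f x| ∂μ) / ε := by
  rw [le_div_iff₀ hε, mul_comm]
  have h0 : 0 ≤ᵐ[μ] μ[fun y => |f y| | m] :=
    condExp_nonneg (Eventually.of_forall fun x => abs_nonneg _)
  have h1 := mul_meas_ge_le_integral_of_nonneg h0 integrable_condExp ε
  rw [integral_condExp hm] at h1
  refine le_trans ?_ h1
  exact mul_le_mul_of_nonneg_left (measureReal_mono fun x (hx : ε < _) => hx.le) hε.le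

theorem continuous_of_lipschitz_two {F : ℝ → ℝ → ℝ} {K : ℝ}
    (hF : ∀ a a' b b', |F a b - F a' b'| ≤ K * (|a - a'| + |b - b'|)) :
    Continuous fun q : ℝ × ℝ => F q.1 q.2 := by
  rw [continuous_iff_continuousAt]
  intro q
  rw [ContinuousAt, tendsto_iff_dist_tendsto_zero]
  refine squeeze_zero (fun _ => dist_nonneg) (fun r => hF r.1 q.1 r.2 q.2) ?_
  have : Continuous fun r : ℝ × ℝ => K * (|r.1 - q.1| + |r.2 - q.2|) := by fun_prop
  simpa using this.tendsto q

theorem integrable_of_lipschitz_two [IsFiniteMeasure μ] {F : ℝ → ℝ → ℝ} {K : ℝ}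
    (hF : ∀ a a' b b', |F a b - F a' b'| ≤ K * (|a - a'| + |b - b'|)) {f g : X → ℝ}
    (hf : Measurable f) (hg : Measurable g) (hfi : Integrable f μ) (hgi : Integrable g μ) :
    Integrable (fun x => F (f x) (g x)) μ := by
  refine Integrable.mono' (((hfi.abs.add hgi.abs).const_mul K).add (integrable_const |F 0 0|))
    ((continuous_of_lipschitz_two hF).measurable.comp (hf.prodMk hg)).aestronglyMeasurable
    (Eventually.of_forall fun x => ?_)
  have h1 := hF (f x) 0 (g x) 0
  have h2 := abs_sub_abs_le_abs_sub (F (f x) (g x)) (F 0 0)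
  simp only [sub_zero] at h1
  simp only [Pi.add_apply, Real.norm_eq_abs]
  linarith

namespace MPAction

/-- Almost periodicity of a function under `T` relative to the `S`-rigid σ-algebra. -/
def IsAlmostPeriodic [IsFiniteMeasure μ] (T S : MPAction G μ) (p : Ultrafilter G) (φ : X → ℝ) :
    Prop :=
  ∀ ε > 0, ∃ Ψ : Set (X → ℝ), Ψ.Finite ∧ (∀ ψ ∈ Ψ, Measurable ψ ∧ Integrable ψ μ) ∧
    ∀ᶠ h in (p : Filter G),
      μ.real {x | ∀ ψ ∈ Ψ, ε < (μ[fun y => |φ (T h y) - ψ y| | S.rigidSigma p]) x} ≤ ε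

variable [IsProbabilityMeasure μ]

/-- Finite nets for `f` and `g` combine into the finite net of all `F (ψ, θ)`, and an `L¹`
approximant passes its net on by Markov's inequality for conditional expectations. -/
theorem isLipschitzClass_isAlmostPeriodic (T S : MPAction G μ) (p : Ultrafilter G) :
    IsLipschitzClass μ (T.IsAlmostPeriodic S p) where
  zero ε hε := by
    refine ⟨{fun _ => 0}, Set.finite_singleton _, ?_, Eventually.of_forall fun h => ?_⟩
    · rintro ψ rfl
      exact ⟨measurable_const, integrable_const _⟩
    · have : μ[fun _ : X => (0 : ℝ) | S.rigidSigma p] = 0 := condExp_zero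
      simp [this, not_lt.2 hε.le, hε.le]
  lip f g hf hg hfi hgi hfc hgc F K hF := by
    intro ε hε
    obtain ⟨L, hL, hKL⟩ : ∃ L : ℝ, 1 ≤ L ∧ K ≤ L := ⟨max 1 K, le_max_left _ _, le_max_right _ _⟩
    have hL0 : 0 < L := by linarith
    have hF' : ∀ a a' b b', |F a b - F a' b'| ≤ L * (|a - a'| + |b - b'|) := fun a a' b b' =>
      (hF a a' b b').trans (mul_le_mul_of_nonneg_right hKL (by positivity))
    -- Two errors of this size, amplified by the Lipschitz constant `L`, add up to `ε`. Since `L ≥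
    -- 1`, the two exceptional sets together also have measure at most `ε`.
    have hε' : 0 < ε / (2 * L) := by positivity
    have hεε : ε / (2 * L) ≤ ε / 2 := by
      gcongr
      linarith
    obtain ⟨Ψ, hΨ, hΨm, hΨe⟩ := hfc _ hε'
    obtain ⟨Θ, hΘ, hΘm, hΘe⟩ := hgc _ hε'
    refine ⟨(fun q : (X → ℝ) × (X → ℝ) => fun x => F (q.1 x) (q.2 x)) '' (Ψ ×ˢ Θ),
      (hΨ.prod hΘ).image _, ?_, ?_⟩
    · rintro _ ⟨⟨ψ, θ⟩, ⟨hψ, hθ⟩, rfl⟩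
      exact ⟨(continuous_of_lipschitz_two hF).measurable.comp ((hΨm ψ hψ).1.prodMk (hΘm θ hθ).1),
        integrable_of_lipschitz_two hF (hΨm ψ hψ).1 (hΘm θ hθ).1 (hΨm ψ hψ).2 (hΘm θ hθ).2⟩
    · filter_upwards [hΨe, hΘe] with h h1 h2
      have key : ∀ᵐ x ∂μ, ∀ ψ ∈ Ψ, ∀ θ ∈ Θ,
          (μ[fun y => |F (f (T h y)) (g (T h y)) - F (ψ y) (θ y)| | S.rigidSigma p]) x ≤
          L * ((μ[fun y => |f (T h y) - ψ y| | S.rigidSigma p]) x +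
            (μ[fun y => |g (T h y) - θ y| | S.rigidSigma p]) x) := by
        rw [ae_ball_iff hΨ.countable]
        intro ψ hψ
        rw [ae_ball_iff hΘ.countable]
        intro θ hθ
        have i1 : Integrable (fun y => |f (T h y) - ψ y|) μ :=
          ((T.integrable_comp h hfi).sub (hΨm ψ hψ).2).abs
        have i2 : Integrable (fun y => |g (T h y) - θ y|) μ :=
          ((T.integrable_comp h hgi).sub (hΘm θ hθ).2).abs
        have i3 : Integrable (fun y => |F (f (T h y)) (g (T h y)) - F (ψ y) (θ y)|) μ :=
          ((T.integrable_comp h (integrable_of_lipschitz_two hF hf hg hfi hgi)).sub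
            (integrable_of_lipschitz_two hF (hΨm ψ hψ).1 (hΘm θ hθ).1 (hΨm ψ hψ).2
              (hΘm θ hθ).2)).abs
        have e1 := condExp_mono (m := S.rigidSigma p) i3 ((i1.add i2).smul L)
          (Eventually.of_forall fun y => hF' _ _ _ _)
        have e2 := condExp_smul (μ := μ) L
          ((fun y => |f (T h y) - ψ y|) + fun y => |g (T h y) - θ y|) (S.rigidSigma p)
        have e3 := condExp_add i1 i2 (S.rigidSigma p)
        filter_upwards [e1, e2, e3] with x e1 e2 e3
        refine e1.trans (le_of_eq ?_)
        rw [e2, Pi.smul_apply, e3, Pi.add_apply, smul_eq_mul]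
      calc _ ≤ _ := measureReal_le_add_of_ae (C := {x | ∀ ψ ∈ Θ, ε / (2 * L) <
              (μ[fun y => |g (T h y) - ψ y| | S.rigidSigma p]) x}) ?_
        _ ≤ ε / (2 * L) + ε / (2 * L) := add_le_add h1 h2
        _ ≤ ε := by linarith
      filter_upwards [key] with x hx hxA
      by_contra hcon
      simp only [not_or, not_forall, not_lt] at hcon
      obtain ⟨⟨ψ, hψ, h3⟩, ⟨θ, hθ, h4⟩⟩ := hcon
      have h5 := hxA _ ⟨(ψ, θ), ⟨hψ, hθ⟩, rfl⟩
      have h6 := hx ψ hψ θ hθ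
      have h7 : L * (ε / (2 * L) + ε / (2 * L)) = ε := by
        field_simp
        ring
      have h8 := mul_le_mul_of_nonneg_left (add_le_add h3 h4) hL0.le
      linarith
  closed f hf hfi h ε hε := by
    -- By Markov's inequality, the conditional error then exceeds `ε / 2` only on a set of measure
    -- at most `ε / 2`.
    obtain ⟨g, hg, hgi, hgc, hfg⟩ := h (ε / 2 * (ε / 2)) (by positivity)
    obtain ⟨Ψ, hΨ, hΨm, hΨe⟩ := hgc (ε / 2) (by positivity)
    refine ⟨Ψ, hΨ, hΨm, ?_⟩
    filter_upwards [hΨe] with a ha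
    have i1 : Integrable (fun y => |f (T a y) - g (T a y)|) μ :=
      (T.integrable_comp a (hfi.sub hgi)).abs
    have key : ∀ᵐ x ∂μ, ∀ ψ ∈ Ψ,
        (μ[fun y => |f (T a y) - ψ y| | S.rigidSigma p]) x ≤
          (μ[fun y => |f (T a y) - g (T a y)| | S.rigidSigma p]) x +
            (μ[fun y => |g (T a y) - ψ y| | S.rigidSigma p]) x := by
      rw [ae_ball_iff hΨ.countable]
      intro ψ hψ
      have i2 : Integrable (fun y => |g (T a y) - ψ y|) μ :=
        ((T.integrable_comp a hgi).sub (hΨm ψ hψ).2).abs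
      have i3 : Integrable (fun y => |f (T a y) - ψ y|) μ :=
        ((T.integrable_comp a hfi).sub (hΨm ψ hψ).2).abs
      have e1 := condExp_mono (m := S.rigidSigma p) i3 (i1.add i2)
        (Eventually.of_forall fun y => abs_sub_le _ _ _)
      filter_upwards [e1, condExp_add i1 i2 (S.rigidSigma p)] with x e1 e3
      rw [e3] at e1
      exact e1
    have hB : μ.real {x | ε / 2 < (μ[fun y => |f (T a y) - g (T a y)| | S.rigidSigma p]) x} ≤
        ε / 2 := by
      refine (measureReal_lt_condExp_abs_le (S.rigidSigma_le p) _ (by positivity)).trans ?_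
      rw [T.integral_comp a (f := fun x => |f x - g x|) (by fun_prop), div_le_iff₀ (by positivity)]
      exact hfg
    calc _ ≤ _ := measureReal_le_add_of_ae ?_
      _ ≤ ε / 2 + ε / 2 := add_le_add hB ha
      _ = ε := by ring
    filter_upwards [key] with x hx hxA
    by_contra hcon
    simp only [not_or, not_forall, not_lt] at hcon
    obtain ⟨h3, ⟨ψ, hψ, h4⟩⟩ := hcon
    have h5 := hxA ψ hψ
    have h6 := hx ψ hψ
    linarith

/-- The σ-algebra of relatively almost periodic sets. -/
@[reducible]
def apSigma (T S : MPAction G μ) (p : Ultrafilter G) : MeasurableSpace X :=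
  (T.isLipschitzClass_isAlmostPeriodic S p).sigma

theorem apSigma_le (T S : MPAction G μ) (p : Ultrafilter G) : T.apSigma S p ≤ mX :=
  (T.isLipschitzClass_isAlmostPeriodic S p).sigma_le

end MPAction

end

/-! ### The relative square and relative mixing. -/

open ProbabilityTheory

theorem exists_kernel_condExp {X : Type*} {m mX : MeasurableSpace X} [StandardBorelSpace X]
    (hm : m ≤ mX) (μ : Measure X) [IsFiniteMeasure μ] :
    ∃ κ : Kernel X X, IsMarkovKernel κ ∧
      ∀ f : X → ℝ, Integrable f μ → μ[f | m] =ᵐ[μ] fun x => ∫ y, f y ∂κ x := by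
  refine ⟨(condExpKernel μ m).comap id (measurable_id'' hm), ?_, fun f hf => ?_⟩
  · exact ⟨fun x => by
      rw [Kernel.comap_apply]
      infer_instance⟩
  · exact condExp_ae_eq_integral_condExpKernel hm hf

theorem condExp_abs_sub_le_add {X : Type*} {m mX : MeasurableSpace X} {μ : Measure X}
    [IsFiniteMeasure μ] (hm : m ≤ mX) {f g w B : X → ℝ} (hf : Integrable f μ) (hg : Integrable g μ)
    (hw : Integrable w μ) (hB : Integrable B μ) (hBm : Measurable[m] B)
    (h : ∀ x, |g x - w x| ≤ B x) :
    ∀ᵐ x ∂μ, (μ[fun y => |f y - w y| | m]) x ≤ (μ[fun y => |f y - g y| | m]) x + B x := by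
  have i1 : Integrable (fun y => |f y - w y|) μ := (hf.sub hw).abs
  have i2 : Integrable (fun y => |f y - g y|) μ := (hf.sub hg).abs
  have e1 := condExp_mono (m := m) i1 (i2.add hB)
    (Eventually.of_forall fun y => (abs_sub_le _ (g y) _).trans (add_le_add le_rfl (h y)))
  have e2 := condExp_add i2 hB m
  rw [condExp_of_stronglyMeasurable hm hBm.stronglyMeasurable hB] at e2
  filter_upwards [e1, e2] with x e1 e2
  rw [e2] at e1
  exact e1

section RelativeSquare

variable {X : Type*} [mX : MeasurableSpace X] {μ : Measure X}

theorem exists_finite_net (C : ℝ) {s : ℝ} (hs : 0 < s) :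
    ∃ N : Set ℝ, N.Finite ∧ ∀ t : ℝ, |t| ≤ C → ∃ r ∈ N, |t - r| ≤ s := by
  obtain ⟨N, -, hN, hc⟩ := (isCompact_Icc (a := -C) (b := C)).finite_cover_balls hs
  refine ⟨N, hN, fun t ht => ?_⟩
  obtain ⟨r, hr, htr⟩ := Set.mem_iUnion₂.1 (hc (abs_le.1 ht))
  exact ⟨r, hr, (Metric.mem_ball.1 htr).le⟩

theorem integral_abs_le_of_forall_mul_le {f : X → ℝ} (hf : Measurable f) {δ : ℝ}
    (h : ∀ ψ : X → ℝ, Measurable ψ → (∀ x, |ψ x| ≤ 1) → ∫ x, ψ x * f x ∂μ ≤ δ) :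
    ∫ x, |f x| ∂μ ≤ δ := by
  have hs : MeasurableSet {x | 0 ≤ f x} := measurableSet_le measurable_const hf
  refine le_trans (le_of_eq ?_) (h (fun x => if 0 ≤ f x then 1 else -1)
    (Measurable.ite hs measurable_const measurable_const) fun x => ?_)
  · refine integral_congr_ae (Eventually.of_forall fun x => ?_)
    by_cases hx : 0 ≤ f x
    · simp [hx, abs_of_nonneg hx]
    · simp [hx, abs_of_neg (not_le.1 hx)]
  · split_ifs <;> simp

variable [IsProbabilityMeasure μ] {κ : Kernel X X} [IsMarkovKernel κ]

theorem integral_compProd_mul {a : X → ℝ} {F : X × X → ℝ} (ha : Measurable a) {C : ℝ}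
    (haC : ∀ x, |a x| ≤ C) (hF : Integrable F (μ ⊗ₘ κ)) :
    ∫ q, a q.1 * F q ∂(μ ⊗ₘ κ) = ∫ x, a x * ∫ y, F (x, y) ∂κ x ∂μ := by
  have hi : Integrable (fun q : X × X => a q.1 * F q) (μ ⊗ₘ κ) := by
    simpa [mul_comm] using
      integrable_mul_of_abs_le hF (ha.comp measurable_fst) (fun q : X × X => haC q.1)
  rw [Measure.integral_compProd hi]
  simp_rw [integral_const_mul]

end RelativeSquare

theorem integral_compProd_mul_condExp {X : Type*} {m mX : MeasurableSpace X} {μ : Measure X}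
    [IsProbabilityMeasure μ] {κ : Kernel X X} [IsMarkovKernel κ]
    (hκ : ∀ f : X → ℝ, Integrable f μ → μ[f | m] =ᵐ[μ] fun x => ∫ y, f y ∂κ x)
    {a b : X → ℝ} (ha : Measurable[mX] a) (hb : Measurable[mX] b) {C D : ℝ}
    (haC : ∀ x, |a x| ≤ C) (hbD : ∀ x, |b x| ≤ D) :
    ∫ q, a q.1 * b q.2 ∂(μ ⊗ₘ κ) = ∫ x, a x * (μ[b | m]) x ∂μ := by
  have hb2 : Measurable fun q : X × X => b q.2 := hb.comp measurable_snd
  rw [integral_compProd_mul ha haC (F := fun q : X × X => b q.2)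
    (integrable_of_abs_le hb2 fun q => hbD q.2)]
  refine integral_congr_ae ?_
  filter_upwards [hκ b (integrable_of_abs_le hb hbD)] with x hx
  rw [hx]

section

variable {G : Type*} [Group G] {p : Ultrafilter G} {X : Type*} [mX : MeasurableSpace X]
  {μ : Measure X} [IsProbabilityMeasure μ] {T S : MPAction G μ} {κ : Kernel X X}
  [IsMarkovKernel κ]

namespace MPAction

/-- The diagonal action on the relative square. -/
def relSquare (hTS : T.Commute S)
    (hκ : ∀ f : X → ℝ, Integrable f μ → μ[f | S.rigidSigma p] =ᵐ[μ] fun x => ∫ y, f y ∂κ x) :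
    MPAction G (μ ⊗ₘ κ) where
  act g q := (T g q.1, T g q.2)
  mp g := by
    have hm : Measurable fun q : X × X => (T g q.1, T g q.2) :=
      ((T.measurable g).comp measurable_fst).prodMk ((T.measurable g).comp measurable_snd)
    refine ⟨hm, ?_⟩
    have : IsFiniteMeasure (Measure.map (fun q : X × X => (T g q.1, T g q.2)) (μ ⊗ₘ κ)) :=
      Measure.isFiniteMeasure_map _ _
    refine Measure.ext_prod fun {s t} hs ht => ?_
    rw [Measure.map_apply hm (hs.prod ht)]
    -- Rectangles determine the measure, and on them it is expressed through a conditional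
    -- expectation, which is equivariant under `T` because `T` preserves the rigid σ-algebra.
    have hreal : ∀ s t : Set X, MeasurableSet s → MeasurableSet t →
        (μ ⊗ₘ κ).real (s ×ˢ t) = ∫ x, s.indicator (fun _ => (1 : ℝ)) x *
          (μ[t.indicator fun _ => (1 : ℝ) | S.rigidSigma p]) x ∂μ := by
      intro s t hs ht
      have hb : ∀ (s : Set X) (x : X), |s.indicator (fun _ => (1 : ℝ)) x| ≤ 1 := fun s x => by
        by_cases hx : x ∈ s <;> simp [hx]
      rw [← integral_compProd_mul_condExp hκ (measurable_const.indicator hs)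
        (measurable_const.indicator ht) (hb s) (hb t), ← integral_indicator_one (hs.prod ht)]
      refine integral_congr_ae (Eventually.of_forall fun q => ?_)
      by_cases h1 : q.1 ∈ s <;> by_cases h2 : q.2 ∈ t <;> simp [Set.indicator, h1, h2]
    have hpre : (fun q : X × X => (T g q.1, T g q.2)) ⁻¹' s ×ˢ t = (T g ⁻¹' s) ×ˢ (T g ⁻¹' t) := rfl
    rw [hpre]
    refine (measureReal_eq_measureReal_iff).1 ?_
    rw [hreal _ _ (T.measurable g hs) (T.measurable g ht), hreal _ _ hs ht]
    have hti : Measurable (t.indicator fun _ => (1 : ℝ)) := measurable_const.indicator ht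
    have hcm : Measurable (μ[t.indicator fun _ => (1 : ℝ) | S.rigidSigma p]) :=
      stronglyMeasurable_condExp.measurable.mono (S.rigidSigma_le p) le_rfl
    rw [← T.integral_comp g (f := fun x => s.indicator (fun _ => (1 : ℝ)) x *
      (μ[t.indicator fun _ => (1 : ℝ) | S.rigidSigma p]) x)
      ((measurable_const.indicator hs).mul hcm)]
    refine integral_congr_ae ?_
    filter_upwards [hTS.condExp_comp p g hti (integrable_indicator_one ht)] with x hx
    have e : (T g ⁻¹' t).indicator (fun _ => (1 : ℝ)) =
        fun x => t.indicator (fun _ => (1 : ℝ)) (T g x) := rfl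
    rw [e, hx]
    rfl
  act_mul g h q := by simp [T.act_mul]
  act_one q := by simp [T.act_one]

/-- A function that is approximated, in `L¹` and uniformly along `p`, by combinations of finitely
many functions with rigid coefficients is relatively almost periodic. -/
theorem isAlmostPeriodic_of_approx {χ : X → ℝ} (hχi : Integrable χ μ) {C : ℝ} (hC : 0 ≤ C)
    (h : ∀ ε > 0, ∃ (I : Finset G) (c : G → ℝ) (a : G → X → ℝ) (β : G → G → X → ℝ),
      (∀ k, Measurable (a k) ∧ ∀ x, |a k x| ≤ C) ∧
      (∀ k h, Measurable[S.rigidSigma p] (β k h) ∧ ∀ x, |β k h x| ≤ C) ∧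
      ∀ᶠ h in (p : Filter G), ∫ x, |χ (T h x) - ∑ k ∈ I, c k * (a k x * β k h x)| ∂μ ≤ ε) :
    T.IsAlmostPeriodic S p χ := by
  intro ε hε
  have hle := S.rigidSigma_le p
  obtain ⟨I, c, a, β, ha, hβ, happ⟩ := h (ε * (ε / 2)) (by positivity)
  have hD : 0 < ∑ k ∈ I, |c k| * C + 1 := by
    have : 0 ≤ ∑ k ∈ I, |c k| * C := Finset.sum_nonneg fun k _ => by positivity
    linarith
  -- Rigid coefficients factor out of conditional expectations, so at each `x` they can be rounded
  -- to a finite net of constants. The mesh makes the total rounding error at most `ε / 2`; the `+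
  -- 1` avoids division by zero.
  obtain ⟨N, hN, hNC⟩ := exists_finite_net C
    (show 0 < ε / 2 / (∑ k ∈ I, |c k| * C + 1) by positivity)
  set s := ε / 2 / (∑ k ∈ I, |c k| * C + 1) with hsdef
  have hs0 : 0 < s := by positivity
  have hfin : {r : I → ℝ | ∀ k, r k ∈ N}.Finite := by
    have := Set.Finite.pi (fun _ : I => hN)
    refine this.subset fun r hr => ?_
    simpa using hr
  refine ⟨(fun (r : I → ℝ) x => ∑ k : I, c k * (a k x * r k)) '' {r | ∀ k, r k ∈ N},
    hfin.image _, ?_, ?_⟩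
  · rintro _ ⟨r, -, rfl⟩
    have hm : Measurable fun x => ∑ k : I, c k * (a k x * r k) :=
      Finset.measurable_fun_sum _ fun k _ => ((ha k).1.mul_const _).const_mul _
    refine ⟨hm, integrable_finsetSum _ fun k _ => ?_⟩
    exact ((integrable_of_abs_le (ha k).1 (ha k).2).mul_const _).const_mul _
  · filter_upwards [happ] with h hh
    have hai : ∀ k, Integrable (fun x => a k x * β k h x) μ := fun k =>
      integrable_mul_of_abs_le (integrable_of_abs_le (ha k).1 (ha k).2)
        ((hβ k h).1.mono hle le_rfl) (hβ k h).2
    have hsum : Integrable (fun x => ∑ k ∈ I, c k * (a k x * β k h x)) μ :=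
      integrable_finsetSum _ fun k _ => (hai k).const_mul _
    have hdi : Integrable (fun x => |χ (T h x) - ∑ k ∈ I, c k * (a k x * β k h x)|) μ :=
      ((T.integrable_comp h hχi).sub hsum).abs
    have key : ∀ᵐ x ∂μ, ∀ r ∈ {r : I → ℝ | ∀ k, r k ∈ N},
        (μ[fun y => |χ (T h y) - ∑ k : I, c k * (a k y * r k)| | S.rigidSigma p]) x ≤
          (μ[fun y => |χ (T h y) - ∑ k ∈ I, c k * (a k y * β k h y)| | S.rigidSigma p]) x +
            ∑ k : I, |c k| * C * |β k h x - r k| := by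
      rw [ae_ball_iff hfin.countable]
      intro r _
      have hBm : Measurable[S.rigidSigma p] fun x => ∑ k : I, |c k| * C * |β k h x - r k| := by
        refine Finset.measurable_fun_sum _ fun k _ => ?_
        have := (hβ k h).1
        exact Measurable.const_mul (continuous_abs.measurable.comp (this.sub_const _)) _
      have hβi : ∀ k : I, Integrable (fun x => |c k| * C * |β k h x - r k|) μ := fun k => by
        have h1 := integrable_of_abs_le (μ := μ) ((hβ k h).1.mono hle le_rfl) (hβ k h).2
        exact ((h1.sub (integrable_const _)).abs).const_mul _
      have hBi : Integrable (fun x => ∑ k : I, |c k| * C * |β k h x - r k|) μ :=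
        integrable_finsetSum _ fun k _ => hβi k
      refine condExp_abs_sub_le_add hle (T.integrable_comp h hχi) hsum
        (integrable_finsetSum _ fun k _ =>
          ((integrable_of_abs_le (ha k).1 (ha k).2).mul_const _).const_mul _) hBi hBm fun y => ?_
      rw [← Finset.sum_coe_sort I, ← Finset.sum_sub_distrib]
      refine (Finset.abs_sum_le_sum_abs _ _).trans (Finset.sum_le_sum fun k _ => ?_)
      rw [← mul_sub, ← mul_sub, abs_mul, abs_mul, mul_assoc]
      gcongr
      exact (ha k).2 y
    have hmark := measureReal_lt_condExp_abs_le (μ := μ) hle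
      (fun x => χ (T h x) - ∑ k ∈ I, c k * (a k x * β k h x)) (half_pos hε)
    have hmark' : (∫ x, |χ (T h x) - ∑ k ∈ I, c k * (a k x * β k h x)| ∂μ) / (ε / 2) ≤ ε := by
      rw [div_le_iff₀ (half_pos hε)]
      exact hh
    refine le_trans (ENNReal.toReal_mono (measure_ne_top _ _) (measure_mono_ae ?_))
      (hmark.trans hmark')
    filter_upwards [key] with x hx hxA
    by_contra hcon
    replace hcon := not_lt.1 hcon
    choose r hrN hr using fun k : I => hNC (β k h x) ((hβ k h).2 x)
    have h1 := hx r hrN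
    have h2 := hxA _ ⟨r, hrN, rfl⟩
    have h3 : ∑ k : I, |c k| * C * |β k h x - r k| ≤ ε / 2 := by
      calc _ ≤ ∑ k : I, |c k| * C * s := Finset.sum_le_sum fun k _ => by
            gcongr
            exact hr k
        _ = (∑ k ∈ I, |c k| * C) * s := by
            rw [← Finset.sum_mul, Finset.sum_coe_sort I (fun k => |c k| * C)]
        _ ≤ (∑ k ∈ I, |c k| * C + 1) * s := by
            gcongr
            linarith
        _ = ε / 2 := by
            rw [hsdef, mul_div_assoc']
            exact mul_div_cancel_left₀ _ hD.ne'
    dsimp only at h2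
    linarith

end MPAction

end

section

variable {G : Type*} [Group G] {p : Ultrafilter G} {X : Type*} [mX : MeasurableSpace X]
  {μ : Measure X} [IsProbabilityMeasure μ] {T S : MPAction G μ}

namespace MPAction

/-- Bounded functions orthogonal to the almost periodic sets are relatively mixing along `p`. -/
theorem tendsto_integral_mul_condExp_zero [StandardBorelSpace X] (hp : IsIdempotentFilter p)
    (hTS : T.Commute S) {φ : X → ℝ} (hφ : Measurable φ) {C : ℝ} (hC : ∀ x, |φ x| ≤ C)
    (h0 : μ[φ | T.apSigma S p] =ᵐ[μ] 0) :
    Tendsto (fun h => ∫ x, (φ x * φ (T h x)) *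
      (μ[fun y => φ y * φ (T h y) | S.rigidSigma p]) x ∂μ) p (𝓝 0) := by
  have hle := S.rigidSigma_le p
  obtain ⟨κ, hκM, hκ⟩ := exists_kernel_condExp hle μ
  have hC0 : 0 ≤ C := by
    obtain ⟨x⟩ := nonempty_of_isProbabilityMeasure μ
    exact (abs_nonneg _).trans (hC x)
  let R : MPAction G (μ ⊗ₘ κ) := relSquare hTS hκ
  have hR : ∀ g q, R g q = (T g q.1, T g q.2) := fun _ _ => rfl
  have hmul : ∀ a b : ℝ, |a| ≤ C → |b| ≤ C → |a * b| ≤ C * C := fun a b ha hb => by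
    rw [abs_mul]
    exact mul_le_mul ha hb (abs_nonneg _) hC0
  have hΦm : Measurable fun q : X × X => φ q.1 * φ q.2 := by fun_prop
  have hΦC : ∀ q : X × X, |φ q.1 * φ q.2| ≤ C * C := fun q => hmul _ _ (hC _) (hC _)
  obtain ⟨H, hHm, hH2, hHw, hHr, hHeq, hHapp⟩ := R.exists_weak_limit hp hΦm hΦC
  have hHi : Integrable H (μ ⊗ₘ κ) := hH2.integrable (by norm_num)
  have hφT : ∀ g, Measurable fun x => φ (T g x) := fun g => hφ.comp (T.measurable g)
  have hφTT : ∀ k h, Measurable fun x => φ (T k x) * φ (T h x) := fun k h => (hφT k).mul (hφT h)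
  have hFi : Integrable (fun q : X × X => H q * φ q.2) (μ ⊗ₘ κ) :=
    integrable_mul_of_abs_le hHi (hφ.comp measurable_snd) fun q => hC q.2
  have hFm : Measurable fun q : X × X => H q * φ q.2 := hHm.mul (hφ.comp measurable_snd)
  -- `H` is the weak limit of `φ ⊗ φ` under the diagonal action, and `χ` is the fibrewise integral
  -- operator with kernel `H` applied to `φ`. The aim is to show that `χ` is almost periodic, hence
  -- orthogonal to `φ`.
  let χ : X → ℝ := fun x => ∫ y, H (x, y) * φ y ∂κ x
  have hχm : Measurable χ :=
    (StronglyMeasurable.integral_kernel_prod_right (κ := κ) (f := fun x y => H (x, y) * φ y)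
      hFm.stronglyMeasurable).measurable
  have hχi : Integrable χ μ := by
    simpa [Kernel.prodMkLeft_apply] using Integrable.integral_compProd
      (κ := Kernel.const Unit μ) (η := Kernel.prodMkLeft Unit κ) (a := ()) hFi
  have hdual : ∀ (ψ : X → ℝ), Measurable ψ → ∀ D : ℝ, (∀ x, |ψ x| ≤ D) →
      ∫ x, ψ x * χ x ∂μ = ∫ q, ψ q.1 * (H q * φ q.2) ∂(μ ⊗ₘ κ) := fun ψ hψ D hD =>
    (integral_compProd_mul hψ hD hFi).symm
  -- Testing against `ψ` moves the translation by `h` onto the relative square, so no pointwise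
  -- equivariance of the kernel `κ` is needed.
  have hdualT : ∀ (h : G) (ψ : X → ℝ), Measurable ψ → ∀ D : ℝ, (∀ x, |ψ x| ≤ D) →
      ∫ x, ψ x * χ (T h x) ∂μ =
        ∫ q, ψ q.1 * (H (R h q) * φ (T h q.2)) ∂(μ ⊗ₘ κ) := by
    intro h ψ hψ D hD
    have h1 := hdual (fun x => ψ (T h⁻¹ x)) (hψ.comp (T.measurable _)) D fun x => hD _
    have h2 := T.integral_comp h (f := fun x => ψ (T h⁻¹ x) * χ x)
      ((hψ.comp (T.measurable _)).mul hχm)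
    have h3 := R.integral_comp h (f := fun q => ψ (T h⁻¹ q.1) * (H q * φ q.2))
      (((hψ.comp (T.measurable _)).comp measurable_fst).mul hFm)
    simp only [hR, T.inv_act] at h2 h3
    simp only [hR]
    rw [h2, h1, h3]
  -- Rigidity replaces `H ∘ R h` by `H`, and `H` is close to a combination of `φ ∘ T k ⊗ φ ∘ T k`.
  -- Hence `χ ∘ T h` is close to `∑ c k * (φ ∘ T k) * β k h`, where `β k h` is the conditional
  -- expectation of `φ ∘ T k * φ ∘ T h`. Only these rigid coefficients depend on `h`.
  have hAP : T.IsAlmostPeriodic S p χ := by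
    refine isAlmostPeriodic_of_approx hχi (C := C + C * C) (by positivity) fun ε hε => ?_
    have hδ : 0 < ε / (2 * (C + 1)) := by positivity
    obtain ⟨c, hc⟩ := hHapp _ hδ
    have hb : ∀ k h x, |φ (T k x) * φ (T h x)| ≤ C * C := fun k h x => hmul _ _ (hC _) (hC _)
    choose β hβm hβ1 hβ2 hβe _ using fun k h => S.exists_rigid_condExp hp
      (hφTT k h) (fun x => (abs_le.1 (hb k h x)).1) (fun x => (abs_le.1 (hb k h x)).2)
    refine ⟨c.support, c, fun k x => φ (T k x), β, fun k => ⟨hφT k, fun x => (hC _).trans ?_⟩,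
      fun k h => ⟨hβm k h, fun x => (abs_le.2 ⟨hβ1 k h x, hβ2 k h x⟩).trans ?_⟩, ?_⟩
    · exact le_add_of_nonneg_right (by positivity)
    · exact le_add_of_nonneg_left hC0
    filter_upwards [hHr.eventually (gt_mem_nhds hδ)] with h hh
    have hβm' : ∀ k, Measurable (β k h) := fun k => (hβm k h).mono hle le_rfl
    have hβb : ∀ k x, |β k h x| ≤ C * C := fun k x => abs_le.2 ⟨hβ1 k h x, hβ2 k h x⟩
    have hsm : Measurable fun x => ∑ k ∈ c.support, c k * (φ (T k x) * β k h x) :=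
      Finset.measurable_fun_sum _ fun k _ => ((hφT k).mul (hβm' k)).const_mul _
    refine integral_abs_le_of_forall_mul_le
      (f := fun x => χ (T h x) - ∑ k ∈ c.support, c k * (φ (T k x) * β k h x))
      ((hχm.comp (T.measurable h)).sub hsm) ?_
    intro ψ hψ hψ1
    have hψφ : ∀ k, Measurable fun x => ψ x * φ (T k x) := fun k => hψ.mul (hφT k)
    have hψφC : ∀ k x, |ψ x * φ (T k x)| ≤ C := fun k x => by
      rw [abs_mul]
      exact (mul_le_mul (hψ1 x) (hC _) (abs_nonneg _) zero_le_one).trans (one_mul C).le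
    have e1 : ∀ k, ∫ x, ψ x * φ (T k x) * β k h x ∂μ =
        ∫ q, ψ q.1 * φ (T k q.1) * (φ (T k q.2) * φ (T h q.2)) ∂(μ ⊗ₘ κ) := by
      intro k
      rw [integral_compProd_mul_condExp hκ (hψφ k) (hφTT k h) (hψφC k) (hb k h)]
      refine integral_congr_ae ?_
      filter_upwards [hβe k h] with x hx
      rw [hx]
    have i1 : Integrable (fun x => ψ x * χ (T h x)) μ := by
      simpa [mul_comm] using integrable_mul_of_abs_le (T.integrable_comp h hχi) hψ hψ1
    have i2 : ∀ k, Integrable (fun x => c k * (ψ x * φ (T k x) * β k h x)) μ := fun k =>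
      (integrable_mul_of_abs_le (integrable_of_abs_le (hψφ k) (hψφC k)) (hβm' k)
        (hβb k)).const_mul _
    have e2 : ∫ x, ψ x * (χ (T h x) - ∑ k ∈ c.support, c k * (φ (T k x) * β k h x)) ∂μ =
        ∫ x, ψ x * χ (T h x) ∂μ -
          ∑ k ∈ c.support, c k * ∫ x, ψ x * φ (T k x) * β k h x ∂μ := by
      simp_rw [← integral_const_mul]
      rw [← integral_finsetSum _ fun k _ => i2 k,
        ← integral_sub i1 (integrable_finsetSum _ fun k _ => i2 k)]
      refine integral_congr_ae (Eventually.of_forall fun x => ?_)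
      dsimp only
      rw [mul_sub, Finset.mul_sum]
      congr 1
      exact Finset.sum_congr rfl fun k _ => by ring
    have hψ1' : Measurable fun q : X × X => ψ q.1 * φ (T h q.2) :=
      (hψ.comp measurable_fst).mul ((hφT h).comp measurable_snd)
    have hψ1C : ∀ q : X × X, |ψ q.1 * φ (T h q.2)| ≤ C := fun q => by
      rw [abs_mul]
      exact (mul_le_mul (hψ1 _) (hC _) (abs_nonneg _) zero_le_one).trans (one_mul C).le
    have j0 : Integrable (fun q => H (R h q)) (μ ⊗ₘ κ) := R.integrable_comp h hHi
    have j1 : Integrable (fun q : X × X => ψ q.1 * (H (R h q) * φ (T h q.2))) (μ ⊗ₘ κ) := by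
      refine (integrable_mul_of_abs_le j0 hψ1' hψ1C).congr (Eventually.of_forall fun q => ?_)
      dsimp only
      ring
    have hΦR : ∀ k, Integrable (fun q => c k * (φ (R k q).1 * φ (R k q).2)) (μ ⊗ₘ κ) := fun k =>
      (R.integrable_comp k (integrable_of_abs_le hΦm hΦC)).const_mul (c k)
    have j2 : ∀ k, Integrable (fun q : X × X => c k * (ψ q.1 * φ (T k q.1) *
        (φ (T k q.2) * φ (T h q.2)))) (μ ⊗ₘ κ) := by
      intro k
      refine (integrable_mul_of_abs_le (hΦR k) hψ1' hψ1C).congr (Eventually.of_forall fun q => ?_)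
      simp only [hR]
      ring
    rw [e2, hdualT h ψ hψ 1 hψ1]
    simp_rw [e1, ← integral_const_mul]
    rw [← integral_finsetSum _ fun k _ => j2 k,
      ← integral_sub j1 (integrable_finsetSum _ fun k _ => j2 k)]
    have j3 : Integrable (fun q => |H (R h q) - H q|) (μ ⊗ₘ κ) := (j0.sub hHi).abs
    have j4 : Integrable (fun q => |H q - c.sum fun k r => r * (φ (R k q).1 * φ (R k q).2)|)
        (μ ⊗ₘ κ) := (hHi.sub (integrable_finsetSum _ fun k _ => hΦR k)).abs
    calc _ ≤ ∫ q, C * (|H (R h q) - H q| +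
          |H q - c.sum fun k r => r * (φ (R k q).1 * φ (R k q).2)|) ∂(μ ⊗ₘ κ) := by
          refine integral_mono (j1.sub (integrable_finsetSum _ fun k _ => j2 k))
            ((j3.add j4).const_mul C) fun q => ?_
          have : ψ q.1 * (H (R h q) * φ (T h q.2)) - ∑ k ∈ c.support, c k *
              (ψ q.1 * φ (T k q.1) * (φ (T k q.2) * φ (T h q.2))) =
              (ψ q.1 * φ (T h q.2)) * ((H (R h q) - H q) +
                (H q - c.sum fun k r => r * (φ (R k q).1 * φ (R k q).2))) := by
            simp only [Finsupp.sum, hR]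
            rw [sub_add_sub_cancel, mul_sub, Finset.mul_sum]
            congr 1
            · ring
            · exact Finset.sum_congr rfl fun k _ => by ring
          dsimp only
          rw [this]
          refine (le_abs_self _).trans ?_
          rw [abs_mul]
          exact mul_le_mul (hψ1C q) (abs_add_le _ _) (abs_nonneg _) hC0
      _ ≤ C * (ε / (2 * (C + 1)) + ε / (2 * (C + 1))) := by
          rw [integral_const_mul, integral_add j3 j4]
          gcongr
      _ ≤ (C + 1) * (ε / (2 * (C + 1)) + ε / (2 * (C + 1))) := by
          gcongr
          linarith
      _ = ε := by
          field_simp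
          ring
  have hχZ : Measurable[T.apSigma S p] χ :=
    (T.isLipschitzClass_isAlmostPeriodic S p).measurable_sigma hχm hχi hAP
  have hφi : Integrable φ μ := integrable_of_abs_le hφ hC
  have hzero : ∫ x, φ x * χ x ∂μ = 0 := by
    have hi : Integrable (χ * φ) μ := integrable_mul_of_abs_le hχi hφ hC
    have h1 := condExp_mul_of_stronglyMeasurable_left hχZ.stronglyMeasurable hi hφi
    calc ∫ x, φ x * χ x ∂μ = ∫ x, (χ * φ) x ∂μ :=
          integral_congr_ae (Eventually.of_forall fun x => by simp [mul_comm])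
      _ = ∫ x, (μ[χ * φ | T.apSigma S p]) x ∂μ := (integral_condExp (T.apSigma_le S p)).symm
      _ = ∫ x, (0 : ℝ) ∂μ := by
          refine integral_congr_ae ?_
          filter_upwards [h1, h0] with x h1 h2
          rw [h1, Pi.mul_apply, h2]
          simp
      _ = 0 := by simp
  have hH0 : ∫ q, H q * (φ q.1 * φ q.2) ∂(μ ⊗ₘ κ) = 0 := by
    rw [← hzero, hdual φ hφ C hC]
    refine integral_congr_ae (Eventually.of_forall fun q => ?_)
    dsimp only
    ring
  have hfin := hHw (fun q => φ q.1 * φ q.2) (memLp_of_abs_le hΦm hΦC)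
  rw [hH0] at hfin
  refine hfin.congr fun h => ?_
  have hb : ∀ x, |φ x * φ (T h x)| ≤ C * C := fun x => hmul _ _ (hC _) (hC _)
  have hφφ : Measurable fun x => φ x * φ (T h x) := hφ.mul (hφT h)
  rw [← integral_compProd_mul_condExp hκ hφφ hφφ hb hb]
  refine integral_congr_ae (Eventually.of_forall fun q => ?_)
  simp only [hR]
  ring

end MPAction

end

/-! ### The random part does not contribute to corners. -/

section

variable {G : Type*} [Group G] {p : Ultrafilter G} {X : Type*} [mX : MeasurableSpace X]
  {μ : Measure X} [IsProbabilityMeasure μ] {T S : MPAction G μ}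

theorem abs_mul_le_one {a b : ℝ} (ha : |a| ≤ 1) (hb : |b| ≤ 1) : |a * b| ≤ 1 := by
  rw [abs_mul]
  exact mul_le_one₀ ha (abs_nonneg _) hb

theorem sum_integral_mul_nonneg {ι : Type*} [Fintype ι] {w : ι → X → ℝ}
    (hw : ∀ i, Measurable (w i)) {C : ℝ} (hC : ∀ i x, |w i x| ≤ C) :
    0 ≤ ∑ i, ∑ j, ∫ x, w i x * w j x ∂μ := by
  have hi : ∀ i j, Integrable (fun x => w i x * w j x) μ := fun i j =>
    integrable_mul_of_abs_le (integrable_of_abs_le (hw i) (hC i)) (hw j) (hC j)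
  have : ∑ i, ∑ j, ∫ x, w i x * w j x ∂μ = ∫ x, (∑ i, w i x) * (∑ j, w j x) ∂μ := by
    simp_rw [Finset.sum_mul_sum]
    rw [integral_finsetSum _ fun i _ => integrable_finsetSum _ fun j _ => hi i j]
    exact Finset.sum_congr rfl fun i _ => (integral_finsetSum _ fun j _ => hi i j).symm
  rw [this]
  exact integral_nonneg fun x => mul_self_nonneg _

theorem integral_mul_self_le_of_abs_le {w : X → ℝ} (hw : Measurable w) {C : ℝ}
    (hC : ∀ x, |w x| ≤ C) : ∫ x, w x * w x ∂μ ≤ C * C := by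
  have : ∫ x, w x * w x ∂μ ≤ ∫ x, C * C ∂μ := by
    refine integral_mono (integrable_mul_of_abs_le (integrable_of_abs_le hw hC)
      hw hC) (integrable_const _) fun x => ?_
    dsimp only
    rw [← abs_mul_abs_self]
    exact mul_le_mul (hC x) (hC x) (abs_nonneg _) ((abs_nonneg _).trans (hC x))
  simpa using this

namespace MPAction

/-- Weak limits of the Gram kernel `d i * d j`, raised to a power, form a positive semidefinite
kernel. -/
theorem sum_integral_mul_pow_nonneg {ι : Type*} [Fintype ι] (S : MPAction G μ)
    {d : ι → X → ℝ} (hd : ∀ i, Measurable (d i)) {D : ℝ} (hdD : ∀ i x, |d i x| ≤ D)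
    {e : ι → ι → X → ℝ} (he : ∀ i j, Measurable (e i j)) {E : ℝ} (heE : ∀ i j x, |e i j x| ≤ E)
    (hlim : ∀ i j, ∀ ψ : X → ℝ, MemLp ψ 2 μ →
      Tendsto (fun g => ∫ x, d i (S g x) * d j (S g x) * ψ x ∂μ) p (𝓝 (∫ x, e i j x * ψ x ∂μ)))
    (n : ℕ) : ∀ (w : ι → X → ℝ), (∀ i, Measurable (w i)) → ∀ C : ℝ, (∀ i x, |w i x| ≤ C) →
      0 ≤ ∑ i, ∑ j, ∫ x, w i x * w j x * e i j x ^ n ∂μ := by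
  have hmul : ∀ {a b A B : ℝ}, |a| ≤ A → |b| ≤ B → |a * b| ≤ A * B := fun ha hb => by
    rw [abs_mul]
    exact mul_le_mul ha hb (abs_nonneg _) ((abs_nonneg _).trans ha)
  induction n with
  | zero =>
    intro w hw C hC
    simpa using sum_integral_mul_nonneg hw hC
  | succ n ih =>
    intro w hw C hC
    have hψm : ∀ i j, Measurable fun x => w i x * w j x * e i j x ^ n := fun i j =>
      ((hw i).mul (hw j)).mul ((he i j).pow_const n)
    have hψb : ∀ i j x, |w i x * w j x * e i j x ^ n| ≤ C * C * E ^ n := fun i j x =>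
      hmul (hmul (hC i x) (hC j x)) (by
        rw [abs_pow]
        exact pow_le_pow_left₀ (abs_nonneg _) (heE i j x) n)
    have h1 : Tendsto (fun g => ∑ i, ∑ j, ∫ x, d i (S g x) * d j (S g x) *
        (w i x * w j x * e i j x ^ n) ∂μ) p
        (𝓝 (∑ i, ∑ j, ∫ x, e i j x * (w i x * w j x * e i j x ^ n) ∂μ)) :=
      tendsto_finsetSum _ fun i _ => tendsto_finsetSum _ fun j _ =>
        hlim i j _ (memLp_of_abs_le (hψm i j) (hψb i j))
    -- One factor `e i j` is the weak limit of `d i (S g x) * d j (S g x)`, a product that is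
    -- absorbed into the weights `w i` and `w j`. This is a Schur product argument, one power at a
    -- time.
    refine (ge_of_tendsto h1 (Eventually.of_forall fun g => ?_)).trans (le_of_eq ?_)
    · have h2 := ih (fun i x => w i x * d i (S g x))
        (fun i => (hw i).mul ((hd i).comp (S.measurable g))) (C * D)
        (fun i x => hmul (hC i x) (hdD i _))
      refine h2.trans (le_of_eq ?_)
      refine Finset.sum_congr rfl fun i _ => Finset.sum_congr rfl fun j _ => ?_
      refine integral_congr_ae (Eventually.of_forall fun x => ?_)
      dsimp only
      ring
    · refine Finset.sum_congr rfl fun i _ => Finset.sum_congr rfl fun j _ => ?_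
      refine integral_congr_ae (Eventually.of_forall fun x => ?_)
      dsimp only
      ring

/-- After removing `T g` by invariance, the `c`-factors appear composed with `S g`, and their weak
limit is a rigid function `b` bounded by 1. Only the conditional expectation of `φ * φ ∘ T h` meets
`b`, and it is small in `L²` by relative mixing. -/
theorem eventually_integral_mul_lt [StandardBorelSpace X] (hp : IsIdempotentFilter p)
    (hTS : T.Commute S) {φ : X → ℝ} (hφ : Measurable φ) (hφ1 : ∀ x, |φ x| ≤ 1)
    (h0 : μ[φ | T.apSigma S p] =ᵐ[μ] 0) {c : X → ℝ} (hc : Measurable c) (hc1 : ∀ x, |c x| ≤ 1)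
    {s : ℝ} (hs : 0 < s) :
    ∀ᶠ h in (p : Filter G), ∀ᶠ g in (p : Filter G),
      ∫ x, (φ (T g x) * c (S g (T g x))) * (φ (T (g * h) x) * c (S (g * h) (T (g * h) x))) ∂μ
        < 2 * s := by
  have hle := S.rigidSigma_le p
  have h7 := tendsto_integral_mul_condExp_zero hp hTS hφ hφ1 h0
  filter_upwards [h7.eventually (gt_mem_nhds (show (0 : ℝ) < s ^ 2 by positivity))] with h hh
  have hΦm : Measurable fun x => φ x * φ (T h x) := hφ.mul (hφ.comp (T.measurable h))
  have hΦ1 : ∀ x, |φ x * φ (T h x)| ≤ 1 := fun x => abs_mul_le_one (hφ1 _) (hφ1 _)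
  have hΨm : Measurable fun x => c x * c (S h (T h x)) :=
    hc.mul (hc.comp ((S.measurable h).comp (T.measurable h)))
  have hΨ1 : ∀ x, |c x * c (S h (T h x))| ≤ 1 := fun x => abs_mul_le_one (hc1 _) (hc1 _)
  obtain ⟨e, hem, he1, he2, hee, -⟩ := S.exists_rigid_condExp hp hΦm
    (fun x => (abs_le.1 (hΦ1 x)).1) (fun x => (abs_le.1 (hΦ1 x)).2)
  obtain ⟨b, hbm, hb1, hb2, -, hblim⟩ := S.exists_rigid_condExp hp hΨm
    (fun x => (abs_le.1 (hΨ1 x)).1) (fun x => (abs_le.1 (hΨ1 x)).2)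
  have hΦi := integrable_of_abs_le (μ := μ) hΦm hΦ1
  have hea : ∀ x, |e x| ≤ 1 := fun x => abs_le.2 ⟨he1 x, he2 x⟩
  have hba : ∀ x, |b x| ≤ 1 := fun x => abs_le.2 ⟨hb1 x, hb2 x⟩
  have hem' : Measurable e := hem.mono hle le_rfl
  have hbm' : Measurable b := hbm.mono hle le_rfl
  have hei := integrable_of_abs_le (μ := μ) hem' hea
  have hesq : ∫ x, e x * e x ∂μ < s ^ 2 := by
    rw [← integral_mul_eq_of_ae_eq_condExp hle hΦi hee hem hea]
    refine lt_of_eq_of_lt (integral_congr_ae ?_) hh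
    filter_upwards [hee] with x hx
    rw [hx]
  have hlim := hblim _ (memLp_of_abs_le hΦm hΦ1)
  have hbe : ∫ x, b x * (φ x * φ (T h x)) ∂μ ≤ s := by
    calc ∫ x, b x * (φ x * φ (T h x)) ∂μ = ∫ x, (φ x * φ (T h x)) * b x ∂μ := by
          simp_rw [mul_comm (b _)]
      _ = ∫ x, e x * b x ∂μ := integral_mul_eq_of_ae_eq_condExp hle hΦi hee hbm hba
      _ ≤ ∫ x, ((e x * e x) / (2 * s) + s / 2) ∂μ := by
          refine integral_mono (integrable_mul_of_abs_le hei hbm' hba)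
            (((integrable_mul_of_abs_le hei hem' hea).div_const _).add (integrable_const _))
            fun x => ?_
          have h1 : e x * b x ≤ |e x| := by
            refine (le_abs_self _).trans ?_
            rw [abs_mul]
            exact mul_le_of_le_one_right (abs_nonneg _) (hba x)
          have h2 : |e x| * (2 * s) ≤ e x * e x + s / 2 * (2 * s) := by
            rw [← abs_mul_abs_self (e x)]
            nlinarith [sq_nonneg (|e x| - s)]
          have h3 : |e x| ≤ (e x * e x) / (2 * s) + s / 2 := by
            rw [div_add' _ _ _ (by positivity), le_div_iff₀ (by positivity)]
            exact h2
          exact h1.trans h3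
      _ = (∫ x, e x * e x ∂μ) / (2 * s) + s / 2 := by
          rw [integral_add ((integrable_mul_of_abs_le hei hem' hea).div_const _)
            (integrable_const _), integral_div]
          simp
      _ ≤ s ^ 2 / (2 * s) + s / 2 := by gcongr
      _ = s := by
          field_simp
          ring
  filter_upwards [hlim.eventually (gt_mem_nhds (show _ < 2 * s by linarith))] with g hg
  refine lt_of_eq_of_lt ?_ hg
  rw [← T.integral_comp g (f := fun x => c (S g x) * c (S h (T h (S g x))) *
    (φ x * φ (T h x))) ((hΨm.comp (S.measurable g)).mul hΦm)]
  refine integral_congr_ae (Eventually.of_forall fun x => ?_)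
  dsimp only
  rw [T.act_mul, S.act_mul, hTS h g]
  ring

/-- Functions orthogonal to the almost periodic sets do not contribute to the limit of
corner averages. -/
theorem tendsto_integral_corner_zero [StandardBorelSpace X] (hp : IsIdempotentFilter p)
    (hTS : T.Commute S) {φ : X → ℝ} (hφ : Measurable φ) (hφ1 : ∀ x, |φ x| ≤ 1)
    (h0 : μ[φ | T.apSigma S p] =ᵐ[μ] 0) {c : X → ℝ} (hc : Measurable c) (hc1 : ∀ x, |c x| ≤ 1)
    {a : X → ℝ} (ha : Measurable a) (ha1 : ∀ x, |a x| ≤ 1) :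
    Tendsto (fun g => ∫ x, a x * (φ (T g x) * c (S g (T g x))) ∂μ) p (𝓝 0) := by
  have key : ∀ (a : X → ℝ), Measurable a → (∀ x, |a x| ≤ 1) → ∀ η > 0,
      ¬ ∀ᶠ g in (p : Filter G), η < ∫ x, a x * (φ (T g x) * c (S g (T g x))) ∂μ := by
    intro a ha ha1 η hη H
    set u : G → X → ℝ := fun g x => φ (T g x) * c (S g (T g x)) with hu
    have hum : ∀ g, Measurable (u g) := fun g =>
      (hφ.comp (T.measurable g)).mul (hc.comp ((S.measurable g).comp (T.measurable g)))
    have hu1 : ∀ g x, |u g x| ≤ 1 := fun g x => abs_mul_le_one (hφ1 _) (hc1 _)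
    -- If all `u g` correlate with `a` by more than `η` while `u g` and `u (g * h)` correlate by
    -- less than `η ^ 2 / 2`, the Gram kernel of the `w g` is below `η ^ 2 / 2 - 2 * η ^ 2 + η ^ 2 =
    -- -η ^ 2 / 2`, contradicting positivity.
    set w : G → X → ℝ := fun g x => u g x - η * a x with hw
    have hwm : ∀ g, Measurable (w g) := fun g => (hum g).sub (ha.const_mul η)
    have hw1 : ∀ g x, |w g x| ≤ 1 + η := fun g x => by
      refine (abs_sub _ _).trans (add_le_add (hu1 g x) ?_)
      rw [abs_mul, abs_of_pos hη]
      exact mul_le_of_le_one_right hη.le (ha1 x)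
    refine hp.kernel_nonneg (k := fun g g' => ∫ x, w g x * w g' x ∂μ)
      (fun g h => by simp_rw [mul_comm]) ?_ (C := (1 + η) * (1 + η)) ?_
      (ε := η ^ 2 / 4) (by positivity) ?_
    · exact fun N v => sum_integral_mul_nonneg (fun i => hwm (v i)) fun i => hw1 (v i)
    · exact fun g => integral_mul_self_le_of_abs_le (hwm g) (hw1 g)
    · filter_upwards [hp _ H, eventually_integral_mul_lt hp hTS hφ hφ1 h0 hc hc1
        (s := η ^ 2 / 4) (by positivity)] with h hh1 hh2
      filter_upwards [H, hh1, hh2] with g hg1 hg2 hg3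
      have hui : ∀ g, Integrable (u g) μ := fun g => integrable_of_abs_le (hum g) (hu1 g)
      have hai : Integrable a μ := integrable_of_abs_le ha ha1
      have i1 : Integrable (fun x => u g x * u (g * h) x) μ :=
        integrable_mul_of_abs_le (hui g) (hum _) (hu1 _)
      have i2 : ∀ g, Integrable (fun x => η * (a x * u g x)) μ := fun g =>
        (integrable_mul_of_abs_le hai (hum _) (hu1 _)).const_mul _
      have i3 : Integrable (fun x => η ^ 2 * (a x * a x)) μ :=
        (integrable_mul_of_abs_le hai ha ha1).const_mul _
      have e1 : ∫ x, w g x * w (g * h) x ∂μ = ∫ x, u g x * u (g * h) x ∂μ -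
          η * ∫ x, a x * u g x ∂μ - η * ∫ x, a x * u (g * h) x ∂μ + η ^ 2 * ∫ x, a x * a x ∂μ := by
        rw [← integral_const_mul, ← integral_const_mul, ← integral_const_mul,
          ← integral_sub i1 (i2 g), ← integral_sub (f := fun x => _ - _) (i1.sub (i2 g)) (i2 _),
          ← integral_add (f := fun x => _ - _) ((i1.sub (i2 g)).sub (i2 _)) i3]
        refine integral_congr_ae (Eventually.of_forall fun x => ?_)
        simp only [hw]
        ring
      have e2 : ∫ x, a x * a x ∂μ ≤ 1 := by
        have : ∫ x, a x * a x ∂μ ≤ ∫ x, (1 : ℝ) ∂μ :=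
          integral_mono (integrable_mul_of_abs_le hai ha ha1) (integrable_const _) fun x =>
            (le_abs_self _).trans (abs_mul_le_one (ha1 x) (ha1 x))
        simpa using this
      rw [e1]
      have hg1' : η < ∫ x, a x * u g x ∂μ := hg1
      have hg2' : η < ∫ x, a x * u (g * h) x ∂μ := hg2
      have hg3' : ∫ x, u g x * u (g * h) x ∂μ < 2 * (η ^ 2 / 4) := hg3
      have f1 := mul_lt_mul_of_pos_left hg1' hη
      have f2 := mul_lt_mul_of_pos_left hg2' hη
      have f3 := mul_le_mul_of_nonneg_left e2 (sq_nonneg η)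
      nlinarith
  rw [Metric.tendsto_nhds]
  intro ε hε
  have h1 := Ultrafilter.eventually_not.2 (key a ha ha1 (ε / 2) (by positivity))
  have h2 := Ultrafilter.eventually_not.2
    (key (fun x => -a x) ha.neg (fun x => by rw [abs_neg]; exact ha1 x) (ε / 2) (by positivity))
  filter_upwards [h1, h2] with g h1 h2
  simp only [neg_mul, integral_neg, not_lt] at h1 h2
  rw [dist_zero_right, Real.norm_eq_abs, abs_lt]
  constructor <;> linarith

end MPAction

end

/-! ### Uniform recurrence of almost periodic functions. -/

section

variable {G : Type*} [Group G] {p : Ultrafilter G} {X : Type*} [mX : MeasurableSpace X]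
  {μ : Measure X} [IsProbabilityMeasure μ] {T S : MPAction G μ}

theorem integral_indicator_sub_mul_indicator_sub {A B : Set X} (hA : MeasurableSet A)
    (hB : MeasurableSet B) (t : ℝ) :
    ∫ x, (A.indicator (fun _ => (1 : ℝ)) x - t) * (B.indicator (fun _ => (1 : ℝ)) x - t) ∂μ =
      μ.real (A ∩ B) - t * μ.real A - t * μ.real B + t ^ 2 := by
  have hi : ∀ {A : Set X}, MeasurableSet A → ∫ x, A.indicator (fun _ => (1 : ℝ)) x ∂μ = μ.real A :=
    fun hA => by
      rw [integral_indicator hA]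
      simp
  have iA := (integrable_indicator_one (μ := μ) hA).const_mul t
  have iB := (integrable_indicator_one (μ := μ) hB).const_mul t
  have iAB := integrable_indicator_one (μ := μ) (hA.inter hB)
  rw [← hi hA, ← hi hB, ← hi (hA.inter hB), ← integral_const_mul, ← integral_const_mul,
    ← integral_sub iAB iA, ← integral_sub (f := fun x => _ - _) (iAB.sub iA) iB]
  have h2 : ∫ _x : X, t ^ 2 ∂μ = t ^ 2 := by simp
  rw [← h2, ← integral_add (f := fun x => _ - _) ((iAB.sub iA).sub iB) (integrable_const _)]
  refine integral_congr_ae (Eventually.of_forall fun x => ?_)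
  by_cases h1 : x ∈ A <;> by_cases h2 : x ∈ B <;> simp [h1, h2] <;> ring

namespace MPAction

theorem condExp_abs_sub_le {m : MeasurableSpace X} {f g ψ : X → ℝ} (hf : Integrable f μ)
    (hg : Integrable g μ) (hψ : Integrable ψ μ) :
    ∀ᵐ x ∂μ, (μ[fun y => |f y - g y| | m]) x ≤
      (μ[fun y => |f y - ψ y| | m]) x + (μ[fun y => |g y - ψ y| | m]) x := by
  have i1 : Integrable (fun y => |f y - ψ y|) μ := (hf.sub hψ).abs
  have i2 : Integrable (fun y => |g y - ψ y|) μ := (hg.sub hψ).abs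
  have e1 := condExp_mono (m := m) (hf.sub hg).abs (i1.add i2)
    (Eventually.of_forall fun y => by
      have := abs_sub_le (f y) (ψ y) (g y)
      rw [abs_sub_comm (ψ y)] at this
      exact this)
  have e2 := condExp_add i1 i2 m
  filter_upwards [e1, e2] with x e1 e2
  rw [e2] at e1
  exact e1

/-- An almost periodic function returns close to itself on a set of uniformly positive measure. -/
theorem IsAlmostPeriodic.exists_le_measureReal (hp : IsIdempotentFilter p) (hTS : T.Commute S)
    {d : X → ℝ} (hd : Measurable d) {D : ℝ} (hdD : ∀ x, |d x| ≤ D)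
    (hAP : T.IsAlmostPeriodic S p d) {Y : Set X} (hY : MeasurableSet Y) (hY0 : 0 < μ.real Y)
    {δ : ℝ} (hδ : 0 < δ) :
    ∃ κ > 0, ∀ᶠ h in (p : Filter G), κ ≤ μ.real {x | x ∈ Y ∧ T h x ∈ Y ∧
      (μ[fun y => |d (T h y) - d y| | S.rigidSigma p]) x ≤ δ} := by
  have hle := S.rigidSigma_le p
  set m := μ.real Y / 2 with hm
  have hm0 : 0 < m := by positivity
  obtain ⟨Ψ, hΨf, hΨ, happ⟩ := hAP (min (δ / 2) m) (by positivity)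
  set ε := min (δ / 2) m with hε
  lift Ψ to Finset (X → ℝ) using hΨf
  set M : ℝ := Ψ.card + 1 with hM
  have hM0 : 0 < M := by positivity
  have hcE : ∀ f : X → ℝ, Measurable (μ[f | S.rigidSigma p]) := fun f =>
    (stronglyMeasurable_condExp.measurable).mono hle le_rfl
  -- The sets `W ψ g` sort the points of `(T g)⁻¹ Y` by a net element close to `d ∘ T g`. A point of
  -- `W ψ g ∩ W ψ (g * h)` is sent by `T g` to a point of `Y` returning under `T h` with conditional
  -- error at most `2 * ε ≤ δ`.
  let W : (X → ℝ) → G → Set X := fun ψ g =>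
    {x | T g x ∈ Y ∧ (μ[fun y => |d (T g y) - ψ y| | S.rigidSigma p]) x ≤ ε}
  have hW : ∀ ψ g, MeasurableSet (W ψ g) := fun ψ g =>
    (T.measurable g hY).inter (measurableSet_le (hcE _) measurable_const)
  have hdi : ∀ g, Integrable (fun x => d (T g x)) μ := fun g =>
    T.integrable_comp g (integrable_of_abs_le hd hdD)
  have hsum : ∀ᶠ g in (p : Filter G), m ≤ ∑ ψ ∈ Ψ, μ.real (W ψ g) := by
    filter_upwards [happ] with g hg
    have h1 : μ.real (T g ⁻¹' Y) ≤ μ.real (⋃ ψ ∈ Ψ, W ψ g) + μ.real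
        {x | ∀ ψ ∈ Ψ, ε < (μ[fun y => |d (T g y) - ψ y| | S.rigidSigma p]) x} := by
      refine measureReal_le_add_of_ae (Eventually.of_forall fun x hx => ?_)
      by_contra! h
      refine h.2 fun ψ hψ => ?_
      by_contra! h'
      exact h.1 (Set.mem_biUnion (Finset.mem_coe.2 hψ) ⟨hx, h'⟩)
    rw [(T.mp g).measureReal_preimage hY.nullMeasurableSet] at h1
    have h2 := measureReal_biUnion_finset_le (μ := μ) Ψ fun ψ => W ψ g
    have h3 : ε ≤ m := min_le_right _ _
    have h4 : μ.real Y = 2 * m := by rw [hm]; ring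
    simp only [Finset.mem_coe] at hg
    linarith
  -- If the return set had smaller measure, the kernel of the indicators centred at `t = m / M`
  -- would be below `M * κ + M * t ^ 2 - 2 * t * m = -m ^ 2 / (2 * M)`.
  refine ⟨m ^ 2 / (2 * M ^ 2), by positivity, ?_⟩
  by_contra H
  rw [← Ultrafilter.eventually_not] at H
  set t := m / M with ht
  have ht0 : 0 < t := by positivity
  let w : (X → ℝ) → G → X → ℝ := fun ψ g x => (W ψ g).indicator (fun _ => (1 : ℝ)) x - t
  have hwm : ∀ ψ g, Measurable (w ψ g) := fun ψ g =>
    (measurable_const.indicator (hW ψ g)).sub measurable_const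
  have hw1 : ∀ ψ g x, |w ψ g x| ≤ 1 + t := fun ψ g x => by
    refine (abs_sub _ _).trans (add_le_add ?_ (abs_of_pos ht0).le)
    by_cases hx : x ∈ W ψ g <;> simp [hx]
  have hkey := hp.kernel_nonneg (k := fun g g' => ∑ ψ ∈ Ψ, ∫ x, w ψ g x * w ψ g' x ∂μ)
    (C := ∑ ψ ∈ Ψ, (1 + t) * (1 + t)) (ε := m ^ 2 / (2 * M)) (fun g h =>
      Finset.sum_congr rfl fun ψ _ =>
        integral_congr_ae (Eventually.of_forall fun x => mul_comm (w ψ g x) (w ψ h x)))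
    (fun N v => by
      have : ∑ i, ∑ j, ∑ ψ ∈ Ψ, ∫ x, w ψ (v i) x * w ψ (v j) x ∂μ =
          ∑ ψ ∈ Ψ, ∑ i, ∑ j, ∫ x, w ψ (v i) x * w ψ (v j) x ∂μ := by
        rw [Finset.sum_comm (s := Ψ)]
        exact Finset.sum_congr rfl fun i _ => Finset.sum_comm
      rw [this]
      exact Finset.sum_nonneg fun ψ _ =>
        sum_integral_mul_nonneg (fun i => hwm ψ (v i)) fun i => hw1 ψ (v i))
    (fun g => Finset.sum_le_sum fun ψ _ => integral_mul_self_le_of_abs_le (hwm ψ g) (hw1 ψ g))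
    (by positivity)
  refine hkey ?_
  filter_upwards [hp _ hsum, H] with h hh1 hh2
  filter_upwards [hsum, hh1] with g hg1 hg2
  have hE : ∀ ψ ∈ Ψ, μ.real (W ψ g ∩ W ψ (g * h)) ≤ μ.real {x | x ∈ Y ∧ T h x ∈ Y ∧
      (μ[fun y => |d (T h y) - d y| | S.rigidSigma p]) x ≤ δ} := by
    intro ψ hψ
    rw [← (T.mp g).measureReal_preimage (s := {x | x ∈ Y ∧ T h x ∈ Y ∧
      (μ[fun y => |d (T h y) - d y| | S.rigidSigma p]) x ≤ δ}) (hY.inter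
        ((T.measurable h hY).inter (measurableSet_le (hcE _) measurable_const))).nullMeasurableSet]
    have e1 := hTS.condExp_comp p g (φ := fun y => |d (T h y) - d y|)
      (((hd.comp (T.measurable h)).sub hd).abs) ((hdi h).sub (integrable_of_abs_le hd hdD)).abs
    have e2 := condExp_abs_sub_le (m := S.rigidSigma p) (hdi (g * h)) (hdi g) (hΨ ψ hψ).2
    refine ENNReal.toReal_mono (measure_ne_top _ _) (measure_mono_ae ?_)
    filter_upwards [e1, e2] with x e1 e2 hx
    obtain ⟨⟨h1, h2⟩, h3, h4⟩ := hx
    simp only [T.act_mul] at h3 h4 e2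
    refine ⟨h1, h3, ?_⟩
    rw [← e1]
    have : ε ≤ δ / 2 := min_le_left _ _
    linarith
  have hE0 := not_le.1 hh2
  set E := μ.real {x | x ∈ Y ∧ T h x ∈ Y ∧
      (μ[fun y => |d (T h y) - d y| | S.rigidSigma p]) x ≤ δ} with hEdef
  have hE0' : 0 ≤ E := measureReal_nonneg
  calc ∑ ψ ∈ Ψ, ∫ x, w ψ g x * w ψ (g * h) x ∂μ
      = ∑ ψ ∈ Ψ, (μ.real (W ψ g ∩ W ψ (g * h)) - t * μ.real (W ψ g) -
          t * μ.real (W ψ (g * h)) + t ^ 2) :=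
        Finset.sum_congr rfl fun ψ _ => integral_indicator_sub_mul_indicator_sub (hW _ _) (hW _ _) t
    _ ≤ ∑ ψ ∈ Ψ, (E - t * μ.real (W ψ g) - t * μ.real (W ψ (g * h)) + t ^ 2) := by
        refine Finset.sum_le_sum fun ψ hψ => ?_
        linarith [hE ψ hψ]
    _ = Ψ.card * (E + t ^ 2) - t * ∑ ψ ∈ Ψ, μ.real (W ψ g) -
          t * ∑ ψ ∈ Ψ, μ.real (W ψ (g * h)) := by
        rw [Finset.sum_add_distrib, Finset.sum_sub_distrib, Finset.sum_sub_distrib,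
          Finset.mul_sum, Finset.mul_sum]
        simp
        ring
    _ ≤ M * (E + t ^ 2) - t * m - t * m := by
        have h1 : (Ψ.card : ℝ) * (E + t ^ 2) ≤ M * (E + t ^ 2) :=
          mul_le_mul_of_nonneg_right (by rw [hM]; linarith) (by positivity)
        have h2 := mul_le_mul_of_nonneg_left hg1 ht0.le
        have h3 := mul_le_mul_of_nonneg_left hg2 ht0.le
        linarith
    _ < M * (m ^ 2 / (2 * M ^ 2) + t ^ 2) - t * m - t * m := by gcongr
    _ = -(m ^ 2 / (2 * M)) := by
        rw [ht]
        field_simp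
        ring

end MPAction

end

/-! ### Moment bounds and recurrence of corners. -/

section

variable {G : Type*} [Group G] {p : Ultrafilter G} {X : Type*} [mX : MeasurableSpace X]
  {μ : Measure X} [IsProbabilityMeasure μ] {T S : MPAction G μ}

theorem abs_le_one_of_mem_Icc {a : ℝ} (h : a ∈ Set.Icc (0 : ℝ) 1) : |a| ≤ 1 :=
  abs_le.2 ⟨by linarith [h.1], h.2⟩

theorem mul_mem_Icc {a b : ℝ} (ha : a ∈ Set.Icc (0 : ℝ) 1) (hb : b ∈ Set.Icc (0 : ℝ) 1) :
    a * b ∈ Set.Icc (0 : ℝ) 1 :=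
  ⟨mul_nonneg ha.1 hb.1, mul_le_one₀ ha.2 hb.1 hb.2⟩

theorem pow_mem_Icc {a : ℝ} (ha : a ∈ Set.Icc (0 : ℝ) 1) (n : ℕ) : a ^ n ∈ Set.Icc (0 : ℝ) 1 :=
  ⟨pow_nonneg ha.1 n, pow_le_one₀ ha.1 ha.2⟩

namespace MPAction

/-- Lower bound for the weighted correlations of `f` with its translates along `p`. -/
theorem eventually_le_integral_mul_pow (hp : IsIdempotentFilter p) (hTS : T.Commute S)
    {f y d : X → ℝ} (hf : Measurable f) (hf1 : ∀ x, f x ∈ Set.Icc (0 : ℝ) 1)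
    (hy : Measurable[S.rigidSigma p] y) (hy1 : ∀ x, y x ∈ Set.Icc (0 : ℝ) 1)
    (hd : Measurable d) (hd1 : ∀ x, d x ∈ Set.Icc (0 : ℝ) 1) {c : ℝ} (hc : c ∈ Set.Icc (0 : ℝ) 1)
    (hcf : ∀ β : X → ℝ, Measurable[S.rigidSigma p] β → (∀ x, β x ∈ Set.Icc (0 : ℝ) 1) →
      c * ∫ x, y x * β x ∂μ ≤ ∫ x, f x * β x ∂μ)
    {q : G → X → ℝ} (hq : ∀ h, Measurable[S.rigidSigma p] (q h))
    (hq1 : ∀ h x, q h x ∈ Set.Icc (0 : ℝ) 1)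
    (hqe : ∀ h, q h =ᵐ[μ] μ[fun x => d x * d (T h x) | S.rigidSigma p]) (n : ℕ) {ε : ℝ}
    (hε : 0 < ε) :
    ∀ᶠ h in (p : Filter G), c ^ 2 / 4 * ∫ x, y x * y (T h x) * q h x ^ n ∂μ - ε ≤
      ∫ x, f x * f (S h (T h x)) * q h x ^ n ∂μ := by
  have hle := S.rigidSigma_le p
  by_contra H
  rw [← Ultrafilter.eventually_not] at H
  have hym : Measurable y := hy.mono hle le_rfl
  have hqm : ∀ h, Measurable (q h) := fun h => (hq h).mono hle le_rfl
  have hdd : ∀ g g', Measurable fun x => d (T g x) * d (T g' x) := fun g g' =>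
    (hd.comp (T.measurable g)).mul (hd.comp (T.measurable g'))
  have hdd1 : ∀ g g' x, d (T g x) * d (T g' x) ∈ Set.Icc (0 : ℝ) 1 := fun g g' x =>
    mul_mem_Icc (hd1 _) (hd1 _)
  choose E hEm hE0 hE1 hEe hElim using fun g g' => S.exists_rigid_condExp hp (hdd g g')
    (fun x => (hdd1 g g' x).1) (fun x => (hdd1 g g' x).2)
  have hE : ∀ g g' x, E g g' x ∈ Set.Icc (0 : ℝ) 1 := fun g g' x => ⟨hE0 g g' x, hE1 g g' x⟩
  have hEm' : ∀ g g', Measurable (E g g') := fun g g' => (hEm g g').mono hle le_rfl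
  -- Equivariance makes the weight in the kernel at `(g, g * h)` a translate of `q h`, so that `T g`
  -- can be removed by invariance.
  have hEq : ∀ g h, E g (g * h) =ᵐ[μ] fun x => q h (T g x) := by
    intro g h
    have e1 := hTS.condExp_comp p g (φ := fun x => d x * d (T h x))
      (hd.mul (hd.comp (T.measurable h)))
      (integrable_of_abs_le (C := 1) (hd.mul (hd.comp (T.measurable h))) fun x =>
        abs_le_one_of_mem_Icc (mul_mem_Icc (hd1 _) (hd1 _)))
    have e2 := (T.mp g).quasiMeasurePreserving.ae_eq_comp (hqe h)
    have e3 := hEe g (g * h)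
    simp only [T.act_mul] at e3
    filter_upwards [e1, e2, e3] with x e1 e2 e3
    rw [e3, e1]
    exact e2.symm
  have hEsymm : ∀ g g', E g g' =ᵐ[μ] E g' g := by
    intro g g'
    have e1 := hEe g g'
    simp_rw [mul_comm (d (T g _))] at e1
    exact e1.trans (hEe g' g).symm
  -- Subtracting `l * y` yields one usable cross term, at most `-l * c` times the moment, and the
  -- square `l ^ 2`. The choice `l = c / 2` minimises `l ^ 2 - l * c`, with value `-c ^ 2 / 4`; the
  -- other cross term is nonpositive and is dropped.
  obtain ⟨ξ, hξ⟩ : ∃ ξ : G → X → ℝ, ∀ g x, ξ g x = f (S g (T g x)) - c / 2 * y (T g x) :=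
    ⟨_, fun _ _ => rfl⟩
  have hξm : ∀ g, Measurable (ξ g) := fun g => by
    have : ξ g = fun x => f (S g (T g x)) - c / 2 * y (T g x) := funext (hξ g)
    rw [this]
    exact (hf.comp ((S.measurable g).comp (T.measurable g))).sub
      ((hym.comp (T.measurable g)).const_mul _)
  have hξ1 : ∀ g x, |ξ g x| ≤ 1 := fun g x => by
    rw [hξ]
    have h1 := hf1 (S g (T g x))
    have h2 := hy1 (T g x)
    have h3 := hc.1
    have h4 := hc.2
    rw [abs_le]
    constructor <;> nlinarith [h1.1, h1.2, h2.1, h2.2]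
  refine hp.kernel_nonneg (k := fun g g' => ∫ x, ξ g x * ξ g' x * E g g' x ^ n ∂μ) ?_ ?_ (C := 1)
    ?_ (ε := ε / 2) (by positivity) ?_
  · intro g g'
    refine integral_congr_ae ?_
    filter_upwards [hEsymm g g'] with x hx
    rw [hx, mul_comm (ξ g x)]
  · intro N v
    exact S.sum_integral_mul_pow_nonneg (p := p) (d := fun i x => d (T (v i) x))
      (fun i => hd.comp (T.measurable _)) (D := 1) (fun i x => abs_le_one_of_mem_Icc (hd1 _))
      (e := fun i j => E (v i) (v j)) (fun i j => hEm' _ _) (E := 1)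
      (fun i j x => abs_le_one_of_mem_Icc (hE _ _ x)) (fun i j => hElim (v i) (v j)) n
      (fun i => ξ (v i)) (fun i => hξm _) 1 (fun i x => hξ1 _ x)
  · intro g
    have hb : ∀ x, |ξ g x * ξ g x * E g g x ^ n| ≤ 1 := fun x =>
      abs_mul_le_one (abs_mul_le_one (hξ1 g x) (hξ1 g x))
        (abs_le_one_of_mem_Icc (pow_mem_Icc (hE g g x) n))
    have : ∫ x, ξ g x * ξ g x * E g g x ^ n ∂μ ≤ ∫ x, (1 : ℝ) ∂μ :=
      integral_mono (integrable_of_abs_le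
        (((hξm g).mul (hξm g)).mul ((hEm' g g).pow_const n)) hb) (integrable_const _)
        fun x => (le_abs_self _).trans (hb x)
    simpa using this
  filter_upwards [H] with h hh
  rw [not_le] at hh
  have hyT : Measurable[S.rigidSigma p] fun x => y (T h x) :=
    hy.comp (hTS.measurable_rigidSigma p h)
  have hyTm : Measurable fun x => y (T h x) := hyT.mono hle le_rfl
  have hqn : Measurable[S.rigidSigma p] fun x => q h x ^ n := (hq h).pow_const n
  have hqnm : Measurable fun x => q h x ^ n := hqn.mono hle le_rfl
  have hqn1 : ∀ x, q h x ^ n ∈ Set.Icc (0 : ℝ) 1 := fun x => pow_mem_Icc (hq1 h x) n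
  have hβm : Measurable[S.rigidSigma p] fun x => y (T h x) * q h x ^ n := hyT.mul hqn
  have hβ1 : ∀ x, y (T h x) * q h x ^ n ∈ Set.Icc (0 : ℝ) 1 := fun x =>
    mul_mem_Icc (hy1 _) (hqn1 x)
  have hFm : Measurable fun x => f x * f (S h (T h x)) :=
    hf.mul (hf.comp ((S.measurable h).comp (T.measurable h)))
  have hF1 : ∀ x, f x * f (S h (T h x)) ∈ Set.Icc (0 : ℝ) 1 := fun x => mul_mem_Icc (hf1 _) (hf1 _)
  obtain ⟨e, hem, -, -, hee, helim⟩ := S.exists_rigid_condExp hp hf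
    (fun x => (hf1 x).1) (fun x => (hf1 x).2)
  obtain ⟨b, hbm, -, -, hbe, hblim⟩ := S.exists_rigid_condExp hp hFm
    (fun x => (hF1 x).1) (fun x => (hF1 x).2)
  have l1 := hblim (fun x => q h x ^ n)
    (memLp_of_abs_le hqnm fun x => abs_le_one_of_mem_Icc (hqn1 x))
  have l2 := (helim (fun x => y (T h x) * q h x ^ n)
    (memLp_of_abs_le (hβm.mono hle le_rfl) fun x => abs_le_one_of_mem_Icc (hβ1 x))).const_mul (c / 2)
  have hfi : Integrable f μ := integrable_of_abs_le hf fun x => abs_le_one_of_mem_Icc (hf1 x)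
  have hFi : Integrable (fun x => f x * f (S h (T h x))) μ :=
    integrable_of_abs_le hFm fun x => abs_le_one_of_mem_Icc (hF1 x)
  rw [← integral_mul_eq_of_ae_eq_condExp hle hFi hbe hqn fun x =>
    abs_le_one_of_mem_Icc (hqn1 x)] at l1
  rw [← integral_mul_eq_of_ae_eq_condExp hle hfi hee hβm fun x =>
    abs_le_one_of_mem_Icc (hβ1 x)] at l2
  have hM := hcf _ hβm hβ1
  have l3 := (l1.sub l2).add_const (c ^ 2 / 4 * ∫ x, y x * y (T h x) * q h x ^ n ∂μ)
  have hlt : ∫ x, f x * f (S h (T h x)) * q h x ^ n ∂μ -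
      c / 2 * ∫ x, f x * (y (T h x) * q h x ^ n) ∂μ +
      c ^ 2 / 4 * ∫ x, y x * y (T h x) * q h x ^ n ∂μ < -(ε / 2) := by
    have h1 := mul_le_mul_of_nonneg_left hM (show 0 ≤ c / 2 by linarith [hc.1])
    simp_rw [← mul_assoc] at h1 ⊢
    nlinarith
  filter_upwards [l3.eventually (gt_mem_nhds hlt)] with g hg
  refine lt_of_le_of_lt ?_ hg
  have i1 : Integrable (fun x => f (S g x) * f (S h (T h (S g x))) * q h x ^ n) μ :=
    integrable_of_abs_le (C := 1) ((hFm.comp (S.measurable g)).mul hqnm) fun x =>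
      abs_le_one_of_mem_Icc (mul_mem_Icc (hF1 _) (hqn1 x))
  have i2 : Integrable (fun x => c / 2 * (f (S g x) * (y (T h x) * q h x ^ n))) μ :=
    (integrable_of_abs_le (C := 1) ((hf.comp (S.measurable g)).mul (hβm.mono hle le_rfl)) fun x =>
      abs_le_one_of_mem_Icc (mul_mem_Icc (hf1 _) (hβ1 x))).const_mul _
  have i3 : Integrable (fun x => c ^ 2 / 4 * (y x * y (T h x) * q h x ^ n)) μ :=
    (integrable_of_abs_le (C := 1) ((hym.mul hyTm).mul hqnm) fun x =>
      abs_le_one_of_mem_Icc (mul_mem_Icc (mul_mem_Icc (hy1 _) (hy1 _)) (hqn1 x))).const_mul _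
  rw [← integral_const_mul, ← integral_const_mul, ← integral_sub i1 i2,
    ← integral_add (f := fun x => _ - _) (i1.sub i2) i3]
  have e1 : ∫ x, ξ g x * ξ (g * h) x * E g (g * h) x ^ n ∂μ =
      ∫ x, (f (S g x) - c / 2 * y x) * (f (S h (T h (S g x))) - c / 2 * y (T h x)) *
        q h x ^ n ∂μ := by
    rw [← T.integral_comp g (f := fun x => (f (S g x) - c / 2 * y x) *
      (f (S h (T h (S g x))) - c / 2 * y (T h x)) * q h x ^ n)
      ((((hf.comp (S.measurable g)).sub (hym.const_mul _)).mul
        ((hf.comp ((S.measurable h).comp ((T.measurable h).comp (S.measurable g)))).sub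
          (hyTm.const_mul _))).mul hqnm)]
    refine integral_congr_ae ?_
    filter_upwards [hEq g h] with x hx
    rw [hx, hξ, hξ, T.act_mul, S.act_mul, hTS h g]
  rw [e1]
  have hbd : ∀ x, |(f (S g x) - c / 2 * y x) * (f (S h (T h (S g x))) - c / 2 * y (T h x)) *
      q h x ^ n| ≤ 1 := by
    have : ∀ a b : ℝ, a ∈ Set.Icc (0 : ℝ) 1 → b ∈ Set.Icc (0 : ℝ) 1 → |a - c / 2 * b| ≤ 1 := by
      intro a b ha hb
      have h3 := hc.1
      have h4 := hc.2
      rw [abs_le]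
      constructor <;> nlinarith [ha.1, ha.2, hb.1, hb.2]
    exact fun x => abs_mul_le_one (abs_mul_le_one (this _ _ (hf1 _) (hy1 _))
      (this _ _ (hf1 _) (hy1 _))) (abs_le_one_of_mem_Icc (hqn1 x))
  refine integral_mono (integrable_of_abs_le ((((hf.comp (S.measurable g)).sub
    (hym.const_mul _)).mul ((hf.comp ((S.measurable h).comp ((T.measurable h).comp
      (S.measurable g)))).sub (hyTm.const_mul _))).mul hqnm) hbd) ((i1.sub i2).add i3) fun x => ?_
  have hpos : 0 ≤ c / 2 * (y x * f (S h (T h (S g x))) * q h x ^ n) :=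
    mul_nonneg (by linarith [hc.1])
      (mul_mem_Icc (mul_mem_Icc (hy1 _) (hf1 _)) (hqn1 x)).1
  dsimp only
  nlinarith

end MPAction

end

section

variable {G : Type*} [Group G] {p : Ultrafilter G} {X : Type*} [mX : MeasurableSpace X]
  {μ : Measure X} [IsProbabilityMeasure μ] {T S : MPAction G μ}

theorem indicator_one_mem_Icc (A : Set X) (x : X) :
    A.indicator (fun _ => (1 : ℝ)) x ∈ Set.Icc (0 : ℝ) 1 := by
  by_cases h : x ∈ A <;> simp [h]

theorem integral_indicator_one_eq_measureReal {A : Set X} (hA : MeasurableSet A) :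
    ∫ x, A.indicator (fun _ => (1 : ℝ)) x ∂μ = μ.real A := by
  rw [integral_indicator hA]
  simp

theorem integrable_of_mem_Icc {f : X → ℝ} (hf : Measurable f)
    (h : ∀ x, f x ∈ Set.Icc (0 : ℝ) 1) : Integrable f μ :=
  integrable_of_abs_le hf fun x => abs_le_one_of_mem_Icc (h x)

namespace MPAction

/-- Upper bound for the weighted correlations of `f` with its translates along `p`. -/
theorem eventually_integral_mul_pow_le (hTS : T.Commute S)
    {a f y d : X → ℝ} (ha : Measurable a) (ha1 : ∀ x, a x ∈ Set.Icc (0 : ℝ) 1)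
    (hf : Measurable f) (hf1 : ∀ x, f x ∈ Set.Icc (0 : ℝ) 1)
    (hy : Measurable[S.rigidSigma p] y) (hy1 : ∀ x, y x ∈ Set.Icc (0 : ℝ) 1)
    (hd : Measurable d) (hd1 : ∀ x, d x ∈ Set.Icc (0 : ℝ) 1)
    (hfa : ∀ x, f x ≤ a x) (hfd : ∀ x, f x ≤ d x * y x) (hfy : ∀ x, f x ≤ y x) {s : ℝ}
    (hds : ∀ β : X → ℝ, Measurable[S.rigidSigma p] β → (∀ x, β x ∈ Set.Icc (0 : ℝ) 1) →
      ∫ x, d x * (y x * β x) ∂μ ≤ s * ∫ x, y x * β x ∂μ)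
    (hL : Tendsto (fun h => ∫ x, a x * (d (T h x) * a (S h (T h x))) ∂μ) p (𝓝 0))
    {q : G → X → ℝ} (hq : ∀ h, Measurable[S.rigidSigma p] (q h))
    (hq1 : ∀ h x, q h x ∈ Set.Icc (0 : ℝ) 1)
    (hqe : ∀ h, q h =ᵐ[μ] μ[fun x => d x * d (T h x) | S.rigidSigma p]) (n : ℕ) {ε : ℝ}
    (hε : 0 < ε) :
    ∀ᶠ h in (p : Filter G), ∫ x, f x * f (S h (T h x)) * q h x ^ n ∂μ ≤
      s * ∫ x, y x * y (T h x) * q h x ^ n ∂μ - ∫ x, y x * y (T h x) * q h x ^ (n + 1) ∂μ + ε := by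
  have hle := S.rigidSigma_le p
  have hym : Measurable y := hy.mono hle le_rfl
  have hr := S.isRigid_of_measurable hy fun x => abs_le_one_of_mem_Icc (hy1 x)
  filter_upwards [hL.eventually (gt_mem_nhds (half_pos hε)),
    hr.eventually (gt_mem_nhds (half_pos hε))] with h h1 h2
  have hyT : Measurable[S.rigidSigma p] fun x => y (T h x) :=
    hy.comp (hTS.measurable_rigidSigma p h)
  have hqn : Measurable[S.rigidSigma p] fun x => q h x ^ n := (hq h).pow_const n
  have hqn1 : ∀ x, q h x ^ n ∈ Set.Icc (0 : ℝ) 1 := fun x => pow_mem_Icc (hq1 h x) n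
  have hβm : Measurable[S.rigidSigma p] fun x => y (T h x) * q h x ^ n := hyT.mul hqn
  have hβ1 : ∀ x, y (T h x) * q h x ^ n ∈ Set.Icc (0 : ℝ) 1 := fun x =>
    mul_mem_Icc (hy1 _) (hqn1 x)
  have hγm : Measurable[S.rigidSigma p] fun x => y x * (y (T h x) * q h x ^ n) := hy.mul hβm
  have hγ1 : ∀ x, y x * (y (T h x) * q h x ^ n) ∈ Set.Icc (0 : ℝ) 1 := fun x =>
    mul_mem_Icc (hy1 _) (hβ1 x)
  have hγm' := hγm.mono hle le_rfl
  have hdT : Measurable fun x => d (T h x) := hd.comp (T.measurable h)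
  have hddm : Measurable fun x => d x * d (T h x) := hd.mul hdT
  have hdd1 : ∀ x, d x * d (T h x) ∈ Set.Icc (0 : ℝ) 1 := fun x => mul_mem_Icc (hd1 _) (hd1 _)
  have hST : Measurable fun x => S h (T h x) := (S.measurable h).comp (T.measurable h)
  have i0 : Integrable (fun x => f x * f (S h (T h x)) * q h x ^ n) μ :=
    integrable_of_mem_Icc ((hf.mul (hf.comp hST)).mul (hqn.mono hle le_rfl)) fun x =>
      mul_mem_Icc (mul_mem_Icc (hf1 _) (hf1 _)) (hqn1 x)
  have i1 : Integrable (fun x => a x * (d (T h x) * a (S h (T h x)))) μ :=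
    integrable_of_mem_Icc (ha.mul (hdT.mul (ha.comp hST))) fun x =>
      mul_mem_Icc (ha1 _) (mul_mem_Icc (hd1 _) (ha1 _))
  have i2 : Integrable (fun x => d x * (y x * (y (T h x) * q h x ^ n))) μ :=
    integrable_of_mem_Icc (hd.mul hγm') fun x => mul_mem_Icc (hd1 _) (hγ1 x)
  have i3 : Integrable (fun x => d x * d (T h x) * (y x * (y (T h x) * q h x ^ n))) μ :=
    integrable_of_mem_Icc (hddm.mul hγm') fun x => mul_mem_Icc (hdd1 _) (hγ1 x)
  have i4 : Integrable (fun x => |y (S h (T h x)) - y (T h x)|) μ :=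
    ((integrable_of_mem_Icc (hym.comp hST) fun x => hy1 _).sub
      (integrable_of_mem_Icc (hym.comp (T.measurable h)) fun x => hy1 _)).abs
  have e4 : ∫ x, |y (S h (T h x)) - y (T h x)| ∂μ = ∫ x, |y (S h x) - y x| ∂μ :=
    T.integral_comp h (f := fun x => |y (S h x) - y x|)
      (((hym.comp (S.measurable h)).sub hym).abs)
  have e3 : ∫ x, d x * d (T h x) * (y x * (y (T h x) * q h x ^ n)) ∂μ =
      ∫ x, y x * y (T h x) * q h x ^ (n + 1) ∂μ := by
    rw [integral_mul_eq_of_ae_eq_condExp hle (integrable_of_mem_Icc hddm hdd1) (hqe h) hγm fun x =>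
      abs_le_one_of_mem_Icc (hγ1 x)]
    refine integral_congr_ae (Eventually.of_forall fun x => ?_)
    dsimp only
    ring
  have e2 := hds _ hβm hβ1
  -- The integrand is split by `d (T h x)` and `1 - d (T h x)`. The first part is bounded by the
  -- corner integrand, whose integral is small. In the second, `f ≤ d * y` at the first vertex and
  -- `f ≤ y` at the last, and rigidity of `y` replaces `y (S h (T h x))` by `y (T h x)`.
  have hle' : ∫ x, f x * f (S h (T h x)) * q h x ^ n ∂μ ≤
      ∫ x, (a x * (d (T h x) * a (S h (T h x))) + d x * (y x * (y (T h x) * q h x ^ n)) -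
        d x * d (T h x) * (y x * (y (T h x) * q h x ^ n)) +
          |y (S h (T h x)) - y (T h x)|) ∂μ := by
    refine integral_mono i0 (((i1.add i2).sub i3).add i4) fun x => ?_
    dsimp only
    have k1 : f x * f (S h (T h x)) * d (T h x) ≤ a x * (d (T h x) * a (S h (T h x))) := by
      have := mul_le_mul (hfa x) (hfa (S h (T h x))) (hf1 _).1 (ha1 x).1
      have := mul_le_mul_of_nonneg_right this (hd1 (T h x)).1
      linarith
    have k2 : f x * f (S h (T h x)) ≤ d x * y x * (y (T h x) + |y (S h (T h x)) - y (T h x)|) := by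
      refine mul_le_mul (hfd x) ?_ (hf1 _).1 (mul_mem_Icc (hd1 x) (hy1 x)).1
      linarith [hfy (S h (T h x)), le_abs_self (y (S h (T h x)) - y (T h x))]
    have k3 : f x * f (S h (T h x)) * d (T h x) * q h x ^ n ≤
        a x * (d (T h x) * a (S h (T h x))) :=
      (mul_le_of_le_one_right (mul_mem_Icc (mul_mem_Icc (hf1 _) (hf1 _)) (hd1 _)).1
        (hqn1 x).2).trans k1
    have hw : (1 - d (T h x)) * q h x ^ n ∈ Set.Icc (0 : ℝ) 1 :=
      mul_mem_Icc ⟨by linarith [(hd1 (T h x)).2], by linarith [(hd1 (T h x)).1]⟩ (hqn1 x)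
    have k4 := mul_le_mul_of_nonneg_right k2 hw.1
    have k5 : d x * y x * ((1 - d (T h x)) * q h x ^ n) * |y (S h (T h x)) - y (T h x)| ≤
        |y (S h (T h x)) - y (T h x)| :=
      mul_le_of_le_one_left (abs_nonneg _) (mul_mem_Icc (mul_mem_Icc (hd1 x) (hy1 x)) hw).2
    linarith
  rw [integral_add (f := fun x => _ + _ - _) ((i1.add i2).sub i3) i4,
    integral_sub (f := fun x => _ + _) (i1.add i2) i3, integral_add i1 i2, e3, e4] at hle'
  simp_rw [← mul_assoc (y _)] at hle' e2
  linarith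

/-- Vanishing corners would make the moments of `q h` on `Y ∩ (T h)⁻¹ Y` decay like `(t - η) ^ n`,
whereas almost periodicity of `D` bounds them below by a fixed multiple of `(t - η / 2) ^ n`. -/
theorem not_tendsto_integral_corner_zero (hp : IsIdempotentFilter p) (hTS : T.Commute S)
    {A D : Set X} (hA : MeasurableSet A) (hD : MeasurableSet D) (hAD : A ⊆ D) (hA0 : 0 < μ.real A)
    (hAP : T.IsAlmostPeriodic S p (D.indicator fun _ => 1)) :
    ¬ Tendsto (fun h => ∫ x, A.indicator (fun _ => (1 : ℝ)) x *
      (D.indicator (fun _ => (1 : ℝ)) (T h x) *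
        A.indicator (fun _ => (1 : ℝ)) (S h (T h x))) ∂μ) p (𝓝 0) := by
  intro hL
  have hle := S.rigidSigma_le p
  obtain ⟨a, hadef⟩ : ∃ a : X → ℝ, a = A.indicator fun _ => 1 := ⟨_, rfl⟩
  obtain ⟨d, hddef⟩ : ∃ d : X → ℝ, d = D.indicator fun _ => 1 := ⟨_, rfl⟩
  rw [← hadef, ← hddef] at hL
  rw [← hddef] at hAP
  have ham : Measurable a := hadef ▸ measurable_const.indicator hA
  have hdm : Measurable d := hddef ▸ measurable_const.indicator hD
  have ha1 : ∀ x, a x ∈ Set.Icc (0 : ℝ) 1 := fun x => hadef ▸ indicator_one_mem_Icc A x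
  have hd1 : ∀ x, d x ∈ Set.Icc (0 : ℝ) 1 := fun x => hddef ▸ indicator_one_mem_Icc D x
  have had : ∀ x, a x ≤ d x := fun x => by
    rw [hadef, hddef]
    exact Set.indicator_le_indicator_of_subset hAD (fun _ => zero_le_one) x
  have hd01 : ∀ x, d x = 0 ∨ d x = 1 := fun x => by
    rw [hddef]
    by_cases h : x ∈ D <;> simp [h]
  have hai := integrable_of_mem_Icc (μ := μ) ham ha1
  have hdi := integrable_of_mem_Icc (μ := μ) hdm hd1
  obtain ⟨e, hem, he0, he1, hee, -⟩ := S.exists_rigid_condExp hp ham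
    (fun x => (ha1 x).1) (fun x => (ha1 x).2)
  obtain ⟨b, hbm, hb0, hb1, hbe, -⟩ := S.exists_rigid_condExp hp hdm
    (fun x => (hd1 x).1) (fun x => (hd1 x).2)
  have hddm : ∀ h, Measurable fun x => d x * d (T h x) := fun h =>
    hdm.mul (hdm.comp (T.measurable h))
  have hdd1 : ∀ h x, d x * d (T h x) ∈ Set.Icc (0 : ℝ) 1 := fun h x => mul_mem_Icc (hd1 _) (hd1 _)
  choose q hqm hq0 hq1' hqe _ using fun h => S.exists_rigid_condExp hp (hddm h)
    (fun x => (hdd1 h x).1) (fun x => (hdd1 h x).2)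
  have hq1 : ∀ h x, q h x ∈ Set.Icc (0 : ℝ) 1 := fun h x => ⟨hq0 h x, hq1' h x⟩
  have heb : ∀ᵐ x ∂μ, e x ≤ b x := by
    filter_upwards [hee, hbe, condExp_mono (m := S.rigidSigma p) hai hdi (Eventually.of_forall had)]
      with x h1 h2 h3
    rw [h1, h2]
    exact h3
  set c := μ.real A / 2 with hc
  have hc0 : 0 < c := by positivity
  have hc1 : c ≤ 1 := by
    have := measureReal_le_one (μ := μ) (s := A)
    linarith
  -- Chosen so that the gain `c ^ 2 / 4` is `2 * η`: it absorbs the width `η` of the range of `b` on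
  -- `Y` and leaves a loss of `η`.
  set η := c ^ 2 / 8 with hη
  have hη0 : 0 < η := by positivity
  have hY0 : μ {x | c ≤ e x} ≠ 0 := by
    intro h0
    have h1 : ∫ x, e x ∂μ = μ.real A := by
      rw [integral_congr_ae hee, integral_condExp hle, hadef, integral_indicator_one_eq_measureReal hA]
    have h2 : ∫ x, e x ∂μ ≤ ∫ x, c ∂μ := by
      refine integral_mono_ae (integrable_of_mem_Icc (hem.mono hle le_rfl)
        fun x => ⟨he0 x, he1 x⟩) (integrable_const _) ?_
      have : ∀ᵐ x ∂μ, ¬ c ≤ e x := by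
        rw [ae_iff]
        simpa using h0
      filter_upwards [this] with x hx
      exact (not_le.1 hx).le
    simp only [integral_const, probReal_univ, smul_eq_mul, one_mul] at h2
    linarith
  obtain ⟨k, hk⟩ : ∃ k : ℕ, μ {x | c ≤ e x ∧ k * η ≤ b x ∧ b x < k * η + η} ≠ 0 := by
    by_contra! H
    refine hY0 (measure_mono_null ?_ (measure_iUnion_null H))
    intro x hx
    refine Set.mem_iUnion.2 ⟨⌊b x / η⌋₊, hx, ?_, ?_⟩
    · rw [← le_div_iff₀ hη0]
      exact Nat.floor_le (div_nonneg (hb0 x) hη0.le)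
    · have := Nat.lt_floor_add_one (b x / η)
      rw [div_lt_iff₀ hη0] at this
      linarith
  set Y : Set X := {x | c ≤ e x ∧ k * η ≤ b x ∧ b x < k * η + η} with hYdef
  set t : ℝ := k * η with ht
  have hYr : MeasurableSet[S.rigidSigma p] Y :=
    MeasurableSet.inter (measurableSet_le measurable_const hem)
      (MeasurableSet.inter (measurableSet_le measurable_const hbm)
        (measurableSet_lt hbm measurable_const))
  have hYm : MeasurableSet Y := hle _ hYr
  have hYpos : 0 < μ.real Y := ENNReal.toReal_pos hk (measure_ne_top _ _)
  obtain ⟨y, hydef⟩ : ∃ y : X → ℝ, y = Y.indicator fun _ => 1 := ⟨_, rfl⟩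
  have hyr : Measurable[S.rigidSigma p] y := hydef ▸ measurable_const.indicator hYr
  have hym : Measurable y := hyr.mono hle le_rfl
  have hy1 : ∀ x, y x ∈ Set.Icc (0 : ℝ) 1 := fun x => hydef ▸ indicator_one_mem_Icc Y x
  have hyY : ∀ x, x ∈ Y → y x = 1 := fun x hx => by simp [hydef, hx]
  have hyYc : ∀ x, x ∉ Y → y x = 0 := fun x hx => by simp [hydef, hx]
  -- On `Y` one has `c ≤ e ≤ b < t + η` almost everywhere; together with `8 * η ≤ c` this keeps `t -
  -- η` positive.
  have htc : c < t + η := by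
    by_contra! H
    refine hk (measure_mono_null (t := {x | ¬ e x ≤ b x}) (fun x hx hx' => ?_) (ae_iff.1 heb))
    linarith [hx.1, hx.2.2]
  have hcη : 8 * η ≤ c := by
    rw [hη]
    nlinarith
  have hyβ : ∀ β : X → ℝ, Measurable[S.rigidSigma p] β → (∀ x, β x ∈ Set.Icc (0 : ℝ) 1) →
      Measurable[S.rigidSigma p] (fun x => y x * β x) ∧ (∀ x, y x * β x ∈ Set.Icc (0 : ℝ) 1) ∧
        Integrable (fun x => y x * β x) μ := fun β hβ hβ1 =>
    have h1 : Measurable[S.rigidSigma p] (fun x => y x * β x) := hyr.mul hβ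
    have h2 : ∀ x, y x * β x ∈ Set.Icc (0 : ℝ) 1 := fun x => mul_mem_Icc (hy1 x) (hβ1 x)
    ⟨h1, h2, integrable_of_mem_Icc (h1.mono hle le_rfl) h2⟩
  have hcf : ∀ β : X → ℝ, Measurable[S.rigidSigma p] β → (∀ x, β x ∈ Set.Icc (0 : ℝ) 1) →
      c * ∫ x, y x * β x ∂μ ≤ ∫ x, (a x * y x) * β x ∂μ := by
    intro β hβ hβ1
    obtain ⟨h1, h2, h3⟩ := hyβ β hβ hβ1
    simp_rw [mul_assoc]
    rw [integral_mul_eq_of_ae_eq_condExp hle hai hee h1 fun x => abs_le_one_of_mem_Icc (h2 x),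
      ← integral_const_mul]
    refine integral_mono (h3.const_mul c) (integrable_of_mem_Icc ((hem.mono hle le_rfl).mul
      (h1.mono hle le_rfl)) fun x => mul_mem_Icc ⟨he0 x, he1 x⟩ (h2 x)) fun x => ?_
    dsimp only
    by_cases hx : x ∈ Y
    · exact mul_le_mul_of_nonneg_right hx.1 (h2 x).1
    · simp [hyYc x hx]
  have hds : ∀ β : X → ℝ, Measurable[S.rigidSigma p] β → (∀ x, β x ∈ Set.Icc (0 : ℝ) 1) →
      ∫ x, d x * (y x * β x) ∂μ ≤ (t + η) * ∫ x, y x * β x ∂μ := by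
    intro β hβ hβ1
    obtain ⟨h1, h2, h3⟩ := hyβ β hβ hβ1
    rw [integral_mul_eq_of_ae_eq_condExp hle hdi hbe h1 fun x => abs_le_one_of_mem_Icc (h2 x),
      ← integral_const_mul]
    refine integral_mono (integrable_of_mem_Icc ((hbm.mono hle le_rfl).mul
      (h1.mono hle le_rfl)) fun x => mul_mem_Icc ⟨hb0 x, hb1 x⟩ (h2 x)) (h3.const_mul _) fun x => ?_
    dsimp only
    by_cases hx : x ∈ Y
    · exact mul_le_mul_of_nonneg_right hx.2.2.le (h2 x).1
    · simp [hyYc x hx]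
  have hMi : ∀ h n, Integrable (fun x => y x * y (T h x) * q h x ^ n) μ := fun h n =>
    integrable_of_mem_Icc ((hym.mul (hym.comp (T.measurable h))).mul
      (((hqm h).mono hle le_rfl).pow_const n)) fun x =>
        mul_mem_Icc (mul_mem_Icc (hy1 _) (hy1 _)) (pow_mem_Icc (hq1 h x) n)
  have hρ0 : 0 < t - η := by linarith
  have hstep : ∀ n, ∀ ε > 0, ∀ᶠ h in (p : Filter G),
      ∫ x, y x * y (T h x) * q h x ^ (n + 1) ∂μ ≤
        (t - η) * ∫ x, y x * y (T h x) * q h x ^ n ∂μ + ε := by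
    intro n ε hε
    filter_upwards [eventually_le_integral_mul_pow hp hTS (f := fun x => a x * y x)
        (ham.mul hym) (fun x => mul_mem_Icc (ha1 x) (hy1 x)) hyr hy1 hdm hd1 ⟨hc0.le, hc1⟩ hcf
        hqm hq1 hqe n (half_pos hε),
      eventually_integral_mul_pow_le hTS ham ha1 (f := fun x => a x * y x)
        (ham.mul hym) (fun x => mul_mem_Icc (ha1 x) (hy1 x)) hyr hy1 hdm hd1
        (fun x => mul_le_of_le_one_right (ha1 x).1 (hy1 x).2)
        (fun x => mul_le_mul_of_nonneg_right (had x) (hy1 x).1)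
        (fun x => mul_le_of_le_one_left (hy1 x).1 (ha1 x).2) hds hL hqm hq1 hqe n (half_pos hε)]
      with h h1 h2
    have h3 : c ^ 2 / 4 = 2 * η := by rw [hη]; ring
    rw [h3] at h1
    linarith
  have hmom : ∀ n, ∀ ε > 0, ∀ᶠ h in (p : Filter G),
      ∫ x, y x * y (T h x) * q h x ^ n ∂μ ≤ (t - η) ^ n + ε := by
    intro n
    induction n with
    | zero =>
      intro ε hε
      refine Eventually.of_forall fun h => ?_
      have : ∫ x, y x * y (T h x) * q h x ^ 0 ∂μ ≤ ∫ x, (1 : ℝ) ∂μ :=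
        integral_mono (hMi h 0) (integrable_const _) fun x =>
          (mul_mem_Icc (mul_mem_Icc (hy1 _) (hy1 _)) (pow_mem_Icc (hq1 h x) 0)).2
      simp only [integral_const, probReal_univ, smul_eq_mul, one_mul] at this
      linarith [pow_zero (t - η)]
    | succ n ih =>
      intro ε hε
      filter_upwards [hstep n (ε / 2) (half_pos hε), ih (ε / 2 / (t - η)) (by positivity)]
        with h h1 h2
      have h3 := mul_le_mul_of_nonneg_left h2 hρ0.le
      rw [mul_add, mul_div_cancel₀ _ hρ0.ne', ← pow_succ'] at h3
      linarith
  obtain ⟨κ, hκ0, hκ⟩ := hAP.exists_le_measureReal hp hTS hdm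
    (fun x => abs_le_one_of_mem_Icc (hd1 x)) hYm hYpos (half_pos hη0)
  have hlow : ∀ n, ∀ᶠ h in (p : Filter G),
      κ * (t - η / 2) ^ n ≤ ∫ x, y x * y (T h x) * q h x ^ n ∂μ := by
    intro n
    filter_upwards [hκ] with h hh
    set F : Set X := {x | x ∈ Y ∧ T h x ∈ Y ∧
      (μ[fun z => |d (T h z) - d z| | S.rigidSigma p]) x ≤ η / 2} with hF
    have hce : Measurable (μ[fun z => |d (T h z) - d z| | S.rigidSigma p]) :=
      stronglyMeasurable_condExp.measurable.mono hle le_rfl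
    have hFm : MeasurableSet F := hYm.inter ((T.measurable h hYm).inter
      (measurableSet_le hce measurable_const))
    have hdTi : Integrable (fun x => |d (T h x) - d x|) μ :=
      ((T.integrable_comp h hdi).sub hdi).abs
    -- Since `d` takes only the values 0 and 1, `d - |d ∘ T h - d| ≤ d * d ∘ T h`. Conditioning
    -- gives `q h ≥ b - η / 2 ≥ t - η / 2` on `F`.
    have e1 := condExp_mono (m := S.rigidSigma p) (hdi.sub hdTi)
      (integrable_of_mem_Icc (hddm h) (hdd1 h)) (Eventually.of_forall fun x => by
        simp only [Pi.sub_apply]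
        rcases hd01 x with h1 | h1
        · rw [h1]
          simp
        · rw [h1]
          have := neg_abs_le (d (T h x) - 1)
          linarith)
    have e2 := condExp_sub hdi hdTi (S.rigidSigma p)
    calc κ * (t - η / 2) ^ n ≤ μ.real F * (t - η / 2) ^ n :=
          mul_le_mul_of_nonneg_right hh (pow_nonneg (by linarith) n)
      _ = ∫ x, F.indicator (fun _ => (1 : ℝ)) x * (t - η / 2) ^ n ∂μ := by
          rw [integral_mul_const, integral_indicator_one_eq_measureReal hFm]
      _ ≤ _ := by
          refine integral_mono_ae ((integrable_indicator_one hFm).mul_const _) (hMi h n) ?_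
          filter_upwards [e1, e2, hqe h, hbe] with x e1 e2 e3 e4
          by_cases hx : x ∈ F
          · rw [Set.indicator_of_mem hx]
            obtain ⟨h1, h2, h3⟩ := hx
            rw [hyY x h1, hyY _ h2]
            rw [one_mul, one_mul, one_mul]
            refine pow_le_pow_left₀ (by linarith) ?_ n
            rw [e2, Pi.sub_apply, ← e4, ← e3] at e1
            linarith [h1.2.1]
          · rw [Set.indicator_of_notMem hx, zero_mul]
            exact (mul_mem_Icc (mul_mem_Icc (hy1 _) (hy1 _)) (pow_mem_Icc (hq1 h x) n)).1
  have hfin : ∀ n, κ * (t - η / 2) ^ n ≤ (t - η) ^ n := fun n => by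
    refine le_of_forall_pos_le_add fun ε hε => ?_
    obtain ⟨h, h1, h2⟩ := ((hlow n).and (hmom n ε hε)).exists
    exact h1.trans h2
  have hr1 : (t - η) / (t - η / 2) < 1 := by
    rw [div_lt_one (by linarith)]
    linarith
  obtain ⟨n, hn⟩ := exists_pow_lt_of_lt_one hκ0 hr1
  rw [div_pow, div_lt_iff₀ (pow_pos (by linarith) n)] at hn
  exact absurd (hfin n) (not_le.2 hn)

/-- Recurrence for corners along an idempotent ultrafilter. -/
theorem frequently_measureReal_corner_ne_zero [StandardBorelSpace X] (hp : IsIdempotentFilter p)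
    (hTS : T.Commute S) {A : Set X} (hA : MeasurableSet A) (hA0 : 0 < μ.real A) :
    ¬ ∀ᶠ h in (p : Filter G), μ.real {x | x ∈ A ∧ T h x ∈ A ∧ S h (T h x) ∈ A} = 0 := by
  intro H
  have hle := T.apSigma_le S p
  obtain ⟨f, hfdef⟩ : ∃ f : X → ℝ, f = A.indicator fun _ => 1 := ⟨_, rfl⟩
  have hf : Measurable f := hfdef ▸ measurable_const.indicator hA
  have hf1 : ∀ x, f x ∈ Set.Icc (0 : ℝ) 1 := fun x => hfdef ▸ indicator_one_mem_Icc A x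
  have hfi := integrable_of_mem_Icc (μ := μ) hf hf1
  obtain ⟨g, hgm, hg1, hge⟩ : ∃ g : X → ℝ, Measurable[T.apSigma S p] g ∧
      (∀ x, g x ∈ Set.Icc (0 : ℝ) 1) ∧ g =ᵐ[μ] μ[f | T.apSigma S p] := by
    refine ⟨fun x => max 0 (min 1 ((μ[f | T.apSigma S p]) x)), ?_, fun x => ⟨le_max_left _ _,
      max_le zero_le_one (min_le_left _ _)⟩, ?_⟩
    · exact measurable_const.max (measurable_const.min stronglyMeasurable_condExp.measurable)
    · have h1 := condExp_mono (m := T.apSigma S p) (integrable_const (0 : ℝ)) hfi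
        (Eventually.of_forall fun x => (hf1 x).1)
      have h2 := condExp_mono (m := T.apSigma S p) hfi (integrable_const (1 : ℝ))
        (Eventually.of_forall fun x => (hf1 x).2)
      rw [condExp_const hle] at h1 h2
      filter_upwards [h1, h2] with x h1 h2
      rw [min_eq_right h2, max_eq_right h1]
  have hgm' : Measurable g := hgm.mono hle le_rfl
  have hgi := integrable_of_mem_Icc (μ := μ) hgm' hg1
  have hφ0 : μ[fun x => f x - g x | T.apSigma S p] =ᵐ[μ] 0 := by
    have h1 := condExp_sub hfi hgi (T.apSigma S p)
    have h2 : μ[g | T.apSigma S p] = g :=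
      condExp_of_stronglyMeasurable hle hgm.stronglyMeasurable hgi
    rw [h2] at h1
    refine h1.trans ?_
    filter_upwards [hge] with x hx
    simp [hx]
  have hφ1 : ∀ x, |f x - g x| ≤ 1 := fun x =>
    abs_le.2 ⟨by linarith [(hf1 x).1, (hg1 x).2], by linarith [(hf1 x).2, (hg1 x).1]⟩
  have hST : ∀ h, Measurable fun x => S h (T h x) := fun h =>
    (S.measurable h).comp (T.measurable h)
  have hlim := tendsto_integral_corner_zero hp hTS (φ := fun x => f x - g x) (hf.sub hgm') hφ1 hφ0 hf
    (fun x => abs_le_one_of_mem_Icc (hf1 x)) hf (fun x => abs_le_one_of_mem_Icc (hf1 x))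
  -- If corners in `A` are null for `p`-most `h`, the integral with `g` at the middle vertex is
  -- minus the one with `f - g`, which tends to zero.
  have hlim2 : Tendsto (fun h => ∫ x, f x * (g (T h x) * f (S h (T h x))) ∂μ) p (𝓝 0) := by
    have := hlim.neg
    rw [neg_zero] at this
    refine this.congr' ?_
    filter_upwards [H] with h hh
    have hset : MeasurableSet {x | x ∈ A ∧ T h x ∈ A ∧ S h (T h x) ∈ A} :=
      hA.inter ((T.measurable h hA).inter (hST h hA))
    have h0 : ∫ x, f x * (f (T h x) * f (S h (T h x))) ∂μ = 0 := by
      rw [← hh, ← integral_indicator_one_eq_measureReal hset, hfdef]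
      refine integral_congr_ae (Eventually.of_forall fun x => ?_)
      by_cases h1 : x ∈ A <;> by_cases h2 : T h x ∈ A <;> by_cases h3 : S h (T h x) ∈ A <;>
        simp [h1, h2, h3]
    have i1 : Integrable (fun x => f x * (f (T h x) * f (S h (T h x)))) μ :=
      integrable_of_mem_Icc (hf.mul ((hf.comp (T.measurable h)).mul (hf.comp (hST h)))) fun x =>
        mul_mem_Icc (hf1 _) (mul_mem_Icc (hf1 _) (hf1 _))
    have i2 : Integrable (fun x => f x * (g (T h x) * f (S h (T h x)))) μ :=
      integrable_of_mem_Icc (hf.mul ((hgm'.comp (T.measurable h)).mul (hf.comp (hST h)))) fun x =>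
        mul_mem_Icc (hf1 _) (mul_mem_Icc (hg1 _) (hf1 _))
    have : ∫ x, f x * ((f (T h x) - g (T h x)) * f (S h (T h x))) ∂μ =
        ∫ x, f x * (f (T h x) * f (S h (T h x))) ∂μ -
          ∫ x, f x * (g (T h x) * f (S h (T h x))) ∂μ := by
      rw [← integral_sub i1 i2]
      refine integral_congr_ae (Eventually.of_forall fun x => ?_)
      dsimp only
      ring
    rw [this, h0]
    ring
  set ε := μ.real A / 2 with hε
  have hε0 : 0 < ε := by positivity
  set D : Set X := {x | ε < g x} with hDdef
  have hDap : MeasurableSet[T.apSigma S p] D := measurableSet_lt measurable_const hgm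
  have hDm : MeasurableSet D := hle _ hDap
  have hAP : T.IsAlmostPeriodic S p (D.indicator fun _ => 1) :=
    ((T.isLipschitzClass_isAlmostPeriodic S p).measurableSet_sigma.1 hDap).2
  -- Outside `D` the conditional expectation `g` is at most half the measure of `A`, so at least
  -- half of `A` lies in `D`.
  have hAD : 0 < μ.real (A ∩ D) := by
    have h1 : ∫ x, f x * Dᶜ.indicator (fun _ => (1 : ℝ)) x ∂μ ≤ ε := by
      rw [integral_mul_eq_of_ae_eq_condExp hle hfi hge
        (measurable_const.indicator hDap.compl)
        fun x => abs_le_one_of_mem_Icc (indicator_one_mem_Icc _ x)]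
      have : ∫ x, g x * Dᶜ.indicator (fun _ => (1 : ℝ)) x ∂μ ≤ ∫ x, ε ∂μ := by
        refine integral_mono (integrable_of_mem_Icc (hgm'.mul
          (measurable_const.indicator hDm.compl)) fun x =>
            mul_mem_Icc (hg1 x) (indicator_one_mem_Icc _ x)) (integrable_const _) fun x => ?_
        by_cases hx : x ∈ D
        · simp [hx, hε0.le]
        · simpa [hx] using not_lt.1 hx
      simpa using this
    have h2 : ∫ x, f x * Dᶜ.indicator (fun _ => (1 : ℝ)) x ∂μ = μ.real (A ∩ Dᶜ) := by
      rw [← integral_indicator_one_eq_measureReal (hA.inter hDm.compl), hfdef]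
      refine integral_congr_ae (Eventually.of_forall fun x => ?_)
      by_cases h1 : x ∈ A <;> by_cases h2 : x ∈ D <;> simp [h1, h2]
    have h3 := measureReal_inter_add_sdiff (μ := μ) (s := A) hDm
    rw [Set.sdiff_eq] at h3
    linarith
  refine not_tendsto_integral_corner_zero hp hTS (hA.inter hDm) hDm Set.inter_subset_right hAD
    hAP ?_
  have hlim3 := hlim2.const_mul ε⁻¹
  rw [mul_zero] at hlim3
  refine squeeze_zero (fun h => integral_nonneg fun x => ?_) (fun h => ?_) hlim3
  · exact (mul_mem_Icc (indicator_one_mem_Icc _ _)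
      (mul_mem_Icc (indicator_one_mem_Icc _ _) (indicator_one_mem_Icc _ _))).1
  · rw [← integral_const_mul]
    refine integral_mono_of_nonneg (Eventually.of_forall fun x => ?_)
      ((integrable_of_mem_Icc (hf.mul ((hgm'.comp (T.measurable h)).mul (hf.comp (hST h))))
        fun x => mul_mem_Icc (hf1 _) (mul_mem_Icc (hg1 _) (hf1 _))).const_mul _)
      (Eventually.of_forall fun x => ?_)
    · exact (mul_mem_Icc (indicator_one_mem_Icc _ _)
        (mul_mem_Icc (indicator_one_mem_Icc _ _) (indicator_one_mem_Icc _ _))).1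
    · dsimp only
      have k0 : ∀ x, (A ∩ D).indicator (fun _ => (1 : ℝ)) x ≤ f x := fun x => by
        rw [hfdef]
        exact Set.indicator_le_indicator_of_subset Set.inter_subset_left (fun _ => zero_le_one) x
      have k1 : D.indicator (fun _ => (1 : ℝ)) (T h x) ≤ ε⁻¹ * g (T h x) := by
        by_cases hx : T h x ∈ D
        · rw [Set.indicator_of_mem hx, inv_mul_eq_div, le_div_iff₀ hε0, one_mul]
          exact (show ε < g (T h x) from hx).le
        · rw [Set.indicator_of_notMem hx]
          exact mul_nonneg (inv_nonneg.2 hε0.le) (hg1 _).1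
      calc _ ≤ f x * (ε⁻¹ * g (T h x) * f (S h (T h x))) := by
            refine mul_le_mul (k0 x) (mul_le_mul k1 (k0 _) (indicator_one_mem_Icc _ _).1 ?_)
              (mul_nonneg (indicator_one_mem_Icc _ _).1 (indicator_one_mem_Icc _ _).1) (hf1 x).1
            exact mul_nonneg (inv_nonneg.2 hε0.le) (hg1 _).1
        _ = _ := by ring

end MPAction

end

/-! ### Idempotent ultrafilters on left finite product sets. -/

section Idempotent

theorem decreasingProd_toFinset {G : Type*} [Group G] (x : ℕ → G) {l : List ℕ}
    (hl : l.Pairwise (· > ·)) : decreasingProd x l.toFinset = (l.map x).prod := by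
  have hn : l.Nodup := hl.imp fun h => ne_of_gt h
  rw [decreasingProd, (List.toFinset_sort (· ≥ ·) hn).2 (hl.imp fun h => le_of_lt h)]

/-- Hindman products take indices in increasing order; passing to the opposite group reverses them
to the decreasing order required here. -/
theorem exists_list_of_mem_FP {G : Type*} [Group G] {a : Stream' Gᵐᵒᵖ} {m : Gᵐᵒᵖ}
    (hm : m ∈ Hindman.FP a) : ∃ l : List ℕ, l ≠ [] ∧ l.Pairwise (· > ·) ∧
      m.unop = (l.map fun n => (a.get n).unop).prod := by
  induction hm with
  | head' a => exact ⟨[0], by simp, by simp, by simp [Stream'.head]⟩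
  | tail' a m _ ih =>
    obtain ⟨l, h1, h2, h3⟩ := ih
    refine ⟨l.map Nat.succ, by simpa using h1, ?_, ?_⟩
    · rw [List.pairwise_map]
      exact h2.imp fun h => Nat.succ_lt_succ h
    · rw [h3, List.map_map]
      rfl
  | cons' a m _ ih =>
    obtain ⟨l, h1, h2, h3⟩ := ih
    refine ⟨l.map Nat.succ ++ [0], by simp, ?_, ?_⟩
    · rw [List.pairwise_append, List.pairwise_map]
      refine ⟨h2.imp fun h => Nat.succ_lt_succ h, by simp, ?_⟩
      intro b hb c hc
      obtain ⟨k, -, rfl⟩ := List.mem_map.1 hb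
      rw [List.mem_singleton.1 hc]
      exact Nat.succ_pos k
    · rw [MulOpposite.unop_mul, h3, List.map_append, List.prod_append, List.map_map]
      simp only [List.map_cons, List.map_nil, List.prod_singleton]
      rfl

/-- Every left finite product set belongs to an idempotent ultrafilter. -/
theorem exists_isIdempotentFilter {G : Type*} [Group G] (x : ℕ → G) :
    ∃ p : Ultrafilter G, IsIdempotentFilter p ∧ ∀ᶠ g in (p : Filter G), g ∈ leftFP x := by
  obtain ⟨U, hU, hFP⟩ := Hindman.exists_idempotent_ultrafilter_le_FP
    (M := Gᵐᵒᵖ) (fun n => MulOpposite.op (x n))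
  refine ⟨U.map MulOpposite.unop, fun Q hQ => ?_, ?_⟩
  · have h1 : ∀ᶠ m in (U : Filter Gᵐᵒᵖ), Q m.unop := hQ
    rw [← hU] at h1
    exact (Ultrafilter.eventually_mul U U _).1 h1
  · have : ∀ᶠ m in (U : Filter Gᵐᵒᵖ), m.unop ∈ leftFP x := by
      filter_upwards [hFP] with m hm
      obtain ⟨l, h1, h2, h3⟩ := exists_list_of_mem_FP hm
      refine ⟨l.toFinset, by simpa using h1, ?_⟩
      rw [decreasingProd_toFinset x h2, h3]
      rfl
    exact this

end Idempotent

/-! ### The correspondence between colourings and measure preserving systems. -/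

section Correspondence

variable {G : Type*} [Group G]

open Classical in
theorem abs_sum_mul_right_sub_le (s : Finset G) (g : G) {F : G → ℝ} {C : ℝ}
    (hC : ∀ a, |F a| ≤ C) :
    |∑ a ∈ s, F (a * g) - ∑ a ∈ s, F a| ≤
      2 * C * (s.card - (s ∩ s.image fun a => a * g).card) := by
  set t := s.image fun a => a * g with ht
  have hinj : Function.Injective fun a : G => a * g := mul_left_injective g
  have hcard : t.card = s.card := Finset.card_image_of_injective s hinj
  have h1 : ∑ a ∈ s, F (a * g) = ∑ a ∈ t, F a := by
    rw [ht, Finset.sum_image fun a _ b _ h => hinj h]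
  have h2 : ∑ a ∈ t, F a = ∑ a ∈ t \ s, F a + ∑ a ∈ s ∩ t, F a := by
    rw [add_comm, Finset.inter_comm, Finset.sum_inter_add_sum_sdiff]
  have h3 : ∑ a ∈ s, F a = ∑ a ∈ s \ t, F a + ∑ a ∈ s ∩ t, F a := by
    rw [add_comm, Finset.sum_inter_add_sum_sdiff]
  have hb : ∀ u : Finset G, |∑ a ∈ u, F a| ≤ u.card * C := fun u => by
    refine (Finset.abs_sum_le_sum_abs _ _).trans ?_
    rw [← nsmul_eq_mul]
    exact Finset.sum_le_card_nsmul _ _ _ fun a _ => hC a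
  have c1 : ((t \ s).card : ℝ) = s.card - (s ∩ t).card := by
    have := Finset.card_sdiff_add_card_inter t s
    rw [Finset.inter_comm, hcard] at this
    rw [eq_sub_iff_add_eq]
    exact_mod_cast this
  have c2 : ((s \ t).card : ℝ) = s.card - (s ∩ t).card := by
    have := Finset.card_sdiff_add_card_inter s t
    rw [eq_sub_iff_add_eq]
    exact_mod_cast this
  have b1 := hb (t \ s)
  have b2 := hb (s \ t)
  rw [c1] at b1
  rw [c2] at b2
  rw [h1, h2, h3, add_sub_add_right_eq_sub]
  refine (abs_sub _ _).trans ?_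
  linarith

/-- The uniform measure on the images of a finite family of points. -/
noncomputable def empiricalMeasure {X I : Type*} [MeasurableSpace X] (s : Finset I) (ω : I → X) :
    Measure X := (s.card : ENNReal)⁻¹ • ∑ i ∈ s, Measure.dirac (ω i)

theorem isProbabilityMeasure_empiricalMeasure {X I : Type*} [MeasurableSpace X] {s : Finset I}
    (hs : s.Nonempty) (ω : I → X) : IsProbabilityMeasure (empiricalMeasure s ω) := by
  refine ⟨?_⟩
  simp only [empiricalMeasure, Measure.smul_apply, Measure.finsetSum_apply, measure_univ,
    Finset.sum_const, nsmul_eq_mul, mul_one, smul_eq_mul]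
  exact ENNReal.inv_mul_cancel (by simpa using hs.ne_empty) (ENNReal.natCast_ne_top _)

theorem integral_empiricalMeasure {X I : Type*} [MeasurableSpace X] (s : Finset I) (ω : I → X)
    {f : X → ℝ} (hf : Measurable f) :
    ∫ x, f x ∂(empiricalMeasure s ω) = (s.card : ℝ)⁻¹ * ∑ i ∈ s, f (ω i) := by
  rw [empiricalMeasure, integral_smul_measure, integral_finsetSum_measure]
  · simp_rw [integral_dirac' f _ hf.stronglyMeasurable]
    simp
  · exact fun i _ => integrable_dirac' hf.stronglyMeasurable (by simp)

variable {r : ℕ}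

/-- Translation of a colouring in the first coordinate. -/
def fstShift (g : G) (ω : G × G → Fin r) : G × G → Fin r := fun z => ω (g * z.1, z.2)

/-- Translation of a colouring in the second coordinate. -/
def sndShift (g : G) (ω : G × G → Fin r) : G × G → Fin r := fun z => ω (z.1, g * z.2)

theorem continuous_fstShift (g : G) : Continuous (fstShift (r := r) g) :=
  continuous_pi fun z => continuous_apply (g * z.1, z.2)

theorem continuous_sndShift (g : G) : Continuous (sndShift (r := r) g) :=
  continuous_pi fun z => continuous_apply (z.1, g * z.2)

/-- The orbit of a colouring under translations. -/
def orbitColouring (χ : G × G → Fin r) (i : G × G) : G × G → Fin r :=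
  fun z => χ (i.1 * z.1, i.2 * z.2)

theorem fstShift_orbitColouring (χ : G × G → Fin r) (g : G) (i : G × G) :
    fstShift g (orbitColouring χ i) = orbitColouring χ (i.1 * g, i.2) := by
  funext z
  simp [fstShift, orbitColouring, mul_assoc]

theorem sndShift_orbitColouring (χ : G × G → Fin r) (g : G) (i : G × G) :
    sndShift g (orbitColouring χ i) = orbitColouring χ (i.1, i.2 * g) := by
  funext z
  simp [sndShift, orbitColouring, mul_assoc]

theorem IsRightFolnerSeq.eventually_nonempty {Φ : ℕ → Finset G} (hΦ : IsRightFolnerSeq Φ) :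
    ∀ᶠ n in atTop, (Φ n).Nonempty := by
  filter_upwards [(hΦ 1).eventually (lt_mem_nhds one_pos)] with n hn
  by_contra h
  rw [Finset.not_nonempty_iff_eq_empty] at h
  simp [h] at hn

/-- The averages of a bounded function over a Følner sequence and over its translates agree
asymptotically. -/
theorem IsRightFolnerSeq.tendsto_average_sub {Φ : ℕ → Finset G} (hΦ : IsRightFolnerSeq Φ)
    (hne : ∀ n, (Φ n).Nonempty) (g : G) {F : G → G → ℝ} {C : ℝ} (hC : ∀ a b, |F a b| ≤ C) :
    Tendsto (fun n => ((Φ n).card * (Φ n).card : ℝ)⁻¹ * ∑ b ∈ Φ n, ∑ a ∈ Φ n, F (a * g) b -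
      ((Φ n).card * (Φ n).card : ℝ)⁻¹ * ∑ b ∈ Φ n, ∑ a ∈ Φ n, F a b) atTop (𝓝 0) := by
  classical
  have h := ((hΦ g).const_sub 1).const_mul (2 * C)
  rw [sub_self, mul_zero] at h
  refine squeeze_zero_norm (fun n => ?_) h
  have hpos : (0 : ℝ) < (Φ n).card := by exact_mod_cast (hne n).card_pos
  rw [← mul_sub, ← Finset.sum_sub_distrib, Real.norm_eq_abs, abs_mul,
    abs_of_pos (by positivity : (0 : ℝ) < ((Φ n).card * (Φ n).card : ℝ)⁻¹),
    inv_mul_le_iff₀ (by positivity)]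
  have h1 : |∑ b ∈ Φ n, (∑ a ∈ Φ n, F (a * g) b - ∑ a ∈ Φ n, F a b)| ≤
      (Φ n).card * (2 * C * ((Φ n).card - (Φ n ∩ (Φ n).image fun a => a * g).card)) := by
    refine (Finset.abs_sum_le_sum_abs _ _).trans ?_
    rw [← nsmul_eq_mul]
    exact Finset.sum_le_card_nsmul _ _ _ fun b _ =>
      abs_sum_mul_right_sub_le (Φ n) g (F := fun a => F a b) fun a => hC a b
  refine h1.trans (le_of_eq ?_)
  field_simp

/-- A colouring of `G × G` generates a measure preserving system. -/
theorem exists_invariant_measure [Countable G] {Φ : ℕ → Finset G} (hΦ : IsRightFolnerSeq Φ)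
    (hne : ∀ n, (Φ n).Nonempty) (χ : G × G → Fin r) :
    ∃ μ : Measure (G × G → Fin r), IsProbabilityMeasure μ ∧
      (∀ g, MeasurePreserving (fstShift g) μ μ) ∧ (∀ g, MeasurePreserving (sndShift g) μ μ) ∧
      ∀ E, IsClopen E → μ E ≠ 0 → ∃ i, orbitColouring χ i ∈ E := by
  have hne2 : ∀ n, (Φ n ×ˢ Φ n).Nonempty := fun n => (hne n).product (hne n)
  let ν : ℕ → ProbabilityMeasure (G × G → Fin r) := fun n =>
    ⟨empiricalMeasure (Φ n ×ˢ Φ n) (orbitColouring χ),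
      isProbabilityMeasure_empiricalMeasure (hne2 n) _⟩
  -- The measure is a weak limit of uniform measures on orbit pieces indexed by `Φ n ×ˢ Φ n`. Shifts
  -- act on the index by right multiplication, so the Følner property yields invariance.
  obtain ⟨μ, -, hμ⟩ := isCompact_univ.ultrafilter_le_nhds ((hyperfilter ℕ).map ν) (by simp)
  have hμ' : Tendsto ν (hyperfilter ℕ) (𝓝 μ) := hμ
  have hint : ∀ f : BoundedContinuousFunction (G × G → Fin r) ℝ,
      Tendsto (fun n => ((Φ n).card * (Φ n).card : ℝ)⁻¹ * ∑ i ∈ Φ n ×ˢ Φ n,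
        f (orbitColouring χ i)) (hyperfilter ℕ) (𝓝 (∫ x, f x ∂(μ : Measure (G × G → Fin r)))) := by
    intro f
    refine (ProbabilityMeasure.tendsto_iff_forall_integral_tendsto.1 hμ' f).congr fun n => ?_
    change ∫ x, f x ∂(empiricalMeasure _ _) = _
    rw [integral_empiricalMeasure _ _ f.continuous.measurable]
    simp
  have hinv : ∀ (τ : (G × G → Fin r) → G × G → Fin r), Continuous τ →
      (∀ f : BoundedContinuousFunction (G × G → Fin r) ℝ,
        Tendsto (fun n => ((Φ n).card * (Φ n).card : ℝ)⁻¹ * ∑ i ∈ Φ n ×ˢ Φ n,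
          f (τ (orbitColouring χ i)) - ((Φ n).card * (Φ n).card : ℝ)⁻¹ * ∑ i ∈ Φ n ×ˢ Φ n,
          f (orbitColouring χ i)) atTop (𝓝 0)) →
      MeasurePreserving τ (μ : Measure (G × G → Fin r)) μ := by
    intro τ hτ h
    refine ⟨hτ.measurable, ?_⟩
    have : IsFiniteMeasure (Measure.map τ (μ : Measure (G × G → Fin r))) :=
      Measure.isFiniteMeasure_map _ _
    refine ext_of_forall_integral_eq_of_IsFiniteMeasure fun f => ?_
    rw [integral_map hτ.measurable.aemeasurable f.continuous.measurable.aestronglyMeasurable]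
    have h1 := (hint (f.compContinuous ⟨τ, hτ⟩)).sub (hint f)
    have h2 := tendsto_nhds_unique h1
      ((h f).mono_left (by rw [← Nat.cofinite_eq_atTop]; exact hyperfilter_le_cofinite))
    exact sub_eq_zero.1 h2
  refine ⟨μ, inferInstance, fun g => hinv _ (continuous_fstShift g) fun f => ?_,
    fun g => hinv _ (continuous_sndShift g) fun f => ?_, ?_⟩
  · refine (hΦ.tendsto_average_sub hne g (F := fun a b => f (orbitColouring χ (a, b)))
      (C := ‖f‖) fun a b => f.norm_coe_le_norm _).congr fun n => ?_
    simp only [fstShift_orbitColouring, Finset.sum_product_right]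
  · refine (hΦ.tendsto_average_sub hne g (F := fun a b => f (orbitColouring χ (b, a)))
      (C := ‖f‖) fun a b => f.norm_coe_le_norm _).congr fun n => ?_
    simp only [sndShift_orbitColouring, Finset.sum_product]
  · intro E hE hE0
    -- On clopen sets the measures themselves converge, so a set missed by the whole orbit has
    -- measure zero.
    by_contra! H
    have h1 := ProbabilityMeasure.tendsto_measure_of_isClopen_of_tendsto hμ' hE
    have h2 : ∀ n, ν n E = 0 := fun n => by
      have : (ν n : Measure (G × G → Fin r)) E = 0 := by
        change empiricalMeasure _ _ E = 0
        simp [empiricalMeasure, Measure.dirac_apply' _ hE.2.measurableSet, H]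
      simp [this]
    simp only [h2] at h1
    have h3 := tendsto_nhds_unique h1 tendsto_const_nhds
    rw [ProbabilityMeasure.null_iff_toMeasure_null] at h3
    exact hE0 h3

end Correspondence

/-! ### Conclusion for colourings. -/

theorem theorem1 {G : Type*} [Group G] [Countable G] (hG : IsAmenableGroup G)
    (r : ℕ) (C : Fin r → Set (G × G))
    (hdisj : Pairwise (fun i j => Disjoint (C i) (C j)))
    (hcover : (⋃ j, C j) = Set.univ) :
    ∃ j : Fin r, IsLeftIPStar
      {g : G | ∃ x y : G, ({(x, y), (x * g, y), (x * g, y * g)} : Set (G × G)) ⊆ C j} := by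
  obtain ⟨Φ, hΦ⟩ := hG
  obtain ⟨N, hN⟩ := eventually_atTop.1 hΦ.eventually_nonempty
  -- Finitely many Følner sets may be empty; shifting the sequence discards them.
  have hΦ' : IsRightFolnerSeq fun n => Φ (n + N) := fun g => (tendsto_add_atTop_iff_nat N).2 (hΦ g)
  have hχ : ∀ z : G × G, ∃ j, z ∈ C j := fun z => by
    rw [← Set.mem_iUnion, hcover]
    trivial
  choose χ hχ using hχ
  obtain ⟨μ, hμ, h1, h2, h3⟩ := exists_invariant_measure hΦ' (fun n => hN _ (by omega)) χ
  let T : MPAction G μ :=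
    ⟨fstShift, h1, fun g h ω => by funext z; simp [fstShift, mul_assoc],
      fun ω => by funext z; simp [fstShift]⟩
  let S : MPAction G μ :=
    ⟨sndShift, h2, fun g h ω => by funext z; simp [sndShift, mul_assoc],
      fun ω => by funext z; simp [sndShift]⟩
  have hTS : T.Commute S := fun g h ω => rfl
  have hclopen : ∀ j, IsClopen {ω : G × G → Fin r | ω (1, 1) = j} := fun j =>
    (isClopen_discrete {j}).preimage (continuous_apply (1, 1))
  -- The colour depends only on the measure and is chosen before any IP set is given, so it serves
  -- all of them.
  obtain ⟨j, hj⟩ : ∃ j, μ {ω : G × G → Fin r | ω (1, 1) = j} ≠ 0 := by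
    by_contra! H
    have h4 : μ (⋃ j, {ω : G × G → Fin r | ω (1, 1) = j}) = 0 := measure_iUnion_null H
    have h5 : (⋃ j, {ω : G × G → Fin r | ω (1, 1) = j}) = Set.univ :=
      Set.eq_univ_of_forall fun ω => Set.mem_iUnion.2 ⟨ω (1, 1), rfl⟩
    rw [h5, measure_univ] at h4
    exact one_ne_zero h4
  refine ⟨j, fun Y hY => ?_⟩
  obtain ⟨x, hx⟩ := hY
  obtain ⟨p, hp, hpx⟩ := exists_isIdempotentFilter x
  have hrec := MPAction.frequently_measureReal_corner_ne_zero hp hTS (hclopen j).2.measurableSet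
    (ENNReal.toReal_pos hj (measure_ne_top _ _))
  rw [← Ultrafilter.eventually_not] at hrec
  obtain ⟨g, hg, hgx⟩ := (hrec.and hpx).exists
  refine ⟨g, ?_, hx hgx⟩
  -- The corner event is clopen of positive measure, so some translate of the original colouring
  -- lies in it; its index `(a, b)` is the vertex of a monochromatic corner.
  obtain ⟨⟨a, b⟩, k1, k2, k3⟩ := h3 _
    ((hclopen j).inter (((hclopen j).preimage (continuous_fstShift g)).inter
      ((hclopen j).preimage ((continuous_sndShift g).comp (continuous_fstShift g)))))
    fun h0 => hg (by
      rw [measureReal_def]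
      exact (congrArg ENNReal.toReal h0).trans rfl)
  have l1 : χ (a, b) = j := by simpa [orbitColouring] using k1
  have l2 : χ (a * g, b) = j := by
    have : fstShift g (orbitColouring χ (a, b)) (1, 1) = j := k2
    simpa [fstShift_orbitColouring, orbitColouring] using this
  have l3 : χ (a * g, b * g) = j := by
    have : sndShift g (fstShift g (orbitColouring χ (a, b))) (1, 1) = j := k3
    simpa [fstShift_orbitColouring, sndShift_orbitColouring, orbitColouring] using this
  refine ⟨a, b, ?_⟩
  rintro z (rfl | rfl | rfl)
  · exact l1 ▸ hχ _
  · exact l2 ▸ hχ _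
  · exact l3 ▸ hχ _
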